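/- \textbf{Setting.} Let $n,m\ge 1$. A weight on $\mathbb R^n$ is a locally integrable function that is positive almost everywhere, and $\omega(E)=\int_E\omega$. $A_r$ $(1\le r<\infty)$ are the Muckenhoupt classes and $A_\infty=\bigcup_{r\ge1}A_r$. For $1\le r_1,\dots,r_m<\infty$ and $1/r=\sum_j 1/r_j$, $\vec\omega=(\omega_1,\dots,\omega_m)\in A_{(r_1,\dots,r_m)}$ means that $$\sup_B\Big(\frac1{|B|}\int_B\prod_{j=1}^m\omega_j^{r/r_j}\Big)^{1/r}\prod_{j=1}^m\Big(\frac1{|B|}\int_B\omega_j^{1-r_j'}\Big)^{1/r_j'}<\infty$$ over all balls $B$, where the $j$-th factor is read as $(\operatorname{ess\,inf}_B\omega_j)^{-1}$ if $r_j=1$. For a weight $\omega$ and $0<q\le\alpha\le p\le\infty$, the space $(L^q(\omega),L^p)^\alpha$ consists of the measurable functions $f$ with $$\|f\|_{(L^q(\omega),L^p)^\alpha}=\sup_{r>0}\Big\|\,\omega(B(y,r))^{\frac1\alpha-\frac1q-\frac1p}\,\|f\chi_{B(y,r)}\|_{L^q(\omega)}\Big\|_{L^p(dy)}<\infty .$$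 Further $\|b\|_{BMO}=\sup_B\frac1{|B|}\int_B|b-b_B|$ with $b_B=\frac1{|B|}\int_Bb$. Functions are real or complex valued. \textbf{Hypotheses.} Let $1\le s<q_j\le\alpha_j<p_j\le\infty$ $(j=1,\dots,m)$, $\frac1q=\sum_j\frac1{q_j}$, $\frac1\alpha=\sum_j\frac1{\alpha_j}$, $\frac1p=\sum_j\frac1{p_j}$, with $\frac q{q_j}=\frac\alpha{\alpha_j}=\frac p{p_j}$ for all $j$ (the condition on $p/p_j$ being void if $p=\infty$, when all $p_j=\infty$). Let $\vec\omega\in A_{(q_1/s,\dots,q_m/s)}$ with every $\omega_j\in A_\infty$, and put $\nu_{\vec\omega}=\prod_j\omega_j^{q/q_j}$. Let $D_1,\dots,D_m$ be linear spaces of measurable functions stable under multiplication by characteristic functions of balls, and let $\mathcal T$ be an operator on $D_1\times\dots\times D_m$ with measurable values which satisfies, for some $C_1$: for all $f_j\in D_j$, every ball $B$, every nonempty $\sigma\subseteq\{1,\dots,m\}$ with complement $\sigma^c$, and almost every $x\in B$, $$|\mathcal T(\vec f^{\sigma})(x)|\le C_1\prod_{j\in\sigma^c}\Big(\frac1{|2B|}\int_{2B}|f_j|^s\Big)^{1/s}\sum_{k=1}^\infty\frac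 k{2^{nk|\sigma^c|}}\prod_{j\in\sigma}\Big(\frac1{|2^{k+1}B|}\int_{2^{k+1}B\setminus2^kB}|f_j|^s\Big)^{1/s},$$ where $f^\sigma_j=f_j\chi_{\mathbb R^n\setminus 2B}$ for $j\in\sigma$ and $f_j^\sigma=f_j\chi_{2B}$ for $j\in\sigma^c$. Let $b_1,\dots,b_m\in BMO$. Assume one of the following. (a) $\mathcal T$ is $m$-linear (identities between values of $\mathcal T$ being understood almost everywhere), and $\mathcal T_{\Pi\vec b}=[b_1,[b_2,\dots[b_m,\mathcal T]_m\dots]_2]_1$, where $[b,U]_j(\vec f)=b\,U(\vec f)-U(f_1,\dots,bf_j,\dots,f_m)$. (b) $\mathcal T$ is $m$-sublinear: in each variable, at every point $x$, $|\mathcal T(\dots,g+h,\dots)|\le|\mathcal T(\dots,g,\dots)|+|\mathcal T(\dots,h,\dots)|$ and $|\mathcal T(\dots,cg,\dots)|=|c||\mathcal T(\dots,g,\dots)|$ (the value $|\mathcal T(\vec f)(x)|=\infty$ is allowed), and $$|\mathcal T_{\Pi\vec b}(\vec f)(x)|=\big|\mathcal T\big((b_1(x)-b_1)f_1,\dots,(b_m(x)-b_m)f_m\big)(x)\big|$$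 is measurable in $x$. (For $\mathcal T$ linear this is the iterated commutator of (a).) In both cases $\mathcal T_{\Pi\vec b}$ acts on the tuples $\vec f$ with $f_j\in D_j$ and $b_jf_j\in D_j$ for all $j$. \textbf{Theorem.} If $\mathcal T_{\Pi\vec b}$ is bounded from $L^{q_1}(\omega_1)\times\dots\times L^{q_m}(\omega_m)$ to $L^q(\nu_{\vec\omega})$ with constant $K$, then it is bounded from $(L^{q_1}(\omega_1),L^{p_1})^{\alpha_1}\times\dots\times(L^{q_m}(\omega_m),L^{p_m})^{\alpha_m}$ to $(L^q(\nu_{\vec\omega}),L^p)^\alpha$, and $$\|\mathcal T_{\Pi\vec b}(\vec f)\|_{(L^q(\nu_{\vec\omega}),L^p)^\alpha}\le C\Big(K+\prod_{j=1}^m\|b_j\|_{BMO}\Big)\prod_{j=1}^m\|f_j\|_{(L^{q_j}(\omega_j),L^{p_j})^{\alpha_j}},$$ where $C$ depends only on $n$, $m$, the exponents, $\vec\omega$ and $C_1$. In particular, the bound is $\lesssim\prod_j\|b_j\|_{BMO}$ whenever $K\lesssim\prod_j\|b_j\|_{BMO}$. -/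

import Mathlib

open MeasureTheory Metric
open scoped ENNReal NNReal

noncomputable section

namespace Amalgam

/-- The Euclidean space `ℝⁿ`. -/
abbrev E (n : ℕ) : Type := EuclideanSpace ℝ (Fin n)

/-! ### Weights -/

/-- A weight: a locally integrable function that is positive almost everywhere. -/
structure IsWeight {n : ℕ} (ω : E n → ℝ) : Prop where
  locallyIntegrable : LocallyIntegrable ω volume
  pos : ∀ᵐ x, 0 < ω x

/-- The measure `ω(x) dx`. -/
def weightMeasure {n : ℕ} (ω : E n → ℝ) : Measure (E n) :=
  volume.withDensity fun x => ENNReal.ofReal (ω x)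

/-- The mean value `|B|⁻¹ ∫_B g` over `B = B(x, r)` of a `[0, ∞]`-valued function. -/
def ballMean {n : ℕ} (g : E n → ℝ≥0∞) (x : E n) (r : ℝ) : ℝ≥0∞ :=
  (volume (ball x r))⁻¹ * ∫⁻ y in ball x r, g y

/-- The factor `(|B|⁻¹ ∫_B ω ^ (1 - p'))^(1 / p')`, `p' = p / (p - 1)`, of the Muckenhoupt
conditions, read as `(ess inf_B ω)⁻¹` when `p = 1`. Powers are taken in `[0, ∞]`. -/
def dualFactor {n : ℕ} (p : ℝ) (ω : E n → ℝ) (x : E n) (r : ℝ) : ℝ≥0∞ :=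
  if p = 1 then
    (essInf (fun y => ENNReal.ofReal (ω y)) (volume.restrict (ball x r)))⁻¹
  else
    (ballMean (fun y => ENNReal.ofReal (ω y) ^ (1 - p / (p - 1))) x r) ^ (1 / (p / (p - 1)))

/-- The Muckenhoupt class `A_p`, `1 ≤ p < ∞`. -/
def MemAp {n : ℕ} (p : ℝ) (ω : E n → ℝ) : Prop :=
  IsWeight ω ∧
    (⨆ (x : E n) (r : ℝ) (_ : 0 < r),
      (ballMean (fun y => ENNReal.ofReal (ω y)) x r) ^ (1 / p) * dualFactor p ω x r) < ∞

/-- The class `A_∞`, the union of the classes `A_p`, `1 ≤ p < ∞`. -/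
def MemAInfty {n : ℕ} (ω : E n → ℝ) : Prop :=
  ∃ p : ℝ, 1 ≤ p ∧ MemAp p ω

/-- The weight `ν_ω = ∏_j ω_j ^ (p / p_j)`. -/
def multiWeight {n m : ℕ} (p : ℝ) (P : Fin m → ℝ) (ω : Fin m → E n → ℝ) : E n → ℝ :=
  fun x => ∏ j, ω j x ^ (p / P j)

/-- The exponent `p` with `1 / p = ∑_j 1 / p_j`. -/
def harmonicExponent {m : ℕ} (P : Fin m → ℝ) : ℝ :=
  1 / ∑ j, 1 / P j

/-- The class `A_{(p_1, …, p_m)}` of multiple weights, `1 ≤ p_1, …, p_m < ∞`. -/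
def MemAVec {n m : ℕ} (P : Fin m → ℝ) (ω : Fin m → E n → ℝ) : Prop :=
  (∀ j, IsWeight (ω j)) ∧
    (⨆ (x : E n) (r : ℝ) (_ : 0 < r),
      (ballMean (fun y => ENNReal.ofReal (multiWeight (harmonicExponent P) P ω y)) x r)
          ^ (1 / harmonicExponent P) *
        ∏ j, dualFactor (P j) (ω j) x r) < ∞

/-! ### Function spaces -/

/-- The norm `‖f‖_{(L^q(ω₁, ω₂), L^p)^α}`; functions may take values in `[0, ∞]`. With `1 / ∞ = 0`,
the inner `eLpNorm` is `‖f χ_{B(y, r)}‖_{L^q(ω₂)}`, and the outer one is the `L^p(dy)`-norm, which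
is the essential supremum for `p = ∞`. -/
def amalgamNorm {n : ℕ} {ε : Type*} [ENorm ε] (q p α : ℝ≥0∞) (ω₁ ω₂ : E n → ℝ) (f : E n → ε) :
    ℝ≥0∞ :=
  ⨆ (r : ℝ) (_ : 0 < r),
    eLpNorm (fun y : E n =>
      (weightMeasure ω₁ (ball y r)) ^ (1 / α.toReal - 1 / q.toReal - 1 / p.toReal) *
        eLpNorm f q ((weightMeasure ω₂).restrict (ball y r))) p volume

/-- Membership in `(L^q(ω), L^p)^α = (L^q(ω, ω), L^p)^α`. -/
def MemAmalgam {n : ℕ} {ε : Type*} [TopologicalSpace ε] [ENorm ε] (q p α : ℝ≥0∞) (ω : E n → ℝ)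
    (f : E n → ε) : Prop :=
  AEStronglyMeasurable f volume ∧ amalgamNorm q p α ω ω f < ∞

variable {𝕜 : Type*} [RCLike 𝕜]

/-- The BMO (semi)norm `sup_B |B|⁻¹ ∫_B |b - b_B|`. -/
def bmoNorm {n : ℕ} (b : E n → 𝕜) : ℝ≥0∞ :=
  ⨆ (x : E n) (r : ℝ) (_ : 0 < r), ballMean (fun y => ‖b y - ⨍ z in ball x r, b z‖ₑ) x r

/-- The space BMO. -/
def MemBMO {n : ℕ} (b : E n → 𝕜) : Prop :=
  LocallyIntegrable b volume ∧ bmoNorm b < ∞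

/-! ### Multilinear and multi-sublinear operators and their iterated commutators -/

/-- The operators below act on `D_1 × ⋯ × D_m`, each `D_j` being a linear space of measurable
functions that is stable under truncation to balls (and so to complements of balls). -/
structure IsOperatorDomain {n m : ℕ} (D : Fin m → Submodule 𝕜 (E n → 𝕜)) : Prop where
  aestronglyMeasurable : ∀ j, ∀ f ∈ D j, AEStronglyMeasurable f volume
  indicator_ball : ∀ j, ∀ f ∈ D j, ∀ (x : E n) (r : ℝ), (ball x r).indicator f ∈ D j

/-- `T` is an `m`-linear operator from `D_1 × ⋯ × D_m` to the measurable functions modulo equality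
almost everywhere. -/
structure IsMultilinearOn {n m : ℕ} (D : Fin m → Submodule 𝕜 (E n → 𝕜))
    (T : (Fin m → E n → 𝕜) → E n → 𝕜) : Prop where
  aestronglyMeasurable : ∀ f, (∀ j, f j ∈ D j) → AEStronglyMeasurable (T f) volume
  map_add : ∀ f, (∀ j, f j ∈ D j) → ∀ i, ∀ g ∈ D i, ∀ h ∈ D i, ∀ᵐ x,
    T (Function.update f i (g + h)) x =
      T (Function.update f i g) x + T (Function.update f i h) x
  map_smul : ∀ f, (∀ j, f j ∈ D j) → ∀ i, ∀ g ∈ D i, ∀ c : 𝕜, ∀ᵐ x,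
    T (Function.update f i (c • g)) x = c * T (Function.update f i g) x

/-- `S f = |T f|` for an `m`-sublinear operator `T` on `D_1 × ⋯ × D_m`. Only the absolute value of
`T f` matters; it may be infinite at some points (square functions, maximal operators). -/
structure IsMultisublinearOn {n m : ℕ} (D : Fin m → Submodule 𝕜 (E n → 𝕜))
    (S : (Fin m → E n → 𝕜) → E n → ℝ≥0∞) : Prop where
  aestronglyMeasurable : ∀ f, (∀ j, f j ∈ D j) → AEStronglyMeasurable (S f) volume
  map_add_le : ∀ f, (∀ j, f j ∈ D j) → ∀ i, ∀ g ∈ D i, ∀ h ∈ D i, ∀ x,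
    S (Function.update f i (g + h)) x ≤
      S (Function.update f i g) x + S (Function.update f i h) x
  map_smul : ∀ f, (∀ j, f j ∈ D j) → ∀ i, ∀ g ∈ D i, ∀ c : 𝕜, ∀ x,
    S (Function.update f i (c • g)) x = ‖c‖ₑ * S (Function.update f i g) x

/-- The tuple with entries `f_j χ_{2B}` for `j ∉ σ` and `f_j χ_{(2B)ᶜ}` for `j ∈ σ`, where
`B = B(x₀, r)`. -/
def splitTuple {n m : ℕ} (f : Fin m → E n → 𝕜) (σ : Finset (Fin m)) (x₀ : E n) (r : ℝ) :
    Fin m → E n → 𝕜 :=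
  fun j => if j ∈ σ then (ball x₀ (2 * r))ᶜ.indicator (f j)
    else (ball x₀ (2 * r)).indicator (f j)

/-- The local size condition, with `S f = |T f|`: for all `f` in the domain, all balls
`B = B(x₀, r)`, all nonempty `σ ⊆ {1, …, m}` and almost every `x ∈ B`,
`|T (splitTuple f σ)(x)| ≤ C₁ ∏_{j ∉ σ} (|2B|⁻¹ ∫_{2B} |f_j|^s)^{1/s}
  ∑_{k ≥ 1} k 2^{-nk|σᶜ|} ∏_{j ∈ σ} (|2^{k+1}B|⁻¹ ∫_{2^{k+1}B ∖ 2^k B} |f_j|^s)^{1/s}`.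
The term `k = 0` in the sum below is zero. -/
def SizeCondition {n m : ℕ} (D : Fin m → Submodule 𝕜 (E n → 𝕜))
    (S : (Fin m → E n → 𝕜) → E n → ℝ≥0∞) (s : ℝ) (C₁ : ℝ≥0) : Prop :=
  ∀ f : Fin m → E n → 𝕜, (∀ j, f j ∈ D j) → ∀ (x₀ : E n) (r : ℝ), 0 < r →
    ∀ σ : Finset (Fin m), σ.Nonempty → ∀ᵐ x ∂(volume.restrict (ball x₀ r)),
      S (splitTuple f σ x₀ r) x ≤
        C₁ * (∏ j ∈ σᶜ, (ballMean (fun z => ‖f j z‖ₑ ^ s) x₀ (2 * r)) ^ (1 / s)) *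
          ∑' k : ℕ, (k : ℝ≥0∞) / 2 ^ (n * k * σᶜ.card) *
            ∏ j ∈ σ, ((volume (ball x₀ (2 ^ (k + 1) * r)))⁻¹ *
              ∫⁻ z in ball x₀ (2 ^ (k + 1) * r) \ ball x₀ (2 ^ k * r), ‖f j z‖ₑ ^ s) ^ (1 / s)

/-- `[b, T]_i (f) = b T(f) - T(f_1, …, b f_i, …, f_m)`. -/
def commutator {n m : ℕ} (i : Fin m) (b : E n → 𝕜) (T : (Fin m → E n → 𝕜) → E n → 𝕜) :
    (Fin m → E n → 𝕜) → E n → 𝕜 :=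
  fun f x => b x * T f x - T (Function.update f i (b * f i)) x

/-- `T_{Πb} = [b_1, [b_2, … [b_m, T]_m … ]_2]_1`. -/
def iteratedCommutator {n m : ℕ} (b : Fin m → E n → 𝕜) (T : (Fin m → E n → 𝕜) → E n → 𝕜) :
    (Fin m → E n → 𝕜) → E n → 𝕜 :=
  (List.finRange m).foldr (fun i U => commutator i (b i) U) T

/-- `|T_{Πb} f|` for a sublinear `T` with `|T f| = S f`:
`T_{Πb}(f)(x) = T((b_1(x) - b_1) f_1, …, (b_m(x) - b_m) f_m)(x)`. For a linear `T` this is the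
iterated commutator above, expanded. -/
def sublinearIteratedCommutator {n m : ℕ} (b : Fin m → E n → 𝕜)
    (S : (Fin m → E n → 𝕜) → E n → ℝ≥0∞) : (Fin m → E n → 𝕜) → E n → ℝ≥0∞ :=
  fun f x => S (fun j z => (b j x - b j z) * f j z) x

/-- The tuples `f` to which the iterated commutator with symbols `b` of an operator on
`D_1 × ⋯ × D_m` applies: `f_j` and `b_j f_j` lie in `D_j`. -/
def commutatorDomain {n m : ℕ} (D : Fin m → Submodule 𝕜 (E n → 𝕜)) (b : Fin m → E n → 𝕜) :
    Set (Fin m → E n → 𝕜) :=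
  {f | ∀ j, f j ∈ D j ∧ b j * f j ∈ D j}

/-! ### Boundedness -/

/-- `U`, defined on `dom`, is bounded from `L^{q_1}(ω_1) × ⋯ × L^{q_m}(ω_m)` to `L^q(ν)` with
constant `K`. -/
def LebesgueBounded {n m : ℕ} {ε : Type*} [TopologicalSpace ε] [ContinuousENorm ε]
    (dom : Set (Fin m → E n → 𝕜)) (U : (Fin m → E n → 𝕜) → E n → ε)
    (Q : Fin m → ℝ≥0∞) (q : ℝ≥0∞) (ω : Fin m → E n → ℝ) (ν : E n → ℝ) (K : ℝ≥0∞) : Prop :=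
  ∀ f ∈ dom, (∀ j, MemLp (f j) (Q j) (weightMeasure (ω j))) →
    MemLp (U f) q (weightMeasure ν) ∧
      eLpNorm (U f) q (weightMeasure ν) ≤ K * ∏ j, eLpNorm (f j) (Q j) (weightMeasure (ω j))

/-- `U`, defined on `dom`, is bounded from
`(L^{q_1}(ω_1), L^{p_1})^{α_1} × ⋯ × (L^{q_m}(ω_m), L^{p_m})^{α_m}` to `(L^q(ν), L^p)^α` with
constant `K`. -/
def AmalgamBounded {n m : ℕ} {ε : Type*} [TopologicalSpace ε] [ContinuousENorm ε]
    (dom : Set (Fin m → E n → 𝕜)) (U : (Fin m → E n → 𝕜) → E n → ε)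
    (Q P A : Fin m → ℝ≥0∞) (q p α : ℝ≥0∞) (ω : Fin m → E n → ℝ) (ν : E n → ℝ) (K : ℝ≥0∞) :
    Prop :=
  ∀ f ∈ dom, (∀ j, MemAmalgam (Q j) (P j) (A j) (ω j) (f j)) →
    MemAmalgam q p α ν (U f) ∧
      amalgamNorm q p α ν ν (U f) ≤
        K * ∏ j, amalgamNorm (Q j) (P j) (A j) (ω j) (ω j) (f j)

end Amalgam

end

noncomputable section

namespace Amalgam

/-! ### Preliminaries on balls and on `[0, ∞]` -/

/-! Fix a ball $B=B(y,r)$ and split every $f_j$ into $f_j\chi_{2B}$ and the rest. The tuple of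
purely local pieces is handled by the assumed Lebesgue bound, which contributes $K$. In every other
tuple write $b_j(x)-b_j=(b_j(x)-c_j)-(b_j-c_j)$ with $c_j$ the mean of $b_j$ over $B$ and expand
(`HasLocalExpansion`). The size condition bounds the result by averages of $|f_j|^s$ or
$|(b_j-c_j)f_j|^s$ over $2^kB$. Hölder's inequality against the dual weight $\omega_j^{1-(q_j/s)'}$
separates $\|f_j\chi_{2^kB}\|_{L^{q_j}(\omega_j)}$ from an oscillation of $b_j$ with respect to the
dual measure. A weighted John–Nirenberg inequality (`IsAInftyMeasure.exists_oscillation_bound`)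
bounds that oscillation by $(k+1)\|b_j\|_{BMO}$. The vector weight condition turns the remaining
product of volumes and dual measures into $\nu(2^kB)^{-1/q}$. The factors $|b_j(x)-c_j|$ are
integrated over $B$ by John–Nirenberg for $\nu$. This gives `exists_local_bound`: $$\|\mathcal
T_{\Pi\vec b}\vec f\|_{L^q(\nu,B)}\le
C\Big(K+\prod_j\|b_j\|\Big)\nu(B)^{1/q}\sum_k(k+1)^{m+1}\nu(2^kB)^{-1/q}\prod_j\|f_j\chi_{2^kB}\|_{L^{q_j}(\omega_j)}.$$

Now multiply by $\nu(B)^\beta$, $\beta=1/\alpha-1/q-1/p\le0$. Since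
$\delta=\beta+1/q=1/\alpha-1/p>0$, reverse doubling gives $\nu(B)^\delta\le\kappa^{\delta
k}\nu(2^kB)^\delta$ with $\kappa<1$, so the series converges geometrically and $\nu(2^kB)^\beta$ is
left over. As $\beta\le0$ and all $\omega_j\in A_\infty$, a reverse Hölder inequality
(`exists_prod_rpow_le`) distributes it as $\prod_j\omega_j(2^kB)^{\beta q/q_j}$. The proportionality
of the exponents makes $\beta q/q_j=1/\alpha_j-1/q_j-1/p_j$, the power in the norm of $f_j$.
Hölder's inequality in $L^p(dy)$ and summation over $k$ conclude.

The facts on weights come from a single device: if $\prod_iw_i^{e_i}=1$ with $\sum_ie_i=1$, then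
$|S|\le\prod_i(\int_Sw_i)^{e_i}$ for all $S$. The converse bound on balls, which is the weight
condition, then forces every $w_i$ to be of $A_\infty$ type. -/

lemma volume_ball_pos' {n : ℕ} (x : E n) {r : ℝ} (hr : 0 < r) : volume (ball x r) ≠ 0 :=
  (measure_ball_pos volume x hr).ne'

lemma volume_ball_ne_top' {n : ℕ} (x : E n) (r : ℝ) : volume (ball x r) ≠ ∞ :=
  measure_ball_lt_top.ne

lemma volume_ball_mul {n : ℕ} (x y : E n) {c : ℝ} (hc : 0 < c) (r : ℝ) :
    volume (ball x (c * r)) = ENNReal.ofReal (c ^ n) * volume (ball y r) := by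
  rw [Measure.addHaar_ball_mul_of_pos volume x hc r, finrank_euclideanSpace_fin,
    Measure.addHaar_ball_center volume y r]

lemma ENNReal.mul_le_mul_right_iff_of_ne {a b c : ℝ≥0∞} (h0 : c ≠ 0) (ht : c ≠ ∞)
    (h : a * c ≤ b * c) : a ≤ b :=
  (ENNReal.mul_le_mul_iff_left h0 ht).1 h

lemma ENNReal.le_rpow_inv_mul_of_rpow_le {a b C : ℝ≥0∞} {t : ℝ} (ht : 0 < t)
    (h : a ^ t ≤ C * b ^ t) : a ≤ C ^ t⁻¹ * b := by
  have := ENNReal.rpow_le_rpow h (inv_pos.2 ht).le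
  rwa [ENNReal.mul_rpow_of_nonneg _ _ (inv_pos.2 ht).le, ENNReal.rpow_rpow_inv ht.ne',
    ENNReal.rpow_rpow_inv ht.ne'] at this

/-! ### Measures of Muckenhoupt type -/

/-- A quantitative form of the `A_∞` condition for a measure. -/
structure IsAInftyMeasure {n : ℕ} (μ : Measure (E n)) : Prop where
  ac : μ ≪ volume
  ball_ne_top : ∀ x r, μ (ball x r) ≠ ∞
  exists_bound : ∃ (C : ℝ≥0∞) (t : ℝ), C ≠ ∞ ∧ 0 < t ∧ ∀ (x : E n) (r : ℝ), 0 < r →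
    ∀ S ⊆ ball x r, MeasurableSet S →
      volume S * μ (ball x r) ^ t ≤ C * μ S ^ t * volume (ball x r)

/-! ### Families of weights linked by Hölder's inequality -/

section Holder

variable {n : ℕ} {ι : Type*} [Fintype ι] {w : ι → E n → ℝ≥0∞} {e : ι → ℝ}

lemma volume_le_prod_lintegral_rpow (hw : ∀ i, AEMeasurable (w i) volume) (he : ∀ i, 0 ≤ e i)
    (he1 : ∑ i, e i = 1) (h : ∀ᵐ x, 1 ≤ ∏ i, w i x ^ e i) (S : Set (E n)) :
    volume S ≤ ∏ i, (∫⁻ x in S, w i x) ^ e i := by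
  calc volume S = ∫⁻ x in S, 1 := by simp
    _ ≤ ∫⁻ x in S, ∏ i, w i x ^ e i := lintegral_mono_ae (ae_restrict_of_ae h)
    _ ≤ _ := ENNReal.lintegral_prod_norm_pow_le _ (fun i _ => (hw i).restrict) he1
        (fun i _ => he i)

lemma lintegral_ball_ne_zero {v : E n → ℝ≥0∞} (hv : AEMeasurable v volume)
    (hpos : ∀ᵐ x, v x ≠ 0) (x : E n) {r : ℝ} (hr : 0 < r) : ∫⁻ y in ball x r, v y ≠ 0 := by
  intro h
  rw [lintegral_eq_zero_iff' hv.restrict] at h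
  have h2 : ∀ᵐ y ∂(volume.restrict (ball x r)), False := by
    filter_upwards [h, ae_restrict_of_ae hpos] with y h1 h2 using h2 h1
  have : (volume.restrict (ball x r)) Set.univ = 0 := by
    simpa [ae_iff] using h2
  rw [Measure.restrict_apply_univ] at this
  exact volume_ball_pos' x hr this

/-- Compare the Hölder lower bound on $S$ with the assumed upper bound on the ball. Enlarging $S$ to
the ball in all factors except the $i$-th leaves $|S|\,w_i(B)^{e_i}\le C\,w_i(S)^{e_i}|B|$. No
openness property of weights enters. -/
lemma isAInftyMeasure_of_family (hw : ∀ i, AEMeasurable (w i) volume) (he : ∀ i, 0 < e i)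
    (he1 : ∑ i, e i = 1) (h : ∀ᵐ x, 1 ≤ ∏ i, w i x ^ e i) (hpos : ∀ i, ∀ᵐ x, w i x ≠ 0)
    {C : ℝ≥0∞} (hC : C ≠ ∞)
    (hb : ∀ (x : E n) (r : ℝ), 0 < r →
      ∏ i, (∫⁻ y in ball x r, w i y) ^ e i ≤ C * volume (ball x r)) (i : ι) :
    IsAInftyMeasure (volume.withDensity (w i)) := by
  classical
  refine ⟨withDensity_absolutelyContinuous _ _, fun x r => ?_, C, e i, hC, he i, ?_⟩
  · rw [withDensity_apply _ measurableSet_ball]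
    rcases le_or_gt r 0 with hr | hr
    · simp [ball_eq_empty.2 hr]
    -- All other factors are nonzero, so one infinite factor would make the product infinite,
    -- against `hb`.
    intro htop
    have h1 : ∏ j, (∫⁻ y in ball x r, w j y) ^ e j = ∞ := by
      rw [← Finset.mul_prod_erase _ _ (Finset.mem_univ i), htop, ENNReal.top_rpow_of_pos (he i)]
      refine ENNReal.top_mul (Finset.prod_ne_zero_iff.2 fun j _ => ?_)
      rw [Ne, ENNReal.rpow_eq_zero_iff_of_pos (he j)]
      exact lintegral_ball_ne_zero (hw j) (hpos j) x hr
    have := hb x r hr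
    rw [h1, top_le_iff] at this
    exact ENNReal.mul_ne_top hC (volume_ball_ne_top' x r) this
  · intro x r hr S hS hSm
    rw [withDensity_apply _ measurableSet_ball, withDensity_apply _ hSm]
    have h1 := volume_le_prod_lintegral_rpow hw (fun j => (he j).le) he1 h S
    have h2 := hb x r hr
    rw [← Finset.mul_prod_erase _ _ (Finset.mem_univ i)] at h1 h2
    have h3 : ∏ j ∈ Finset.univ.erase i, (∫⁻ y in S, w j y) ^ e j ≤
        ∏ j ∈ Finset.univ.erase i, (∫⁻ y in ball x r, w j y) ^ e j :=
      Finset.prod_le_prod' fun j _ =>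
        ENNReal.rpow_le_rpow (lintegral_mono_set hS) (he j).le
    calc volume S * (∫⁻ y in ball x r, w i y) ^ e i
        ≤ ((∫⁻ y in S, w i y) ^ e i *
            ∏ j ∈ Finset.univ.erase i, (∫⁻ y in ball x r, w j y) ^ e j) *
            (∫⁻ y in ball x r, w i y) ^ e i := by gcongr; exact h1.trans (by gcongr)
      _ = (∫⁻ y in S, w i y) ^ e i * ((∫⁻ y in ball x r, w i y) ^ e i *
            ∏ j ∈ Finset.univ.erase i, (∫⁻ y in ball x r, w j y) ^ e j) := by ring
      _ ≤ (∫⁻ y in S, w i y) ^ e i * (C * volume (ball x r)) := by gcongr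
      _ = _ := by ring

end Holder

namespace IsAInftyMeasure

variable {n : ℕ} {μ : Measure (E n)}

/-- A fixed share of the Lebesgue measure of a ball carries a fixed share of its $\mu$-measure.
Doubling and reverse doubling are both read off from this. -/
lemma measure_ball_le (hμ : IsAInftyMeasure μ) {A : ℝ≥0∞} (hA : A ≠ ∞) :
    ∃ D : ℝ≥0, 1 ≤ D ∧ ∀ (x : E n) (r : ℝ), 0 < r → ∀ S ⊆ ball x r, MeasurableSet S →
      volume (ball x r) ≤ A * volume S → μ (ball x r) ≤ D * μ S := by
  obtain ⟨C, t, hC, ht, h⟩ := hμ.exists_bound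
  have hfin : (C * A) ^ t⁻¹ ≠ ∞ :=
    ENNReal.rpow_ne_top_of_nonneg (inv_pos.2 ht).le (ENNReal.mul_ne_top hC hA)
  -- The summand 1 secures `1 ≤ D`, so that the truncated difference `D - 1` used later is a true
  -- one.
  refine ⟨((C * A) ^ t⁻¹).toNNReal + 1, by simp, fun x r hr S hS hSm hvol => ?_⟩
  have hS0 : volume S ≠ 0 := by
    intro h0
    rw [h0, mul_zero] at hvol
    exact volume_ball_pos' x hr (le_zero_iff.1 hvol)
  have hSt : volume S ≠ ∞ := ne_top_of_le_ne_top (volume_ball_ne_top' x r) (measure_mono hS)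
  have h1 : μ (ball x r) ^ t ≤ (C * A) * μ S ^ t := by
    refine ENNReal.mul_le_mul_right_iff_of_ne hS0 hSt ?_
    calc μ (ball x r) ^ t * volume S = volume S * μ (ball x r) ^ t := mul_comm _ _
      _ ≤ C * μ S ^ t * volume (ball x r) := h x r hr S hS hSm
      _ ≤ C * μ S ^ t * (A * volume S) := by gcongr
      _ = _ := by ring
  refine (ENNReal.le_rpow_inv_mul_of_rpow_le ht h1).trans ?_
  gcongr
  rw [ENNReal.coe_add, ENNReal.coe_toNNReal hfin]
  exact le_self_add

/-- Sets of at most half of the Lebesgue measure of `Q` carry a fixed part of `μ Q` only. -/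
lemma exists_measure_le_of_volume_le_half (hμ : IsAInftyMeasure μ) {A : ℝ≥0∞} (hA : A ≠ ∞) :
    ∃ κ : ℝ≥0, κ < 1 ∧ ∀ (x : E n) (r : ℝ), 0 < r → ∀ Q ⊆ ball x r, MeasurableSet Q →
      volume (ball x r) ≤ A * volume Q → ∀ S ⊆ Q, MeasurableSet S →
      2 * volume S ≤ volume Q → μ S ≤ κ * μ Q := by
  obtain ⟨D, hD1, hD⟩ := hμ.measure_ball_le (A := A * 2) (ENNReal.mul_ne_top hA (by simp))
  have hD0 : (0 : ℝ≥0) < D := lt_of_lt_of_le one_pos hD1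
  -- The complement of $S$ in $Q$ has at least half of the volume, hence at least $\mu(Q)/D$; what
  -- is left for $S$ is the share $1-1/D$.
  refine ⟨(D - 1) / D, ?_, fun x r hr Q hQ hQm hvol S hS hSm hhalf => ?_⟩
  · rw [div_lt_one hD0]
    exact tsub_lt_self hD0 one_pos
  have hQt : volume Q ≠ ∞ := ne_top_of_le_ne_top (volume_ball_ne_top' x r) (measure_mono hQ)
  have hSt : volume S ≠ ∞ := ne_top_of_le_ne_top hQt (measure_mono hS)
  have hμQ : μ Q ≠ ∞ := ne_top_of_le_ne_top (hμ.ball_ne_top x r) (measure_mono hQ)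
  have hμS : μ S ≠ ∞ := ne_top_of_le_ne_top hμQ (measure_mono hS)
  have hd : volume S + volume (Q \ S) = volume Q := by
    have := measure_inter_add_sdiff (μ := volume) Q hSm; rwa [Set.inter_eq_right.2 hS] at this
  have hdμ : μ S + μ (Q \ S) = μ Q := by
    have := measure_inter_add_sdiff (μ := μ) Q hSm; rwa [Set.inter_eq_right.2 hS] at this
  have h1 : volume Q ≤ 2 * volume (Q \ S) := by
    have : volume S ≤ volume (Q \ S) := by
      rw [← hd, two_mul] at hhalf
      exact (ENNReal.add_le_add_iff_left hSt).1 hhalf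
    rw [← hd, two_mul]
    gcongr
  have h2 : μ Q ≤ D * μ (Q \ S) := by
    refine (measure_mono hQ).trans (hD x r hr _ (Set.sdiff_subset.trans hQ) (hQm.diff hSm) ?_)
    rw [mul_assoc]
    exact hvol.trans (by gcongr)
  rw [ENNReal.coe_div hD0.ne', div_eq_mul_inv, mul_right_comm, ← div_eq_mul_inv,
    ENNReal.le_div_iff_mul_le (Or.inl (by simpa using hD0.ne')) (Or.inl (by simp)), mul_comm]
  have h3 : (D : ℝ≥0∞) * μ S + μ Q ≤ (D - 1 : ℝ≥0) * μ Q + μ Q := by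
    calc (D : ℝ≥0∞) * μ S + μ Q ≤ D * μ S + D * μ (Q \ S) := by gcongr
      _ = D * μ Q := by rw [← mul_add, hdμ]
      _ = ((D - 1 : ℝ≥0) + 1 : ℝ≥0) * μ Q := by rw [tsub_add_cancel_of_le hD1]
      _ = _ := by push_cast; ring
  exact (ENNReal.add_le_add_iff_right hμQ).1 h3

lemma exists_doubling (hμ : IsAInftyMeasure μ) {c : ℝ} (hc : 1 ≤ c) :
    ∃ D : ℝ≥0, 1 ≤ D ∧ ∀ (x : E n) (r : ℝ), 0 < r → μ (ball x (c * r)) ≤ D * μ (ball x r) := by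
  obtain ⟨D, hD1, hD⟩ := hμ.measure_ball_le (A := ENNReal.ofReal (c ^ n)) (by simp)
  refine ⟨D, hD1, fun x r hr => hD x _ (by positivity) _ (ball_subset_ball (by nlinarith))
    measurableSet_ball (volume_ball_mul x x (by positivity) r).le⟩

/-- The concentric ball of half the radius has at most half of the volume because $2^n\ge2$, so each
doubling of the radius gains a factor $\kappa$. Dimension zero has to be excluded. -/
lemma exists_reverse_doubling (hμ : IsAInftyMeasure μ) (hn : 0 < n) :
    ∃ κ : ℝ≥0, κ < 1 ∧ ∀ (x : E n) (r : ℝ), 0 < r → ∀ k : ℕ,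
      μ (ball x r) ≤ κ ^ k * μ (ball x (2 ^ k * r)) := by
  obtain ⟨κ, hκ, h⟩ := hμ.exists_measure_le_of_volume_le_half (A := 1) (by simp)
  refine ⟨κ, hκ, fun x r hr k => ?_⟩
  induction k with
  | zero => simp
  | succ k ih =>
    refine ih.trans ?_
    rw [pow_succ, mul_assoc]
    gcongr
    have hr' : (0 : ℝ) < 2 ^ k * r := by positivity
    have e : (2 : ℝ) ^ (k + 1) * r = 2 * (2 ^ k * r) := by ring
    rw [e]
    refine h x (2 * (2 ^ k * r)) (by positivity) _ subset_rfl measurableSet_ball (by simp) _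
      (ball_subset_ball (by linarith)) measurableSet_ball ?_
    rw [volume_ball_mul x x two_pos]
    gcongr
    rw [show (2 : ℝ≥0∞) = ENNReal.ofReal 2 by simp]
    exact ENNReal.ofReal_le_ofReal (by simpa using pow_le_pow_right₀ (one_le_two (α := ℝ)) hn)

end IsAInftyMeasure

/-! ### Muckenhoupt weights -/

lemma IsWeight.aemeasurable {n : ℕ} {ω : E n → ℝ} (h : IsWeight ω) :
    AEMeasurable (fun y => ENNReal.ofReal (ω y)) volume :=
  h.locallyIntegrable.aestronglyMeasurable.aemeasurable.ennreal_ofReal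

lemma ENNReal.prod_rpow_eq_rpow_sum {ι : Type*} (s : Finset ι) {e : ι → ℝ} (he : ∀ i, 0 ≤ e i)
    (V : ℝ≥0∞) : ∏ i ∈ s, V ^ e i = V ^ ∑ i ∈ s, e i := by
  classical
  induction s using Finset.induction_on with
  | empty => simp
  | insert i s hi ih =>
    rw [Finset.prod_insert hi, Finset.sum_insert hi, ih,
      ENNReal.rpow_add_of_nonneg _ _ (he i) (Finset.sum_nonneg fun i _ => he i)]

lemma prod_rpow_mean {ι : Type*} [Fintype ι] {e : ι → ℝ} (he : ∀ i, 0 ≤ e i)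
    (he1 : ∑ i, e i = 1) (V : ℝ≥0∞) (y : ι → ℝ≥0∞) :
    ∏ i, (V * y i) ^ e i = V * ∏ i, y i ^ e i := by
  simp_rw [fun i => ENNReal.mul_rpow_of_nonneg V (y i) (he i), Finset.prod_mul_distrib]
  rw [ENNReal.prod_rpow_eq_rpow_sum _ he, he1, ENNReal.rpow_one]

lemma one_le_prod_ballMean_rpow {n : ℕ} {ι : Type*} [Fintype ι] {w : ι → E n → ℝ≥0∞} {e : ι → ℝ}
    (hw : ∀ i, AEMeasurable (w i) volume) (he : ∀ i, 0 ≤ e i) (he1 : ∑ i, e i = 1)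
    (h : ∀ᵐ x, 1 ≤ ∏ i, w i x ^ e i) (x : E n) {r : ℝ} (hr : 0 < r) :
    1 ≤ ∏ i, ballMean (w i) x r ^ e i := by
  unfold ballMean
  rw [prod_rpow_mean he he1, ← ENNReal.inv_mul_cancel (volume_ball_pos' x hr)
    (volume_ball_ne_top' x r)]
  gcongr
  exact volume_le_prod_lintegral_rpow hw he he1 h _

lemma volume_mul_ballMean {n : ℕ} (g : E n → ℝ≥0∞) (x : E n) {r : ℝ} (hr : 0 < r) :
    volume (ball x r) * ballMean g x r = ∫⁻ y in ball x r, g y := by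
  rw [ballMean, ← mul_assoc, ENNReal.mul_inv_cancel (volume_ball_pos' x hr)
    (volume_ball_ne_top' x r), one_mul]

lemma le_iSup_ball {n : ℕ} (F : E n → ℝ → ℝ≥0∞) (x : E n) {r : ℝ} (hr : 0 < r) :
    F x r ≤ ⨆ (x : E n) (r : ℝ) (_ : 0 < r), F x r :=
  le_iSup_of_le x (le_iSup_of_le r (le_iSup_of_le hr le_rfl))

/-- An `A_∞` weight satisfies a Muckenhoupt condition with some negative power. -/
lemma MemAInfty.exists_ballMean_rpow_mul_le {n : ℕ} {ω : E n → ℝ} (h : MemAInfty ω) :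
    ∃ (ε : ℝ) (C : ℝ≥0∞), 0 < ε ∧ C ≠ ∞ ∧ ∀ (x : E n) (r : ℝ), 0 < r →
      ballMean (fun y => ENNReal.ofReal (ω y)) x r ^ ε *
        ballMean (fun y => ENNReal.ofReal (ω y) ^ (-ε)) x r ≤ C := by
  obtain ⟨p, hp1, hω, hlt⟩ := h
  have hle := le_iSup_ball (fun (x : E n) (r : ℝ) =>
    (ballMean (fun y => ENNReal.ofReal (ω y)) x r) ^ (1 / p) * dualFactor p ω x r)
  set M := ⨆ (x : E n) (r : ℝ) (_ : 0 < r),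
    (ballMean (fun y => ENNReal.ofReal (ω y)) x r) ^ (1 / p) * dualFactor p ω x r
  rcases eq_or_lt_of_le hp1 with rfl | hp
  -- For $p=1$ the essential infimum bounds $\omega^{-1}$ pointwise, so $\varepsilon=1$ works.
  · refine ⟨1, M, one_pos, hlt.ne, fun x r hr => le_trans ?_ (hle x hr)⟩
    simp only [dualFactor, if_true, div_one]
    gcongr
    unfold ballMean
    rw [ENNReal.inv_mul_le_iff (volume_ball_pos' x hr) (volume_ball_ne_top' x r)]
    calc _ ≤ ∫⁻ y in ball x r,
          (essInf (fun y => ENNReal.ofReal (ω y)) (volume.restrict (ball x r)))⁻¹ := by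
          refine lintegral_mono_ae ?_
          filter_upwards [ae_essInf_le (f := fun y => ENNReal.ofReal (ω y))
            (μ := volume.restrict (ball x r))] with y hy
          rw [ENNReal.rpow_neg_one]
          exact ENNReal.inv_le_inv.2 hy
      _ = _ := by rw [setLIntegral_const, mul_comm]
  · have hp0 : 0 < p - 1 := by linarith
    -- For $p>1$ raise the $A_p$ condition to the power $p'$; then $\varepsilon=p'-1=1/(p-1)$.
    refine ⟨1 / (p - 1), M ^ (p / (p - 1)), by positivity,
      ENNReal.rpow_ne_top_of_nonneg (by positivity) hlt.ne, fun x r hr => ?_⟩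
    have h1 := ENNReal.rpow_le_rpow (hle x hr) (z := p / (p - 1)) (by positivity)
    refine le_trans (le_of_eq ?_) h1
    simp only [dualFactor, if_neg hp.ne']
    rw [ENNReal.mul_rpow_of_nonneg _ _ (by positivity), ← ENNReal.rpow_mul, ← ENNReal.rpow_mul,
      one_div_mul_cancel (by positivity), ENNReal.rpow_one]
    congr 2
    · field_simp
    · ext y
      congr 1
      field_simp
      ring

/-- The total exponent of each $\omega_j$ is zero. This identity feeds the Hölder device twice: with
dual weights for the vector condition, and with the powers $\omega_j^{-\varepsilon_j}$ for the
reverse Hölder inequality. -/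
lemma ae_prod_rpow_mul_eq_one {n m : ℕ} {ω : Fin m → E n → ℝ} (hω : ∀ j, IsWeight (ω j))
    {N : E n → ℝ≥0∞} {a : ℝ} {θ c d : Fin m → ℝ} (ha : 0 ≤ a)
    (hN : ∀ᵐ y, N y = ∏ j, ENNReal.ofReal (ω j y) ^ θ j) (hcd : ∀ j, d j * c j = - (θ j * a)) :
    ∀ᵐ y, N y ^ a * ∏ j, (ENNReal.ofReal (ω j y) ^ d j) ^ c j = 1 := by
  filter_upwards [hN, ae_all_iff.2 fun j => (hω j).pos] with y hy hpos
  rw [hy, ← ENNReal.prod_rpow_of_nonneg ha, ← Finset.prod_mul_distrib]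
  refine Finset.prod_eq_one fun j _ => ?_
  have h0 : ENNReal.ofReal (ω j y) ≠ 0 := by simpa using hpos j
  rw [← ENNReal.rpow_mul, ← ENNReal.rpow_mul, ← ENNReal.rpow_add _ _ h0 (by simp), hcd]
  simp

/-- The reverse Hölder inequality for products of `A_∞` weights. -/
lemma exists_prod_rpow_le {n m : ℕ} {ω : Fin m → E n → ℝ} (hω : ∀ j, IsWeight (ω j))
    (hωi : ∀ j, MemAInfty (ω j)) {N : E n → ℝ≥0∞} (hNm : AEMeasurable N volume) {θ : Fin m → ℝ}
    (hθ : ∀ j, 0 < θ j) (hθ1 : ∑ j, θ j = 1)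
    (hN : ∀ᵐ y, N y = ∏ j, ENNReal.ofReal (ω j y) ^ θ j) :
    ∃ C : ℝ≥0∞, C ≠ ∞ ∧ ∀ (x : E n) (r : ℝ), 0 < r →
      ∏ j, (∫⁻ y in ball x r, ENNReal.ofReal (ω j y)) ^ θ j ≤ C * ∫⁻ y in ball x r, N y := by
  choose ε C hε hC hle using fun j => (hωi j).exists_ballMean_rpow_mul_le
  -- Chosen so that $a+\sum_jc_j=1$ while $c_j\varepsilon_j=\theta_ja$; the first makes Hölder's
  -- inequality applicable, the second makes the weights cancel.
  set a : ℝ := (1 + ∑ j, θ j / ε j)⁻¹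
  have hsum : 0 ≤ ∑ j, θ j / ε j := Finset.sum_nonneg fun j _ => (div_pos (hθ j) (hε j)).le
  have ha : 0 < a := by positivity
  set c : Fin m → ℝ := fun j => θ j / ε j * a
  have hc : ∀ j, 0 < c j := fun j => by have := hθ j; have := hε j; positivity
  let w : Option (Fin m) → E n → ℝ≥0∞ :=
    fun i => i.elim N fun j y => ENNReal.ofReal (ω j y) ^ (-ε j)
  let e : Option (Fin m) → ℝ := fun i => i.elim a c
  have hw : ∀ i, AEMeasurable (w i) volume := by
    rintro (_ | j)
    · exact hNm
    · exact (hω j).aemeasurable.pow_const _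
  have he : ∀ i, 0 ≤ e i := by
    rintro (_ | j)
    · exact ha.le
    · exact (hc j).le
  have he1 : ∑ i, e i = 1 := by
    rw [Fintype.sum_option]
    simp only [e, Option.elim, c, ← Finset.sum_mul]
    rw [← one_add_mul]
    exact mul_inv_cancel₀ (by positivity)
  have h1 : ∀ᵐ x, 1 ≤ ∏ i, w i x ^ e i := by
    have := ae_prod_rpow_mul_eq_one hω (a := a) (c := c) (d := fun j => - ε j) ha.le hN
      (fun j => by have := (hε j).ne'; simp only [c]; field_simp)
    filter_upwards [this] with x hx
    rw [Fintype.prod_option]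
    exact hx.ge
  refine ⟨(∏ j, C j ^ c j) ^ a⁻¹, ENNReal.rpow_ne_top_of_nonneg (by positivity)
    (ENNReal.prod_ne_top fun j _ => ENNReal.rpow_ne_top_of_nonneg (hc j).le (hC j)),
    fun x r hr => ?_⟩
  have h2 := one_le_prod_ballMean_rpow hw he he1 h1 x hr
  rw [Fintype.prod_option] at h2
  simp only [w, e, Option.elim] at h2
  set X : Fin m → ℝ≥0∞ := fun j => ballMean (fun y => ENNReal.ofReal (ω j y)) x r
  set Y : Fin m → ℝ≥0∞ := fun j => ballMean (fun y => ENNReal.ofReal (ω j y) ^ (-ε j)) x r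
  -- Multiply the Hölder lower bound $1\le N_B^a\prod_jY_j^{c_j}$ by $\prod_jX_j^{\varepsilon_jc_j}$
  -- and absorb each $X_j^{\varepsilon_j}Y_j$ into its Muckenhoupt constant.
  have h3 : (∏ j, X j ^ θ j) ^ a ≤ (∏ j, C j ^ c j) * ballMean N x r ^ a := by
    calc (∏ j, X j ^ θ j) ^ a = (∏ j, (X j ^ ε j) ^ c j) * 1 := by
          rw [mul_one, ← ENNReal.prod_rpow_of_nonneg ha.le]
          refine Finset.prod_congr rfl fun j _ => ?_
          rw [← ENNReal.rpow_mul, ← ENNReal.rpow_mul]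
          congr 1
          have := (hε j).ne'
          simp only [c]; field_simp
      _ ≤ (∏ j, (X j ^ ε j) ^ c j) * (ballMean N x r ^ a * ∏ j, Y j ^ c j) := by gcongr
      _ = (∏ j, (X j ^ ε j * Y j) ^ c j) * ballMean N x r ^ a := by
          simp_rw [fun j => ENNReal.mul_rpow_of_nonneg (X j ^ ε j) (Y j) (hc j).le,
            Finset.prod_mul_distrib]
          ring
      _ ≤ _ := by
          gcongr with j
          · exact (hc j).le
          · exact hle j x r hr
  have h4 := ENNReal.le_rpow_inv_mul_of_rpow_le ha h3
  have h5 : ∏ j, X j ^ θ j =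
      (volume (ball x r))⁻¹ * ∏ j, (∫⁻ y in ball x r, ENNReal.ofReal (ω j y)) ^ θ j :=
    prod_rpow_mean (fun j => (hθ j).le) hθ1 _ _
  rw [h5, ENNReal.inv_mul_le_iff (volume_ball_pos' x hr) (volume_ball_ne_top' x r)] at h4
  refine h4.trans (le_of_eq ?_)
  rw [← volume_mul_ballMean N x hr]
  ring

/-- The dual weight `ω ^ (1 - p')`. -/
def dualWeight {n : ℕ} (p : ℝ) (ω : E n → ℝ) : E n → ℝ≥0∞ :=
  fun y => ENNReal.ofReal (ω y) ^ (1 - p / (p - 1))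

lemma multiWeight_ae_eq {n m : ℕ} {ω : Fin m → E n → ℝ} (hω : ∀ j, IsWeight (ω j))
    (p : ℝ) (P : Fin m → ℝ) : ∀ᵐ y, ENNReal.ofReal (multiWeight p P ω y) =
      ∏ j, ENNReal.ofReal (ω j y) ^ (p / P j) := by
  filter_upwards [ae_all_iff.2 fun j => (hω j).pos] with y hpos
  rw [multiWeight, ENNReal.ofReal_prod_of_nonneg fun j _ => (Real.rpow_pos_of_pos (hpos j) _).le]
  exact Finset.prod_congr rfl fun j _ => (ENNReal.ofReal_rpow_of_pos (hpos j)).symm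

lemma aemeasurable_multiWeight {n m : ℕ} {ω : Fin m → E n → ℝ} (hω : ∀ j, IsWeight (ω j))
    (p : ℝ) (P : Fin m → ℝ) :
    AEMeasurable (fun y => ENNReal.ofReal (multiWeight p P ω y)) volume := by
  have h : AEMeasurable (fun y => ∏ j, ENNReal.ofReal (ω j y) ^ (p / P j)) volume :=
    Finset.aemeasurable_fun_prod _ fun j _ => (hω j).aemeasurable.pow_const _
  exact h.congr ((multiWeight_ae_eq hω p P).mono fun y hy => hy.symm)

/-- The components of a multiple weight are of Muckenhoupt type, and the multiple weight condition
holds for their measures. -/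
lemma MemAVec.exists_bound {n m : ℕ} (hm : 0 < m) {P : Fin m → ℝ} {ω : Fin m → E n → ℝ}
    (hP : ∀ j, 1 < P j) (h : MemAVec P ω) {N : E n → ℝ≥0∞}
    (hN : N = fun y => ENNReal.ofReal (multiWeight (harmonicExponent P) P ω y)) :
    IsAInftyMeasure (volume.withDensity N) ∧
    (∀ j, IsAInftyMeasure (volume.withDensity (dualWeight (P j) (ω j)))) ∧
    ∃ C : ℝ≥0∞, C ≠ ∞ ∧ ∀ (x : E n) (r : ℝ), 0 < r →
      (∫⁻ y in ball x r, N y) ^ (1 / harmonicExponent P) *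
        ∏ j, (∫⁻ y in ball x r, dualWeight (P j) (ω j) y) ^ (1 / (P j / (P j - 1))) ≤
        C * volume (ball x r) ^ m := by
  obtain ⟨hω, hlt⟩ := h
  have hle := le_iSup_ball (fun (x : E n) (r : ℝ) =>
    (ballMean (fun y => ENNReal.ofReal (multiWeight (harmonicExponent P) P ω y)) x r)
          ^ (1 / harmonicExponent P) * ∏ j, dualFactor (P j) (ω j) x r)
  set M := ⨆ (x : E n) (r : ℝ) (_ : 0 < r),
    (ballMean (fun y => ENNReal.ofReal (multiWeight (harmonicExponent P) P ω y)) x r)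
          ^ (1 / harmonicExponent P) * ∏ j, dualFactor (P j) (ω j) x r
  have hNm : AEMeasurable N volume := hN ▸ aemeasurable_multiWeight hω _ _
  have hNae : ∀ᵐ y, N y = ∏ j, ENNReal.ofReal (ω j y) ^ (harmonicExponent P / P j) :=
    hN ▸ multiWeight_ae_eq hω _ _
  have : Nonempty (Fin m) := ⟨⟨0, hm⟩⟩
  have hm' : (0 : ℝ) < m := by exact_mod_cast hm
  set R := harmonicExponent P with hR
  have hS : 0 < ∑ j, 1 / P j :=
    Finset.sum_pos (fun j _ => by have := hP j; positivity) Finset.univ_nonempty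
  have hR0 : 0 < R := by rw [hR, harmonicExponent]; positivity
  have hR1 : 1 / R = ∑ j, 1 / P j := by rw [hR, harmonicExponent, one_div_one_div]
  set c : Fin m → ℝ := fun j => 1 / (P j / (P j - 1))
  have hc : ∀ j, 0 < c j := fun j => by
    have := hP j
    have h1 : 0 < P j - 1 := by linarith
    have h2 : 0 < P j := by linarith
    positivity
  have hc' : ∀ j, c j = 1 - 1 / P j := fun j => by
    have := hP j
    have h1 : P j - 1 ≠ 0 := by linarith
    have h2 : P j ≠ 0 := by linarith
    simp only [c]; field_simp
  -- The family consists of $\nu$ and the $m$ dual weights. As $1/R+\sum_j(1-1/P_j)=m$, the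
  -- exponents of the vector condition sum to one after division by $m$; accordingly the condition
  -- is used to the power $1/m$ and restored at the end.
  let w : Option (Fin m) → E n → ℝ≥0∞ := fun i => i.elim N fun j => dualWeight (P j) (ω j)
  let e : Option (Fin m) → ℝ := fun i => i.elim (1 / R / m) fun j => c j / m
  have hw : ∀ i, AEMeasurable (w i) volume := by
    rintro (_ | j)
    · exact hNm
    · exact (hω j).aemeasurable.pow_const _
  have he : ∀ i, 0 < e i := by
    rintro (_ | j)
    · simp only [e, Option.elim]; positivity
    · have := hc j
      simp only [e, Option.elim]; positivity
  have he1 : ∑ i, e i = 1 := by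
    rw [Fintype.sum_option]
    simp only [e, Option.elim]
    rw [← Finset.sum_div, ← add_div, hR1, ← Finset.sum_add_distrib,
      Finset.sum_congr rfl (g := fun _ => (1 : ℝ)) fun j _ => by rw [hc' j]; ring]
    simp [hm'.ne']
  have h1 : ∀ᵐ x, 1 ≤ ∏ i, w i x ^ e i := by
    have := ae_prod_rpow_mul_eq_one hω (a := 1 / R / m) (c := fun j => c j / m)
      (d := fun j => 1 - P j / (P j - 1)) (by positivity) hNae (fun j => by
        rw [hc' j]
        have := hP j
        have h1 : P j - 1 ≠ 0 := by linarith
        have h2 : P j ≠ 0 := by linarith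
        field_simp
        ring)
    filter_upwards [this] with x hx
    rw [Fintype.prod_option]
    exact hx.ge
  have hpos : ∀ i, ∀ᵐ x, w i x ≠ 0 := by
    rintro (_ | j)
    · filter_upwards [hNae, ae_all_iff.2 fun j => (hω j).pos] with x hx hpos
      simp only [w, Option.elim]
      rw [hx, Finset.prod_ne_zero_iff]
      intro j _
      exact (ENNReal.rpow_pos (by simpa using hpos j) (by simp)).ne'
    · filter_upwards [(hω j).pos] with x hpos
      exact (ENNReal.rpow_pos (by simpa using hpos) (by simp)).ne'
  have hb : ∀ (x : E n) (r : ℝ), 0 < r →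
      ∏ i, (∫⁻ y in ball x r, w i y) ^ e i ≤ M ^ (1 / (m : ℝ)) * volume (ball x r) := by
    intro x r hr
    have h2 := ENNReal.rpow_le_rpow (hle x hr) (z := 1 / (m : ℝ)) (by positivity)
    have h3 : ∏ i, ballMean (w i) x r ^ e i ≤ M ^ (1 / (m : ℝ)) := by
      refine le_trans (le_of_eq ?_) h2
      rw [Fintype.prod_option, ENNReal.mul_rpow_of_nonneg _ _ (by positivity),
        ← ENNReal.prod_rpow_of_nonneg (by positivity), ← ENNReal.rpow_mul]
      simp only [w, e, Option.elim, hN]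
      congr 2
      · ring
      · ext j
        rw [dualFactor, if_neg (hP j).ne', ← ENNReal.rpow_mul]
        simp only [c]
        congr 1
        ring
    unfold ballMean at h3
    rwa [prod_rpow_mean (fun i => (he i).le) he1,
      ENNReal.inv_mul_le_iff (volume_ball_pos' x hr) (volume_ball_ne_top' x r), mul_comm] at h3
  have hMt : M ^ (1 / (m : ℝ)) ≠ ∞ := ENNReal.rpow_ne_top_of_nonneg (by positivity) hlt.ne
  refine ⟨isAInftyMeasure_of_family hw he he1 h1 hpos hMt hb none,
    fun j => isAInftyMeasure_of_family hw he he1 h1 hpos hMt hb (some j), M, hlt.ne, ?_⟩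
  intro x r hr
  have h2 := ENNReal.rpow_le_rpow (hb x r hr) (z := m) (by positivity)
  rw [Fintype.prod_option, ENNReal.mul_rpow_of_nonneg _ _ (by positivity),
    ← ENNReal.prod_rpow_of_nonneg (by positivity), ← ENNReal.rpow_mul,
    ENNReal.mul_rpow_of_nonneg _ _ (by positivity), ← ENNReal.rpow_mul,
    one_div_mul_cancel hm'.ne', ENNReal.rpow_one, ENNReal.rpow_natCast] at h2
  refine le_trans (le_of_eq ?_) h2
  simp only [w, e, Option.elim]
  congr 2
  · field_simp
  · ext j
    rw [← ENNReal.rpow_mul, div_mul_cancel₀ _ hm'.ne']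

/-! ### Dyadic cubes -/

lemma ENNReal.inv_le_mul_inv_of_le {a b A : ℝ≥0∞} (ha0 : a ≠ 0) (ha : a ≠ ∞) (hb0 : b ≠ 0)
    (hb : b ≠ ∞) (h : b ≤ A * a) : a⁻¹ ≤ A * b⁻¹ := by
  calc a⁻¹ = a⁻¹ * (b⁻¹ * b) := by rw [ENNReal.inv_mul_cancel hb0 hb, mul_one]
    _ ≤ a⁻¹ * (b⁻¹ * (A * a)) := by gcongr
    _ = A * b⁻¹ * (a⁻¹ * a) := by ring
    _ = A * b⁻¹ := by rw [ENNReal.inv_mul_cancel ha0 ha, mul_one]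

/-- The half-open cube with corner `a` and side length `l`. -/
def cube {n : ℕ} (a : E n) (l : ℝ) : Set (E n) := {x | ∀ i, ⌊(x i - a i) / l⌋ = 0}

/-- The index of the cell containing `x` in the grid of mesh `l` through `a`. -/
def gridIndex {n : ℕ} (a : E n) (l : ℝ) (x : E n) : Fin n → ℤ := fun i => ⌊(x i - a i) / l⌋

/-- The center of `cube a l`. -/
def cubeCenter {n : ℕ} (a : E n) (l : ℝ) : E n := a + WithLp.toLp 2 fun _ => l / 2

/-- The cell with index `z` in the grid of mesh `l` through `a`. -/
def gridCell {n : ℕ} (a : E n) (l : ℝ) (z : Fin n → ℤ) : Set (E n) :=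
  cube (a + WithLp.toLp 2 fun i => l * z i) l

section Cubes

variable {n : ℕ} {a : E n} {l : ℝ}

lemma mem_cube_iff (hl : 0 < l) {x : E n} : x ∈ cube a l ↔ ∀ i, a i ≤ x i ∧ x i < a i + l := by
  refine forall_congr' fun i => ?_
  rw [Int.floor_eq_zero_iff, Set.mem_Ico, le_div_iff₀ hl, div_lt_iff₀ hl]
  constructor <;> rintro ⟨h1, h2⟩ <;> constructor <;> linarith

lemma mem_gridCell_iff (hl : 0 < l) {x : E n} {z : Fin n → ℤ} :
    x ∈ gridCell a l z ↔ gridIndex a l x = z := by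
  rw [gridCell, mem_cube_iff hl, funext_iff]
  refine forall_congr' fun i => ?_
  rw [gridIndex, Int.floor_eq_iff, le_div_iff₀ hl, div_lt_iff₀ hl, PiLp.add_apply]
  constructor <;> rintro ⟨h1, h2⟩ <;> constructor <;> nlinarith

/-- The index in a coarser grid is the integer quotient of the finer index by a power of two, so the
cells are nested. -/
lemma gridIndex_eq_of_le (hl : 0 < l) {x y : E n} {j k : ℕ} (hjk : j ≤ k)
    (h : gridIndex a (l / 2 ^ k) x = gridIndex a (l / 2 ^ k) y) :
    gridIndex a (l / 2 ^ j) x = gridIndex a (l / 2 ^ j) y := by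
  have key : ∀ (u : E n) (i : Fin n),
      gridIndex a (l / 2 ^ j) u i = gridIndex a (l / 2 ^ k) u i / ((2 ^ (k - j) : ℕ) : ℤ) := by
    intro u i
    rw [gridIndex, gridIndex, ← Int.floor_div_natCast]
    congr 1
    obtain ⟨d, rfl⟩ := Nat.exists_eq_add_of_le hjk
    rw [Nat.add_sub_cancel_left, pow_add]
    push_cast
    field_simp
  ext i
  rw [key, key, h]

lemma measurableSet_cube (a : E n) (l : ℝ) : MeasurableSet (cube a l) := by
  have : cube a l = ⋂ i, {x : E n | ⌊(x i - a i) / l⌋ = 0} := by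
    ext x; simp [cube]
  rw [this]
  refine MeasurableSet.iInter fun i => ?_
  have hm : Measurable fun x : E n => ⌊(x i - a i) / l⌋ := by fun_prop
  exact hm (measurableSet_singleton 0)

/-- A crude comparison of norms gives distance at most $n\rho$; the factor 2 only makes the
inequality strict. -/
lemma mem_ball_of_abs_sub_le (hn : 0 < n) {x c : E n} {ρ : ℝ} (hρ : 0 < ρ)
    (h : ∀ i, |x i - c i| ≤ ρ) : x ∈ ball c (2 * n * ρ) := by
  have hn' : (1 : ℝ) ≤ n := by exact_mod_cast hn
  rw [mem_ball, dist_eq_norm]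
  have h1 : ‖x - c‖ ^ 2 ≤ (n * ρ) ^ 2 := by
    rw [EuclideanSpace.norm_sq_eq]
    calc ∑ i, ‖(x - c) i‖ ^ 2 ≤ ∑ _i : Fin n, ρ ^ 2 := by
          refine Finset.sum_le_sum fun i _ => pow_le_pow_left₀ (norm_nonneg _) ?_ 2
          simpa [Real.norm_eq_abs] using h i
      _ = n * ρ ^ 2 := by simp
      _ ≤ (n * ρ) ^ 2 := by nlinarith [sq_nonneg ρ]
  have h2 := abs_le_of_sq_le_sq h1 (by positivity)
  rw [abs_of_nonneg (norm_nonneg _)] at h2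
  nlinarith [mul_pos (lt_of_lt_of_le one_pos hn') hρ]

lemma abs_sub_cubeCenter_le (hl : 0 < l) {x : E n} (hx : x ∈ cube a l) (i : Fin n) :
    |x i - cubeCenter a l i| ≤ l / 2 := by
  obtain ⟨h1, h2⟩ := (mem_cube_iff hl).1 hx i
  rw [cubeCenter, PiLp.add_apply, abs_le]
  constructor <;> linarith

lemma cube_subset_ball (hn : 0 < n) (hl : 0 < l) :
    cube a l ⊆ ball (cubeCenter a l) (n * l) := by
  intro x hx
  have := mem_ball_of_abs_sub_le hn (half_pos hl) (abs_sub_cubeCenter_le hl hx)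
  rwa [show 2 * (n : ℝ) * (l / 2) = n * l by ring] at this

lemma ball_subset_cube (hl : 0 < l) : ball (cubeCenter a l) (l / 2) ⊆ cube a l := by
  intro x hx
  rw [mem_cube_iff hl]
  intro i
  rw [mem_ball, dist_eq_norm] at hx
  have h1 := (PiLp.norm_apply_le (x - cubeCenter a l) i).trans_lt hx
  rw [PiLp.sub_apply, Real.norm_eq_abs, abs_lt] at h1
  simp only [cubeCenter, PiLp.add_apply] at h1
  constructor <;> linarith

/-- The radius $4nl$ is large enough for the ball to contain the dyadic parent of the cube as well.
-/
lemma volume_ball_le_cube (hn : 0 < n) (hl : 0 < l) :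
    volume (ball (cubeCenter a l) (4 * n * l)) ≤
      ENNReal.ofReal ((8 * n : ℝ) ^ n) * volume (cube a l) := by
  have hn' : (0 : ℝ) < n := by exact_mod_cast hn
  rw [show 4 * (n : ℝ) * l = (8 * n) * (l / 2) by ring,
    volume_ball_mul _ (cubeCenter a l) (by positivity)]
  gcongr
  exact ball_subset_cube hl

lemma ball_subset_ball_four (hn : 0 < n) (hl : 0 < l) (c : E n) :
    ball c (n * l) ⊆ ball c (4 * n * l) := by
  have hn' : (0 : ℝ) < n := by exact_mod_cast hn
  exact ball_subset_ball (by nlinarith [mul_pos hn' hl])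

lemma volume_cube_ne_zero (hl : 0 < l) : volume (cube a l) ≠ 0 := fun h =>
  volume_ball_pos' (cubeCenter a l) (half_pos hl) (measure_mono_null (ball_subset_cube hl) h)

lemma volume_cube_ne_top (hn : 0 < n) (hl : 0 < l) : volume (cube a l) ≠ ∞ :=
  ne_top_of_le_ne_top (volume_ball_ne_top' _ _) (measure_mono (cube_subset_ball hn hl))

lemma cubeCenter_mem (hl : 0 < l) : cubeCenter a l ∈ cube a l :=
  ball_subset_cube hl (mem_ball_self (half_pos hl))

end Cubes

/-! ### Averages -/

section Average

variable {n : ℕ} {𝕜 : Type*} [RCLike 𝕜] {b : E n → 𝕜}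

lemma _root_.MeasureTheory.LocallyIntegrable.integrableOn_ball (hb : LocallyIntegrable b volume)
    (x : E n) (r : ℝ) : IntegrableOn b (ball x r) volume :=
  (hb.integrableOn_isCompact (isCompact_closedBall x r)).mono_set ball_subset_closedBall

lemma enorm_average_sub_le {S : Set (E n)} (h0 : volume S ≠ 0) (ht : volume S ≠ ∞)
    (hb : IntegrableOn b S volume) (c : 𝕜) :
    ‖(⨍ y in S, b y) - c‖ₑ ≤ (volume S)⁻¹ * ∫⁻ y in S, ‖b y - c‖ₑ := by
  have hr : volume.real S ≠ 0 := by
    rw [Measure.real, ENNReal.toReal_ne_zero]; exact ⟨h0, ht⟩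
  have h1 : (⨍ y in S, b y) - c = (volume.real S)⁻¹ • ∫ y in S, (b y - c) := by
    rw [integral_sub hb (integrableOn_const ht), setIntegral_const, smul_sub, smul_smul,
      inv_mul_cancel₀ hr, one_smul, setAverage_eq]
  rw [h1, enorm_smul]
  have h2 : ‖(volume.real S)⁻¹‖ₑ = (volume S)⁻¹ := by
    rw [Real.enorm_eq_ofReal (by positivity), ENNReal.ofReal_inv_of_pos (by positivity),
      Measure.real, ENNReal.ofReal_toReal ht]
  rw [h2]
  gcongr
  exact enorm_integral_le_lintegral_enorm _

/-- The oscillation on the larger set passes to the smaller one at the price of the volume ratio. It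
compares a cube with its parent, a cube with a ball, and a ball with its double. -/
lemma enorm_average_sub_average_le {S T : Set (E n)} (h0 : volume S ≠ 0) (ht : volume S ≠ ∞)
    (hb : IntegrableOn b S volume) (hST : S ⊆ T) {A M : ℝ≥0∞} (hA : volume T ≤ A * volume S)
    (c : 𝕜) (hM : ∫⁻ y in T, ‖b y - c‖ₑ ≤ M * volume T) :
    ‖(⨍ y in S, b y) - c‖ₑ ≤ A * M := by
  refine (enorm_average_sub_le h0 ht hb c).trans ?_
  rw [ENNReal.inv_mul_le_iff h0 ht]
  calc _ ≤ ∫⁻ y in T, ‖b y - c‖ₑ := lintegral_mono_set hST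
    _ ≤ M * volume T := hM
    _ ≤ M * (A * volume S) := by gcongr
    _ = _ := by ring

/-- The Lebesgue differentiation theorem along shrinking sets. -/
lemma ae_le_of_forall_average_le (hb : LocallyIntegrable b volume) (A : ℝ≥0∞) (hA : A ≠ ∞) :
    ∀ᵐ x, ∀ (w : ℕ → E n) (δ : ℕ → ℝ) (S : ℕ → Set (E n)) (c : 𝕜) (M : ℝ≥0∞),
      Filter.Tendsto δ Filter.atTop (nhdsWithin 0 (Set.Ioi 0)) →
      (∀ k, x ∈ S k) → (∀ k, S k ⊆ closedBall (w k) (δ k)) → (∀ k, volume (S k) ≠ 0) →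
      (∀ k, volume (closedBall (w k) (δ k)) ≤ A * volume (S k)) →
      (∀ k, (volume (S k))⁻¹ * ∫⁻ y in S k, ‖b y - c‖ₑ ≤ M) → ‖b x - c‖ₑ ≤ M := by
  filter_upwards [IsUnifLocDoublingMeasure.ae_tendsto_average_norm_sub volume hb 1]
    with x hx w δ S c M hδ hxS hS h0 hvol hM
  have hlim := hx w δ hδ (Filter.Eventually.of_forall fun k => by
    simpa using hS k (hxS k))
  have hlim2 : Filter.Tendsto (fun k => A * ENNReal.ofReal
      (⨍ y in closedBall (w k) (δ k), ‖b y - b x‖) + M) Filter.atTop (nhds (A * 0 + M)) := by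
    refine Filter.Tendsto.add (ENNReal.Tendsto.const_mul ?_ (Or.inr hA)) tendsto_const_nhds
    simpa using ENNReal.tendsto_ofReal hlim
  rw [mul_zero, zero_add] at hlim2
  refine ge_of_tendsto' hlim2 fun k => ?_
  have ht : volume (closedBall (w k) (δ k)) ≠ ∞ := measure_closedBall_lt_top.ne
  have hSt : volume (S k) ≠ ∞ := ne_top_of_le_ne_top ht (measure_mono (hS k))
  have hc0 : volume (closedBall (w k) (δ k)) ≠ 0 := fun h => h0 k (measure_mono_null (hS k) h)
  have hint : IntegrableOn (fun y => b y - b x) (closedBall (w k) (δ k)) volume :=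
    (hb.integrableOn_isCompact (isCompact_closedBall _ _)).sub (integrableOn_const ht)
  -- Differentiation is known along closed balls; each $S_k$ fills a fixed share of such a ball,
  -- which costs the factor $A$.
  have h1 : (volume (S k))⁻¹ * ∫⁻ y in S k, ‖b y - b x‖ₑ ≤
      A * ENNReal.ofReal (⨍ y in closedBall (w k) (δ k), ‖b y - b x‖) := by
    rw [setAverage_eq, smul_eq_mul, ENNReal.ofReal_mul (by positivity),
      ofReal_integral_norm_eq_lintegral_enorm hint, Measure.real,
      ENNReal.ofReal_inv_of_pos (ENNReal.toReal_pos hc0 ht), ENNReal.ofReal_toReal ht, ← mul_assoc]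
    gcongr ?_ * ?_
    · exact ENNReal.inv_le_mul_inv_of_le (h0 k) hSt hc0 ht (hvol k)
    · exact lintegral_mono_set (hS k)
  have hm1 : AEMeasurable (fun y => ‖b y - b x‖ₑ) (volume.restrict (S k)) :=
    (hb.aestronglyMeasurable.aemeasurable.sub_const _).enorm.restrict
  calc ‖b x - c‖ₑ = (volume (S k))⁻¹ * ∫⁻ _y in S k, ‖b x - c‖ₑ := by
        rw [setLIntegral_const, mul_comm (‖b x - c‖ₑ), ← mul_assoc,
          ENNReal.inv_mul_cancel (h0 k) hSt, one_mul]
    _ ≤ (volume (S k))⁻¹ * ∫⁻ y in S k, (‖b y - b x‖ₑ + ‖b y - c‖ₑ) := by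
        gcongr with y
        have : b x - c = -(b y - b x) + (b y - c) := by ring
        rw [this, ← enorm_neg (b y - b x)]
        exact enorm_add_le _ _
    _ = ((volume (S k))⁻¹ * ∫⁻ y in S k, ‖b y - b x‖ₑ) +
          (volume (S k))⁻¹ * ∫⁻ y in S k, ‖b y - c‖ₑ := by
        rw [lintegral_add_left' hm1, mul_add]
    _ ≤ _ := add_le_add h1 (hM k)

end Average

/-! ### The weighted John–Nirenberg inequality -/

section JohnNirenberg

variable {n : ℕ} {𝕜 : Type*} [RCLike 𝕜] {b : E n → 𝕜}

lemma mem_cube_iff_gridIndex {a x : E n} {l : ℝ} : x ∈ cube a l ↔ gridIndex a l x = 0 :=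
  funext_iff.symm

lemma tendsto_mesh {n : ℕ} (hn : 0 < n) {l : ℝ} (hl : 0 < l) :
    Filter.Tendsto (fun k : ℕ => (n : ℝ) * (l / 2 ^ k)) Filter.atTop
      (nhdsWithin 0 (Set.Ioi 0)) := by
  have hn' : (0 : ℝ) < n := by exact_mod_cast hn
  rw [tendsto_nhdsWithin_iff]
  refine ⟨?_, Filter.Eventually.of_forall fun k => by simp only [Set.mem_Ioi]; positivity⟩
  have h := (tendsto_pow_atTop_nhds_zero_of_lt_one (r := (1 / 2 : ℝ)) (by norm_num)
    (by norm_num)).const_mul ((n : ℝ) * l)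
  rw [mul_zero] at h
  refine h.congr fun k => ?_
  rw [one_div, inv_pow]
  field_simp

/-- The Calderón–Zygmund decomposition of the oscillation of `b` on a cube. -/
lemma exists_stopping_cubes (hn : 0 < n) (hb : LocallyIntegrable b volume) {M : ℝ≥0∞}
    (hM0 : M ≠ 0) (hMt : M ≠ ∞) (a : E n) {l : ℝ} (hl : 0 < l)
    (hM : ∫⁻ y in cube a l, ‖b y - ⨍ z in cube a l, b z‖ₑ ≤ M * volume (cube a l)) :
    ∃ (I : Set (ℕ × (Fin n → ℤ))) (S : ℕ × (Fin n → ℤ) → Set (E n)),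
      (∀ p ∈ I, ∃ (a' : E n) (l' : ℝ), 0 < l' ∧ S p = cube a' l') ∧ I.PairwiseDisjoint S ∧
      (∀ p ∈ I, S p ⊆ cube a l) ∧ 2 * volume (⋃ p ∈ I, S p) ≤ volume (cube a l) ∧
      (∀ p ∈ I, ‖(⨍ z in S p, b z) - ⨍ z in cube a l, b z‖ₑ ≤
        ENNReal.ofReal ((8 * n : ℝ) ^ n) * (2 * M)) ∧
      ∀ᵐ x, x ∈ cube a l → x ∉ ⋃ p ∈ I, S p → ‖b x - ⨍ z in cube a l, b z‖ₑ ≤ 2 * M := by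
  set c := ⨍ z in cube a l, b z
  have hlk : ∀ k : ℕ, 0 < l / 2 ^ k := fun k => by positivity
  let S : ℕ × (Fin n → ℤ) → Set (E n) := fun p => gridCell a (l / 2 ^ p.1) p.2
  let Z : ℕ → E n → ℕ × (Fin n → ℤ) := fun k x => (k, gridIndex a (l / 2 ^ k) x)
  have hS : ∀ p x, x ∈ S p ↔ Z p.1 x = p := fun p x => by
    simp only [S, Z, mem_gridCell_iff (hlk p.1), Prod.ext_iff, true_and]
  have hZ : ∀ k x, x ∈ S (Z k x) := fun k x => (hS _ _).2 rfl
  have hZle : ∀ {j k : ℕ} {x y}, j ≤ k → Z k x = Z k y → Z j x = Z j y := by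
    intro j k x y hjk h
    exact Prod.ext rfl (gridIndex_eq_of_le hl hjk (Prod.ext_iff.1 h).2)
  have hS0 : S (0, 0) = cube a l := by
    ext x
    rw [hS, mem_cube_iff_gridIndex, Prod.ext_iff]
    simp [Z]
  have hScube : ∀ p, ∃ (a' : E n) (l' : ℝ), 0 < l' ∧ S p = cube a' l' :=
    fun p => ⟨_, _, hlk p.1, rfl⟩
  have hv0 : ∀ p, volume (S p) ≠ 0 := fun p => volume_cube_ne_zero (hlk p.1)
  have hvt : ∀ p, volume (S p) ≠ ∞ := fun p => volume_cube_ne_top hn (hlk p.1)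
  -- The stopping rule: the mean of $|b-c|$ over the cell exceeds $2M$.
  let bad : ℕ × (Fin n → ℤ) → Prop := fun p =>
    2 * M * volume (S p) < ∫⁻ y in S p, ‖b y - c‖ₑ
  have hbad0 : ¬ bad (0, 0) := by
    simp only [bad, hS0, not_lt]
    refine hM.trans ?_
    gcongr
    rw [two_mul]; exact le_self_add
  -- The maximal bad cells: no cell of a coarser generation containing them is bad. Maximality makes
  -- them disjoint.
  let I : Set (ℕ × (Fin n → ℤ)) :=
    {p | S p ⊆ cube a l ∧ bad p ∧ ∀ j < p.1, ∀ x ∈ S p, ¬ bad (Z j x)}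
  have hdisj : I.PairwiseDisjoint S := by
    intro p hp q hq hpq
    rw [Function.onFun, Set.disjoint_left]
    intro x hxp hxq
    have ep := (hS p x).1 hxp
    have eq' := (hS q x).1 hxq
    rcases lt_trichotomy p.1 q.1 with h | h | h
    · exact hq.2.2 _ h x hxq (ep ▸ hp.2.1)
    · exact hpq (by rw [← ep, ← eq', h])
    · exact hp.2.2 _ h x hxp (eq' ▸ hq.2.1)
  have hmeas : ∀ p, MeasurableSet (S p) := fun p => measurableSet_cube _ _
  refine ⟨I, S, fun p _ => hScube p, hdisj, fun p hp => hp.1, ?_, ?_, ?_⟩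
  -- Chebyshev's inequality, summed over disjoint cells.
  · have h1 : 2 * M * volume (⋃ p ∈ I, S p) ≤ M * volume (cube a l) := by
      rw [measure_biUnion I.to_countable hdisj fun p _ => hmeas p, ← ENNReal.tsum_mul_left]
      calc _ ≤ ∑' p : I, ∫⁻ y in S p, ‖b y - c‖ₑ := ENNReal.tsum_le_tsum fun p => p.2.2.1.le
        _ = ∫⁻ y in ⋃ p ∈ I, S p, ‖b y - c‖ₑ :=
            (lintegral_biUnion I.to_countable (fun p _ => hmeas p) hdisj _).symm
        _ ≤ ∫⁻ y in cube a l, ‖b y - c‖ₑ :=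
            lintegral_mono_set (Set.iUnion₂_subset fun p hp => hp.1)
        _ ≤ _ := hM
    rw [mul_comm 2 M, mul_assoc] at h1
    exact (ENNReal.mul_le_mul_iff_right hM0 hMt).1 h1
  · rintro p hp
    -- The whole cube is not bad, so a stopping cell has a parent, which is good by maximality and
    -- of comparable volume.
    obtain ⟨k, hk⟩ : ∃ k, p.1 = k + 1 := by
      refine Nat.exists_eq_succ_of_ne_zero fun h0 => hbad0 ?_
      have hx : cubeCenter (a + WithLp.toLp 2 fun i => (l / 2 ^ p.1) * p.2 i) (l / 2 ^ p.1) ∈ S p :=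
        cubeCenter_mem (hlk p.1)
      have h2 := (hS _ _).1 hx
      have h3 := (hS (0, 0) _).1 (hS0.symm ▸ hp.1 hx)
      have : p = (0, 0) := by rw [← h2, ← h3, h0]
      rw [← this]; exact hp.2.1
    set x := cubeCenter (a + WithLp.toLp 2 fun i => (l / 2 ^ p.1) * p.2 i) (l / 2 ^ p.1) with hxdef
    have hx : x ∈ S p := cubeCenter_mem (hlk p.1)
    have hsub : S p ⊆ S (Z k x) := by
      intro y hy
      rw [hS]
      exact hZle (by omega : k ≤ p.1) (((hS _ _).1 hy).trans ((hS _ _).1 hx).symm)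
    have hball : S (Z k x) ⊆ ball x (4 * n * (l / 2 ^ p.1)) := by
      intro y hy
      have hxk : x ∈ S (Z k x) := hZ k x
      have hl2 : 0 < 2 * (l / 2 ^ p.1) := mul_pos two_pos (hlk _)
      have := mem_ball_of_abs_sub_le hn hl2 (x := y) (c := x) fun i => by
        obtain ⟨h1, h2⟩ := (mem_cube_iff (hlk k)).1 hy i
        obtain ⟨h3, h4⟩ := (mem_cube_iff (hlk k)).1 hxk i
        have e : l / 2 ^ (Z k x).1 = 2 * (l / 2 ^ p.1) := by
          change l / 2 ^ k = _
          rw [hk, pow_succ]; field_simp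
        rw [abs_le]; constructor <;> linarith
      rwa [show 2 * (n : ℝ) * (2 * (l / 2 ^ p.1)) = 4 * n * (l / 2 ^ p.1) by ring] at this
    refine enorm_average_sub_average_le (hv0 p) (hvt p) ?_ hsub
      ((measure_mono hball).trans (volume_ball_le_cube hn (hlk p.1))) c ?_
    · exact (hb.integrableOn_ball _ _).mono_set (hsub.trans hball)
    · exact not_lt.1 (hp.2.2 k (by omega) x hx)
  · filter_upwards [ae_le_of_forall_average_le hb (ENNReal.ofReal ((8 * n : ℝ) ^ n))
      ENNReal.ofReal_ne_top]
      with x hx hxc hxI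
    -- Were some cell around $x$ bad, the first such would be a stopping cell. All cells shrinking
    -- to $x$ are thus good, and differentiation gives the bound at $x$.
    have hgood : ∀ k, ¬ bad (Z k x) := by
      by_contra! hex
      classical
      refine hxI (Set.mem_iUnion₂.2 ⟨Z (Nat.find hex) x, ⟨?_, Nat.find_spec hex, ?_⟩, hZ _ _⟩)
      · intro y hy
        rw [← hS0, hS]
        rw [← hS0, hS] at hxc
        rw [← hxc]
        exact hZle (Nat.zero_le _) ((hS _ _).1 hy)
      · intro j hj y hy
        rw [hZle hj.le ((hS _ _).1 hy)]
        exact Nat.find_min hex hj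
    refine hx (fun k => cubeCenter (a + WithLp.toLp 2 fun i => (l / 2 ^ k) * (Z k x).2 i)
      (l / 2 ^ k)) (fun k => n * (l / 2 ^ k)) (fun k => S (Z k x)) c (2 * M) (tendsto_mesh hn hl)
      (fun k => hZ k x) (fun k => (cube_subset_ball hn (hlk k)).trans ball_subset_closedBall)
      (fun k => hv0 _) (fun k => ?_) fun k => ?_
    · refine le_trans (measure_mono ?_) (volume_ball_le_cube hn (hlk k))
      have hn' : (0 : ℝ) < n := by exact_mod_cast hn
      exact closedBall_subset_ball (by nlinarith [mul_pos hn' (hlk k)])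
    · rw [ENNReal.inv_mul_le_iff (hv0 _) (hvt _), mul_comm]
      exact not_lt.1 (hgood k)

/-- Exponential decay of the distribution function of the oscillation. -/
lemma measure_oscillation_gt_le (hn : 0 < n) (hb : LocallyIntegrable b volume) {M : ℝ≥0∞}
    (hM0 : M ≠ 0) (hMt : M ≠ ∞)
    (hM : ∀ (a : E n) (l : ℝ), 0 < l →
      ∫⁻ y in cube a l, ‖b y - ⨍ z in cube a l, b z‖ₑ ≤ M * volume (cube a l))
    {μ : Measure (E n)} (hμ : μ ≪ volume) {κ : ℝ≥0∞}
    (hκ : ∀ (a : E n) (l : ℝ), 0 < l → ∀ S ⊆ cube a l, MeasurableSet S →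
      2 * volume S ≤ volume (cube a l) → μ S ≤ κ * μ (cube a l)) (j : ℕ) :
    ∀ (a : E n) (l : ℝ), 0 < l →
      μ {x ∈ cube a l | j * (ENNReal.ofReal ((8 * n : ℝ) ^ n) * (2 * M)) <
        ‖b x - ⨍ z in cube a l, b z‖ₑ} ≤ κ ^ j * μ (cube a l) := by
  set L := ENNReal.ofReal ((8 * n : ℝ) ^ n) * (2 * M) with hL
  have hML : 2 * M ≤ L := by
    have h8 : (1 : ℝ≥0∞) ≤ ENNReal.ofReal ((8 * n : ℝ) ^ n) := by
      rw [← ENNReal.ofReal_one]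
      refine ENNReal.ofReal_le_ofReal (one_le_pow₀ ?_)
      have : (1 : ℝ) ≤ n := by exact_mod_cast hn
      linarith
    calc 2 * M = 1 * (2 * M) := (one_mul _).symm
      _ ≤ L := by rw [hL]; gcongr
  have hLt : L ≠ ∞ := by
    rw [hL]; exact ENNReal.mul_ne_top ENNReal.ofReal_ne_top (ENNReal.mul_ne_top (by simp) hMt)
  induction j with
  | zero =>
    intro a l hl
    rw [pow_zero, one_mul]
    exact measure_mono fun x hx => hx.1
  | succ j ih =>
    intro a l hl
    obtain ⟨I, S, hSc, hdisj, hsub, hhalf, havg, hae⟩ :=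
      exists_stopping_cubes hn hb hM0 hMt a hl (hM a l hl)
    have hmeas : ∀ p ∈ I, MeasurableSet (S p) := fun p hp => by
      obtain ⟨a', l', -, h⟩ := hSc p hp
      rw [h]; exact measurableSet_cube _ _
    set c := ⨍ z in cube a l, b z
    -- Off the stopping cubes the oscillation is at most $2M\le L$. On one of them the mean has
    -- moved by at most $L$, so exceeding level $(j+1)L$ forces exceeding level $jL$ about the new
    -- mean. The stopping cubes carry a share $\kappa$ of $\mu$, which closes the induction.
    have hsubset : {x ∈ cube a l | ((j + 1 : ℕ) : ℝ≥0∞) * L < ‖b x - c‖ₑ} ≤ᵐ[μ]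
        ⋃ p ∈ I, {x ∈ S p | j * L < ‖b x - ⨍ z in S p, b z‖ₑ} := by
      filter_upwards [hμ.ae_le hae] with x hx hxm
      obtain ⟨hxc, hxL⟩ := hxm
      have hxL' : (j : ℝ≥0∞) * L + L < ‖b x - c‖ₑ := by
        push_cast at hxL; rwa [add_mul, one_mul] at hxL
      have hxU : x ∈ ⋃ p ∈ I, S p := by
        by_contra hno
        exact absurd hxL' (not_lt.2 ((hx hxc hno).trans (hML.trans le_add_self)))
      obtain ⟨p, hp, hxp⟩ := Set.mem_iUnion₂.1 hxU
      refine Set.mem_iUnion₂.2 ⟨p, hp, hxp, ?_⟩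
      by_contra hno
      refine absurd hxL' (not_lt.2 ?_)
      calc ‖b x - c‖ₑ = ‖(b x - ⨍ z in S p, b z) + ((⨍ z in S p, b z) - c)‖ₑ := by ring_nf
        _ ≤ _ := (enorm_add_le _ _).trans (add_le_add (not_lt.1 hno) (havg p hp))
    calc _ ≤ μ (⋃ p ∈ I, {x ∈ S p | j * L < ‖b x - ⨍ z in S p, b z‖ₑ}) := measure_mono_ae hsubset
      _ ≤ ∑' p : I, μ {x ∈ S p | j * L < ‖b x - ⨍ z in S p, b z‖ₑ} :=
          measure_biUnion_le _ I.to_countable _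
      _ ≤ ∑' p : I, κ ^ j * μ (S p) := ENNReal.tsum_le_tsum fun p => by
          obtain ⟨a', l', hl', h⟩ := hSc p p.2
          rw [h]; exact ih a' l' hl'
      _ = κ ^ j * μ (⋃ p ∈ I, S p) := by
          rw [ENNReal.tsum_mul_left, measure_biUnion I.to_countable hdisj hmeas]
      _ ≤ κ ^ j * (κ * μ (cube a l)) := by
          gcongr
          exact hκ a l hl _ (Set.iUnion₂_subset hsub)
            (MeasurableSet.biUnion I.to_countable hmeas) hhalf
      _ = _ := by ring

end JohnNirenberg

/-- Geometric decay beats any power; rounding the exponent up reduces this to natural powers. -/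
lemma tsum_succ_rpow_mul_pow_ne_top (u : ℝ) {κ : ℝ≥0} (hκ : κ < 1) :
    ∑' j : ℕ, ((j : ℝ≥0∞) + 1) ^ u * (κ : ℝ≥0∞) ^ j ≠ ∞ := by
  set d := ⌈u⌉₊
  have hs1 : Summable fun j : ℕ => (j : ℝ≥0) ^ d * κ ^ j := by
    rw [← NNReal.summable_coe]
    push_cast
    exact summable_pow_mul_geometric_of_norm_lt_one d (by simpa using hκ)
  have hs2 : Summable fun j : ℕ => κ ^ j := NNReal.summable_geometric hκ
  have hs : Summable fun j : ℕ => 2 ^ d * ((j : ℝ≥0) ^ d * κ ^ j + κ ^ j) :=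
    (hs1.add hs2).mul_left _
  refine ne_top_of_le_ne_top (ENNReal.tsum_coe_ne_top_iff_summable.2 hs)
    (ENNReal.tsum_le_tsum fun j => ?_)
  calc ((j : ℝ≥0∞) + 1) ^ u * (κ : ℝ≥0∞) ^ j ≤ ((j : ℝ≥0∞) + 1) ^ (d : ℝ) * (κ : ℝ≥0∞) ^ j := by
        gcongr
        · exact le_add_self
        · exact Nat.le_ceil u
    _ = (((j + 1 : ℝ≥0) ^ d * κ ^ j : ℝ≥0) : ℝ≥0∞) := by
        rw [ENNReal.rpow_natCast]; push_cast; rfl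
    _ ≤ _ := by
        refine ENNReal.coe_le_coe.2 ?_
        rw [← add_one_mul, ← mul_assoc]
        gcongr
        rcases Nat.eq_zero_or_pos j with rfl | hj
        · simp only [Nat.cast_zero, zero_add, one_pow]
          exact one_le_mul (one_le_pow₀ one_le_two) le_add_self
        · have hj' : (1 : ℝ≥0) ≤ j := by exact_mod_cast hj
          calc ((j : ℝ≥0) + 1) ^ d ≤ (2 * j) ^ d := by gcongr; rw [two_mul]; gcongr
            _ = 2 ^ d * (j : ℝ≥0) ^ d := mul_pow _ _ _
            _ ≤ _ := by gcongr; exact le_self_add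

lemma sum_rpow_le {ι : Type*} (s : Finset ι) (a : ι → ℝ≥0∞) {u : ℝ} (hu : 0 < u) :
    (∑ i ∈ s, a i) ^ u ≤ (s.card : ℝ≥0∞) ^ u * ∑ i ∈ s, a i ^ u := by
  rcases s.eq_empty_or_nonempty with rfl | hs
  · simp [hu]
  obtain ⟨i, hi, hmax⟩ := s.exists_max_image a hs
  have h1 : ∑ j ∈ s, a j ≤ s.card * a i := by
    simpa using Finset.sum_le_card_nsmul s a (a i) hmax
  calc _ ≤ (s.card * a i) ^ u := by gcongr
    _ = (s.card : ℝ≥0∞) ^ u * a i ^ u := ENNReal.mul_rpow_of_nonneg _ _ hu.le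
    _ ≤ _ := by
        gcongr
        exact Finset.single_le_sum (f := fun i => a i ^ u) (fun _ _ => zero_le) hi

lemma add_rpow_le (a b : ℝ≥0∞) {u : ℝ} (hu : 0 < u) :
    (a + b) ^ u ≤ 2 ^ u * (a ^ u + b ^ u) := by
  simpa using sum_rpow_le Finset.univ ![a, b] hu

/-! ### From exponential decay to power means, and from cubes to balls -/

section JohnNirenberg

variable {n : ℕ} {𝕜 : Type*} [RCLike 𝕜] {b : E n → 𝕜}

/-- Cut the cube into the layers $jL<|b-c|\le(j+1)L$ and sum the exponential decay of their
measures. -/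
lemma lintegral_oscillation_cube_le (hn : 0 < n) (hb : LocallyIntegrable b volume) {M : ℝ≥0∞}
    (hMt : M ≠ ∞)
    (hM : ∀ (a : E n) (l : ℝ), 0 < l →
      ∫⁻ y in cube a l, ‖b y - ⨍ z in cube a l, b z‖ₑ ≤ M * volume (cube a l))
    {μ : Measure (E n)} (hμ : μ ≪ volume) {κ : ℝ≥0∞}
    (hκ : ∀ (a : E n) (l : ℝ), 0 < l → ∀ S ⊆ cube a l, MeasurableSet S →
      2 * volume S ≤ volume (cube a l) → μ S ≤ κ * μ (cube a l)) {u : ℝ} (hu : 0 < u)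
    (a : E n) {l : ℝ} (hl : 0 < l) :
    ∫⁻ y in cube a l, ‖b y - ⨍ z in cube a l, b z‖ₑ ^ u ∂μ ≤
      (∑' j : ℕ, ((j : ℝ≥0∞) + 1) ^ u * κ ^ j) *
        (ENNReal.ofReal ((8 * n : ℝ) ^ n) * (2 * M)) ^ u * μ (cube a l) := by
  set c := ⨍ z in cube a l, b z with hc
  have hgm : AEMeasurable (fun y => ‖b y - c‖ₑ) volume :=
    (hb.aestronglyMeasurable.aemeasurable.sub_const _).enorm
  -- For $M=0$ the layers have height zero; then $b$ is a.e. constant on the cube and both sides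
  -- vanish.
  rcases eq_or_ne M 0 with rfl | hM0
  · have h0 := hM a l hl
    rw [zero_mul, nonpos_iff_eq_zero, lintegral_eq_zero_iff' hgm.restrict] at h0
    have h1 := (hμ.restrict (cube a l)).ae_le h0
    rw [lintegral_congr_ae (g := fun _ => 0)]
    · simp
    · filter_upwards [h1] with y hy
      rw [hy]; simp [hu]
  set L := ENNReal.ofReal ((8 * n : ℝ) ^ n) * (2 * M) with hL
  have hL0 : L ≠ 0 := by
    rw [hL]
    exact mul_ne_zero (by simp) (mul_ne_zero two_ne_zero hM0)
  have hdist := measure_oscillation_gt_le hn hb hM0 hMt hM hμ hκ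
  let G : ℕ → Set (E n) := fun j => {y | j * L < ‖b y - c‖ₑ}
  have hG : ∀ j, NullMeasurableSet (G j) (μ.restrict (cube a l)) := fun j =>
    ((hgm.mono_ac hμ).restrict).nullMeasurableSet_preimage measurableSet_Ioi
  calc ∫⁻ y in cube a l, ‖b y - c‖ₑ ^ u ∂μ
      ≤ ∫⁻ y in cube a l, ∑' j : ℕ, (G j).indicator (fun _ => (((j : ℝ≥0∞) + 1) * L) ^ u) y ∂μ := by
        refine lintegral_mono fun y => ?_
        rcases eq_or_ne (‖b y - c‖ₑ) 0 with h0 | h0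
        · rw [h0, ENNReal.zero_rpow_of_pos hu]; exact zero_le
        have hex : ∃ J : ℕ, ‖b y - c‖ₑ ≤ J * L := by
          obtain ⟨J, hJ⟩ := ENNReal.exists_nat_mul_gt hL0 (enorm_ne_top (x := b y - c))
          exact ⟨J, hJ.le⟩
        classical
        obtain ⟨j, hj⟩ : ∃ j, Nat.find hex = j + 1 := by
          refine Nat.exists_eq_succ_of_ne_zero fun hz => h0 ?_
          have := Nat.find_spec hex
          rw [hz] at this
          simpa using this
        have h1 : ‖b y - c‖ₑ ≤ ((j : ℝ≥0∞) + 1) * L := by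
          have := Nat.find_spec hex
          rw [hj] at this
          exact_mod_cast this
        have h2 : y ∈ G j := not_le.1 (Nat.find_min hex (by omega : j < Nat.find hex))
        refine le_trans ?_ (ENNReal.le_tsum j)
        rw [Set.indicator_of_mem h2]
        gcongr
    _ = ∑' j : ℕ, (((j : ℝ≥0∞) + 1) * L) ^ u * μ {y ∈ cube a l | j * L < ‖b y - c‖ₑ} := by
        rw [lintegral_tsum fun j => (aemeasurable_const.indicator₀ (hG j))]
        refine tsum_congr fun j => ?_
        rw [lintegral_indicator_const₀ (hG j), Measure.restrict_apply₀ (hG j)]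
        congr 2
        ext y
        exact and_comm
    _ ≤ ∑' j : ℕ, (((j : ℝ≥0∞) + 1) * L) ^ u * (κ ^ j * μ (cube a l)) := by
        gcongr with j
        exact hdist j a l hl
    _ = _ := by
        rw [← ENNReal.tsum_mul_right, ← ENNReal.tsum_mul_right]
        refine tsum_congr fun j => ?_
        rw [ENNReal.mul_rpow_of_nonneg _ _ hu.le]
        ring

lemma lintegral_ball_le_bmoNorm (b : E n → 𝕜) (x : E n) {r : ℝ} (hr : 0 < r) :
    ∫⁻ y in ball x r, ‖b y - ⨍ z in ball x r, b z‖ₑ ≤ bmoNorm b * volume (ball x r) := by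
  rw [← volume_mul_ballMean _ x hr, mul_comm]
  gcongr
  exact le_iSup_ball (fun x r => ballMean (fun y => ‖b y - ⨍ z in ball x r, b z‖ₑ) x r) x hr

/-- `bmoNorm` is defined by balls while the stopping argument runs on cubes; an enclosing ball of
comparable volume links the two. -/
lemma lintegral_cube_le_bmoNorm (hn : 0 < n) (hb : LocallyIntegrable b volume) (a : E n) {l : ℝ}
    (hl : 0 < l) :
    ∫⁻ y in cube a l, ‖b y - ⨍ z in cube a l, b z‖ₑ ≤
      (2 * ENNReal.ofReal ((8 * n : ℝ) ^ n) * bmoNorm b) * volume (cube a l) := by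
  set A := ENNReal.ofReal ((8 * n : ℝ) ^ n)
  set B := ball (cubeCenter a l) (4 * n * l) with hB
  have hn' : (0 : ℝ) < n := by exact_mod_cast hn
  have hsub : cube a l ⊆ B := (cube_subset_ball hn hl).trans (ball_subset_ball_four hn hl _)
  have hB1 : ∫⁻ y in B, ‖b y - ⨍ z in B, b z‖ₑ ≤ bmoNorm b * volume B :=
    lintegral_ball_le_bmoNorm b _ (by positivity)
  have hvol : volume B ≤ A * volume (cube a l) := volume_ball_le_cube hn hl
  have havg : ‖(⨍ z in cube a l, b z) - ⨍ z in B, b z‖ₑ ≤ A * bmoNorm b :=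
    enorm_average_sub_average_le (volume_cube_ne_zero hl) (volume_cube_ne_top hn hl)
      ((hb.integrableOn_ball _ _).mono_set hsub) hsub hvol _ hB1
  have hgm : AEMeasurable (fun y => ‖b y - ⨍ z in B, b z‖ₑ) (volume.restrict (cube a l)) :=
    (hb.aestronglyMeasurable.aemeasurable.sub_const _).enorm.restrict
  calc _ ≤ ∫⁻ y in cube a l, (‖b y - ⨍ z in B, b z‖ₑ + A * bmoNorm b) := by
        refine lintegral_mono fun y => ?_
        rw [← sub_sub_sub_cancel_right (b y) _ (⨍ z in B, b z)]
        exact enorm_sub_le.trans (by gcongr)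
    _ = (∫⁻ y in cube a l, ‖b y - ⨍ z in B, b z‖ₑ) + A * bmoNorm b * volume (cube a l) := by
        rw [lintegral_add_left' hgm, setLIntegral_const]
    _ ≤ bmoNorm b * (A * volume (cube a l)) + A * bmoNorm b * volume (cube a l) := by
        gcongr
        exact (lintegral_mono_set hsub).trans (hB1.trans (by gcongr))
    _ = _ := by ring

lemma setLIntegral_enorm_sub_rpow_le {μ : Measure (E n)} (hμ : μ ≪ volume)
    (hb : LocallyIntegrable b volume) (S : Set (E n)) (c d : 𝕜) {u : ℝ} (hu : 0 < u) :
    ∫⁻ y in S, ‖b y - d‖ₑ ^ u ∂μ ≤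
      2 ^ u * ((∫⁻ y in S, ‖b y - c‖ₑ ^ u ∂μ) + ‖c - d‖ₑ ^ u * μ S) := by
  have hgm : AEMeasurable (fun y => ‖b y - c‖ₑ ^ u) (μ.restrict S) :=
    ((((hb.aestronglyMeasurable.aemeasurable.sub_const _).enorm).pow_const u).mono_ac hμ).restrict
  calc _ ≤ ∫⁻ y in S, 2 ^ u * (‖b y - c‖ₑ ^ u + ‖c - d‖ₑ ^ u) ∂μ := by
        refine lintegral_mono fun y => le_trans ?_ (add_rpow_le _ _ hu)
        rw [← sub_add_sub_cancel (b y) c d]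
        exact ENNReal.rpow_le_rpow (enorm_add_le _ _) hu.le
    _ = _ := by
        rw [lintegral_const_mul' _ _ (ENNReal.rpow_ne_top_of_nonneg hu.le (by simp)),
          lintegral_add_left' hgm, setLIntegral_const]

/-- Each doubling moves the mean by at most $2^n\|b\|_{BMO}$. Telescoping produces the linear growth
in $k$ that later appears in the series. -/
lemma enorm_average_ball_two_pow_sub_le (hb : LocallyIntegrable b volume) (x : E n) {r : ℝ}
    (hr : 0 < r) (k : ℕ) :
    ‖(⨍ z in ball x (2 ^ k * r), b z) - ⨍ z in ball x r, b z‖ₑ ≤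
      k * (ENNReal.ofReal (2 ^ n) * bmoNorm b) := by
  induction k with
  | zero => simp
  | succ k ih =>
    have hk : (0 : ℝ) < 2 ^ k * r := by positivity
    have e : (2 : ℝ) ^ (k + 1) * r = 2 * (2 ^ k * r) := by ring
    have h1 := enorm_average_sub_average_le (volume_ball_pos' x hk) (volume_ball_ne_top' x _)
      (hb.integrableOn_ball _ _) (ball_subset_ball (by linarith))
      (volume_ball_mul x x two_pos (2 ^ k * r)).le _
      (lintegral_ball_le_bmoNorm b x (by positivity : 0 < 2 * (2 ^ k * r)))
    rw [e, ← sub_add_sub_cancel _ (⨍ z in ball x (2 ^ k * r), b z)]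
    refine (enorm_add_le _ _).trans ?_
    rw [enorm_sub_rev]
    refine (add_le_add h1 ih).trans (le_of_eq ?_)
    push_cast
    ring

/-- The weighted John–Nirenberg inequality: mean oscillations of `BMO` functions with respect to a
measure of Muckenhoupt type. -/
lemma IsAInftyMeasure.exists_oscillation_bound (𝕜 : Type*) [RCLike 𝕜] (hn : 0 < n)
    {μ : Measure (E n)} (hμ : IsAInftyMeasure μ) {u : ℝ} (hu : 0 < u) :
    ∃ C : ℝ≥0∞, C ≠ ∞ ∧ ∀ b : E n → 𝕜, MemBMO b → ∀ (x : E n) (r : ℝ), 0 < r → ∀ k : ℕ,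
      ∫⁻ y in ball x (2 ^ k * r), ‖b y - ⨍ z in ball x r, b z‖ₑ ^ u ∂μ ≤
        C * (((k : ℝ≥0∞) + 1) * bmoNorm b) ^ u * μ (ball x (2 ^ k * r)) := by
  set A := ENNReal.ofReal ((8 * n : ℝ) ^ n)
  have hA : A ≠ ∞ := ENNReal.ofReal_ne_top
  have hn' : (0 : ℝ) < n := by exact_mod_cast hn
  obtain ⟨κ, hκ1, hκ⟩ := hμ.exists_measure_le_of_volume_le_half hA
  obtain ⟨D, hD1, hD⟩ := hμ.exists_doubling (c := 8 * n + 1) (by linarith)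
  set G := ∑' j : ℕ, ((j : ℝ≥0∞) + 1) ^ u * (κ : ℝ≥0∞) ^ j
  have hG : G ≠ ∞ := tsum_succ_rpow_mul_pow_ne_top u hκ1
  have h2u : (2 : ℝ≥0∞) ^ u ≠ ∞ := ENNReal.rpow_ne_top_of_nonneg hu.le (by simp)
  -- the bound for a ball and its own mean
  set C₀ : ℝ≥0∞ := 2 ^ u * (G * (A * (2 * (2 * A))) ^ u + (A * (2 * A)) ^ u) * D with hC₀
  have hC₀t : C₀ ≠ ∞ := by
    refine ENNReal.mul_ne_top (ENNReal.mul_ne_top h2u (ENNReal.add_ne_top.2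
      ⟨ENNReal.mul_ne_top hG ?_, ?_⟩)) (by simp) <;>
    refine ENNReal.rpow_ne_top_of_nonneg hu.le ?_ <;> finiteness
  have hball : ∀ b : E n → 𝕜, MemBMO b → ∀ (x : E n) (r : ℝ), 0 < r →
      ∫⁻ y in ball x r, ‖b y - ⨍ z in ball x r, b z‖ₑ ^ u ∂μ ≤
        C₀ * bmoNorm b ^ u * μ (ball x r) := by
    intro b hb x r hr
    -- The corner of the cube of side $2r$ centred at $x$, which lies between $B(x,r)$ and
    -- $B(x,8nr)$.
    set a : E n := x - WithLp.toLp 2 fun _ => r with ha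
    have hl : 0 < 2 * r := by positivity
    have hcen : cubeCenter a (2 * r) = x := by
      ext i
      simp [cubeCenter, ha]
    have hMt : 2 * A * bmoNorm b ≠ ∞ := by
      have := hb.2.ne
      finiteness
    have hM := fun (a : E n) (l : ℝ) (hl : 0 < l) => lintegral_cube_le_bmoNorm hn hb.1 a hl
    have h1 := lintegral_oscillation_cube_le hn hb.1 hMt hM hμ.ac (κ := κ)
      (fun a l hl S hS hSm h => hκ (cubeCenter a l) (4 * n * l) (by positivity) _
        ((cube_subset_ball hn hl).trans (ball_subset_ball_four hn hl _)) (measurableSet_cube _ _)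
        (volume_ball_le_cube hn hl) S hS hSm h) hu a hl
    set Q := cube a (2 * r) with hQ
    have hBQ : ball x r ⊆ Q := by
      have := ball_subset_cube (a := a) hl
      rwa [hcen, mul_div_cancel_left₀ r two_ne_zero] at this
    have hQB : Q ⊆ ball x ((8 * n) * r) := by
      have := (cube_subset_ball hn hl).trans (ball_subset_ball_four (n := n) hn hl
        (cubeCenter a (2 * r)))
      rwa [hcen, show 4 * (n : ℝ) * (2 * r) = (8 * n) * r by ring] at this
    have hμQ : μ Q ≤ D * μ (ball x r) :=
      (measure_mono (hQB.trans (ball_subset_ball (by nlinarith)))).trans (hD x r hr)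
    have hvol : volume Q ≤ A * volume (ball x r) :=
      (measure_mono hQB).trans (volume_ball_mul x x (by positivity) r).le
    have havg := enorm_average_sub_average_le (volume_ball_pos' x hr) (volume_ball_ne_top' x r)
      (hb.1.integrableOn_ball x r) hBQ hvol _ (hM a (2 * r) hl)
    calc _ ≤ ∫⁻ y in Q, ‖b y - ⨍ z in ball x r, b z‖ₑ ^ u ∂μ := lintegral_mono_set hBQ
      _ ≤ 2 ^ u * ((∫⁻ y in Q, ‖b y - ⨍ z in Q, b z‖ₑ ^ u ∂μ) +
            ‖(⨍ z in Q, b z) - ⨍ z in ball x r, b z‖ₑ ^ u * μ Q) :=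
          setLIntegral_enorm_sub_rpow_le hμ.ac hb.1 _ _ _ hu
      _ ≤ 2 ^ u * (G * (A * (2 * (2 * A * bmoNorm b))) ^ u * (D * μ (ball x r)) +
            (A * (2 * A * bmoNorm b)) ^ u * (D * μ (ball x r))) := by
          gcongr
          · exact h1.trans (by gcongr)
          · rw [enorm_sub_rev]; exact havg
      _ = _ := by
          rw [show A * (2 * (2 * A * bmoNorm b)) = A * (2 * (2 * A)) * bmoNorm b by ring,
            show A * (2 * A * bmoNorm b) = A * (2 * A) * bmoNorm b by ring,
            ENNReal.mul_rpow_of_nonneg _ (bmoNorm b) hu.le,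
            ENNReal.mul_rpow_of_nonneg _ (bmoNorm b) hu.le, hC₀]
          ring
  refine ⟨2 ^ u * (C₀ + ENNReal.ofReal (2 ^ n) ^ u), ?_, fun b hb x r hr k => ?_⟩
  · refine ENNReal.mul_ne_top h2u (ENNReal.add_ne_top.2 ⟨hC₀t, ?_⟩)
    exact ENNReal.rpow_ne_top_of_nonneg hu.le ENNReal.ofReal_ne_top
  · have hk : (0 : ℝ) < 2 ^ k * r := by positivity
    calc _ ≤ 2 ^ u * ((∫⁻ y in ball x (2 ^ k * r),
            ‖b y - ⨍ z in ball x (2 ^ k * r), b z‖ₑ ^ u ∂μ) +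
            ‖(⨍ z in ball x (2 ^ k * r), b z) - ⨍ z in ball x r, b z‖ₑ ^ u *
              μ (ball x (2 ^ k * r))) := setLIntegral_enorm_sub_rpow_le hμ.ac hb.1 _ _ _ hu
      _ ≤ 2 ^ u * (C₀ * (((k : ℝ≥0∞) + 1) * bmoNorm b) ^ u * μ (ball x (2 ^ k * r)) +
            (ENNReal.ofReal (2 ^ n) * (((k : ℝ≥0∞) + 1) * bmoNorm b)) ^ u *
              μ (ball x (2 ^ k * r))) := by
          gcongr
          · refine (hball b hb x _ hk).trans ?_
            gcongr
            exact le_mul_of_one_le_left zero_le le_add_self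
          · refine (enorm_average_ball_two_pow_sub_le hb.1 x hr k).trans ?_
            rw [mul_left_comm]
            gcongr
            exact le_self_add
      _ = _ := by
          rw [ENNReal.mul_rpow_of_nonneg (ENNReal.ofReal (2 ^ n)) _ hu.le]
          ring

end JohnNirenberg

variable {𝕜 : Type*} [RCLike 𝕜]

/-! ### Expansion of iterated commutators -/

section Sublinear

variable {n m : ℕ} {D : Fin m → Submodule 𝕜 (E n → 𝕜)} {S : (Fin m → E n → 𝕜) → E n → ℝ≥0∞}

/-- The filter serves two situations. For multilinear operators additivity holds almost everywhere,
and `F` is `ae volume`. For sublinear ones the tuple itself contains $b_j(x)$, so the inequality is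
needed at the single point $x$, and `F` is `pure x`. -/
lemma eventually_le_sum_piecewise {F : Filter (E n)}
    (hadd : ∀ f, (∀ j, f j ∈ D j) → ∀ i, ∀ g ∈ D i, ∀ h ∈ D i, ∀ᶠ x in F,
      S (Function.update f i (g + h)) x ≤
        S (Function.update f i g) x + S (Function.update f i h) x)
    {u v : Fin m → E n → 𝕜} (hu : ∀ j, u j ∈ D j) (hv : ∀ j, v j ∈ D j) :
    ∀ᶠ x in F, S (u + v) x ≤ ∑ τ : Finset (Fin m), S (τ.piecewise u v) x := by
  -- Induction on the set `s` of slots already expanded; `w` fills the other slots and must stay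
  -- arbitrary because the next slot is moved into it.
  suffices H : ∀ s : Finset (Fin m), ∀ w : Fin m → E n → 𝕜, (∀ j, w j ∈ D j) → ∀ᶠ x in F,
      S (s.piecewise (u + v) w) x ≤
        ∑ τ ∈ s.powerset, S (s.piecewise (τ.piecewise u v) w) x by
    simpa using H Finset.univ u hu
  intro s
  induction s using Finset.induction_on with
  | empty => intro w _; simp
  | insert i s hi ih =>
    intro w hw
    have hw' : ∀ j, Function.update w i (u i + v i) j ∈ D j := by
      intro j
      rcases eq_or_ne j i with rfl | hj
      · simpa using add_mem (hu j) (hv j)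
      · simpa [hj] using hw j
    have hmem : ∀ τ : Finset (Fin m), ∀ j, s.piecewise (τ.piecewise u v) w j ∈ D j := by
      intro τ j
      simp only [Finset.piecewise]
      split_ifs
      exacts [hu j, hv j, hw j]
    have h2 : ∀ᶠ x in F, ∀ τ ∈ s.powerset,
        S (Function.update (s.piecewise (τ.piecewise u v) w) i (u i + v i)) x ≤
          S (Function.update (s.piecewise (τ.piecewise u v) w) i (u i)) x +
          S (Function.update (s.piecewise (τ.piecewise u v) w) i (v i)) x :=
      (Filter.eventually_all_finset _).2 fun τ _ => hadd _ (hmem τ) i _ (hu i) _ (hv i)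
    filter_upwards [ih _ hw', h2] with x hx1 hx2
    rw [Finset.sum_powerset_insert hi, ← Finset.sum_add_distrib]
    have e1 : (insert i s).piecewise (u + v) w =
        s.piecewise (u + v) (Function.update w i (u i + v i)) := by
      ext1 j
      rcases eq_or_ne j i with rfl | hj
      · simp [hi]
      · simp [Finset.piecewise, hj]
    rw [e1]
    refine hx1.trans (Finset.sum_le_sum fun τ hτ => ?_)
    have hiτ : i ∉ τ := fun h => hi (Finset.mem_powerset.1 hτ h)
    have e2 : s.piecewise (τ.piecewise u v) (Function.update w i (u i + v i)) =
        Function.update (s.piecewise (τ.piecewise u v) w) i (u i + v i) := by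
      ext1 j
      rcases eq_or_ne j i with rfl | hj
      · simp [hi]
      · simp [Finset.piecewise, hj]
    have e3 : (insert i s).piecewise (τ.piecewise u v) w =
        Function.update (s.piecewise (τ.piecewise u v) w) i (v i) := by
      ext1 j
      rcases eq_or_ne j i with rfl | hj
      · simp [hiτ]
      · simp [Finset.piecewise, hj]
    have e4 : (insert i s).piecewise ((insert i τ).piecewise u v) w =
        Function.update (s.piecewise (τ.piecewise u v) w) i (u i) := by
      ext1 j
      rcases eq_or_ne j i with rfl | hj
      · simp
      · simp [Finset.piecewise, hj]
    rw [e2, e3, e4]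
    exact (hx2 τ hτ).trans (add_comm _ _).le

lemma IsMultisublinearOn.apply_smul (hS : IsMultisublinearOn D S) {f : Fin m → E n → 𝕜}
    (hf : ∀ j, f j ∈ D j) (d : Fin m → 𝕜) (x : E n) :
    S (fun j => d j • f j) x = (∏ j, ‖d j‖ₑ) * S f x := by
  suffices H : ∀ s : Finset (Fin m),
      S (s.piecewise (fun j => d j • f j) f) x = (∏ j ∈ s, ‖d j‖ₑ) * S f x by
    simpa using H Finset.univ
  intro s
  induction s using Finset.induction_on with
  | empty => simp
  | insert i s hi ih =>
    have hmem : ∀ j, s.piecewise (fun j => d j • f j) f j ∈ D j := by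
      intro j
      simp only [Finset.piecewise]
      split_ifs
      exacts [Submodule.smul_mem _ _ (hf j), hf j]
    have e2 : Function.update (s.piecewise (fun j => d j • f j) f) i (f i) =
        s.piecewise (fun j => d j • f j) f := by
      rw [Function.update_eq_self_iff]; simp [hi]
    rw [Finset.piecewise_insert, hS.map_smul _ hmem i _ (hf i), e2, ih, Finset.prod_insert hi,
      mul_assoc]

end Sublinear

/-! ### Truncated tuples and their domains -/

section Split

variable {n m : ℕ} {D : Fin m → Submodule 𝕜 (E n → 𝕜)} {b : Fin m → E n → 𝕜}

lemma IsOperatorDomain.indicator_compl (hD : IsOperatorDomain D) {j : Fin m} {f : E n → 𝕜}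
    (hf : f ∈ D j) (x : E n) (r : ℝ) : (ball x r)ᶜ.indicator f ∈ D j := by
  rw [Set.indicator_compl]
  exact sub_mem hf (hD.indicator_ball j f hf x r)

lemma IsOperatorDomain.splitTuple_mem (hD : IsOperatorDomain D) {f : Fin m → E n → 𝕜}
    (hf : ∀ j, f j ∈ D j) (σ : Finset (Fin m)) (x : E n) (r : ℝ) (j : Fin m) :
    splitTuple f σ x r j ∈ D j := by
  unfold splitTuple
  split_ifs
  exacts [hD.indicator_compl (hf j) _ _, hD.indicator_ball j _ (hf j) _ _]

lemma mul_splitTuple (f : Fin m → E n → 𝕜) (σ : Finset (Fin m)) (x : E n) (r : ℝ) (j : Fin m)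
    (g : E n → 𝕜) : g * splitTuple f σ x r j = splitTuple (fun j => g * f j) σ x r j := by
  unfold splitTuple
  split_ifs <;> exact funext fun z => (Set.indicator_mul_right _ g (f j)).symm

lemma IsOperatorDomain.splitTuple_mem_commutatorDomain (hD : IsOperatorDomain D)
    {f : Fin m → E n → 𝕜} (hf : f ∈ commutatorDomain D b) (σ : Finset (Fin m)) (x : E n) (r : ℝ) :
    splitTuple f σ x r ∈ commutatorDomain D b := by
  intro j
  refine ⟨hD.splitTuple_mem (fun j => (hf j).1) σ x r j, ?_⟩
  rw [mul_splitTuple]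
  unfold splitTuple
  split_ifs
  exacts [hD.indicator_compl (hf j).2 _ _, hD.indicator_ball j _ (hf j).2 _ _]

/-- The tuple with entries `f_j` for `j ∈ τ` and `(b_j - c_j) f_j` for `j ∉ τ`. -/
def oscTuple (b : Fin m → E n → 𝕜) (c : Fin m → 𝕜) (f : Fin m → E n → 𝕜) (τ : Finset (Fin m)) :
    Fin m → E n → 𝕜 :=
  fun j => if j ∈ τ then f j else fun z => (b j z - c j) * f j z

lemma sub_const_mul_mem {j : Fin m} {f : E n → 𝕜} (c : 𝕜) (hf : f ∈ D j) (hbf : b j * f ∈ D j) :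
    (fun z => (b j z - c) * f z) ∈ D j := by
  have : (fun z => (b j z - c) * f z) = b j * f - c • f := by
    ext z; simp [sub_mul]
  rw [this]
  exact sub_mem hbf (Submodule.smul_mem _ _ hf)

lemma oscTuple_mem {f : Fin m → E n → 𝕜} (hf : f ∈ commutatorDomain D b) (c : Fin m → 𝕜)
    (τ : Finset (Fin m)) (j : Fin m) : oscTuple b c f τ j ∈ D j := by
  unfold oscTuple
  split_ifs
  exacts [(hf j).1, sub_const_mul_mem (c j) (hf j).1 (hf j).2]

lemma oscTuple_splitTuple (f : Fin m → E n → 𝕜) (c : Fin m → 𝕜) (τ σ : Finset (Fin m)) (x : E n)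
    (r : ℝ) : oscTuple b c (splitTuple f σ x r) τ = splitTuple (oscTuple b c f τ) σ x r := by
  ext1 j
  by_cases hj : j ∈ τ
  · simp [oscTuple, splitTuple, hj]
  · simp only [oscTuple, splitTuple, hj, if_false]
    split_ifs <;> exact funext fun z =>
      (Set.indicator_mul_right _ (fun z => b j z - c j) (f j)).symm

lemma splitTuple_eq_piecewise (f : Fin m → E n → 𝕜) (σ : Finset (Fin m)) (x : E n) (r : ℝ) :
    splitTuple f σ x r = σ.piecewise (fun j => (ball x (2 * r))ᶜ.indicator (f j))
      (fun j => (ball x (2 * r)).indicator (f j)) := rfl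

lemma compl_add_indicator (f : Fin m → E n → 𝕜) (x : E n) (r : ℝ) :
    (fun j => (ball x r)ᶜ.indicator (f j)) + (fun j => (ball x r).indicator (f j)) = f := by
  ext1 j
  exact Set.indicator_compl_add_self (ball x r) (f j)

end Split

/-- The expansion of `|U f|` on a ball into a local part and terms controlled by `S`. -/
def HasLocalExpansion {n m : ℕ} {ε : Type*} [ENorm ε] (D : Fin m → Submodule 𝕜 (E n → 𝕜))
    (b : Fin m → E n → 𝕜) (S : (Fin m → E n → 𝕜) → E n → ℝ≥0∞)
    (U : (Fin m → E n → 𝕜) → E n → ε) : Prop :=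
  ∀ f ∈ commutatorDomain D b, ∀ (x₀ : E n) (r : ℝ) (c : Fin m → 𝕜), ∀ᵐ x,
    ‖U f x‖ₑ ≤ ‖U (splitTuple f ∅ x₀ r) x‖ₑ +
      ∑ σ ∈ (Finset.univ : Finset (Finset (Fin m))).erase ∅, ∑ τ : Finset (Fin m),
        (∏ j ∈ τ, ‖b j x - c j‖ₑ) * S (splitTuple (oscTuple b c f τ) σ x₀ r) x

section SublinearExpansion

variable {n m : ℕ} {D : Fin m → Submodule 𝕜 (E n → 𝕜)} {b : Fin m → E n → 𝕜}
  {S : (Fin m → E n → 𝕜) → E n → ℝ≥0∞}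

/-- At a fixed $x$ the numbers $b_j(x)$ are constants. Subadditivity is used twice, for the near and
far pieces and for $b_j(x)-b_j=(b_j(x)-c_j)-(b_j-c_j)$, and homogeneity takes out the scalars. The
purely near term is left unexpanded, since the Lebesgue bound applies to the commutator itself. -/
lemma IsMultisublinearOn.hasLocalExpansion (hD : IsOperatorDomain D)
    (hS : IsMultisublinearOn D S) :
    HasLocalExpansion D b S (sublinearIteratedCommutator b S) := by
  intro f hf x₀ r c
  refine Filter.Eventually.of_forall fun x => ?_
  have hadd : ∀ f, (∀ j, f j ∈ D j) → ∀ i, ∀ g ∈ D i, ∀ h ∈ D i, ∀ᶠ y in pure x,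
      S (Function.update f i (g + h)) y ≤
        S (Function.update f i g) y + S (Function.update f i h) y :=
    fun f hf i g hg h hh => Filter.eventually_pure.2 (hS.map_add_le f hf i g hg h hh x)
  have hmul : ∀ {g : Fin m → E n → 𝕜}, g ∈ commutatorDomain D b → ∀ j,
      (fun z => (b j x - b j z) * g j z) ∈ D j := by
    intro g hg j
    have := Submodule.smul_mem _ (-1 : 𝕜) (sub_const_mul_mem (b j x) (hg j).1 (hg j).2)
    convert this using 1
    ext z
    simp only [Pi.smul_apply, smul_eq_mul]
    ring
  have h1 : sublinearIteratedCommutator b S f x ≤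
      ∑ σ : Finset (Fin m), sublinearIteratedCommutator b S (splitTuple f σ x₀ r) x := by
    set F : Fin m → E n → 𝕜 := fun j z => (b j x - b j z) * f j z with hF
    have hFm : ∀ j, F j ∈ D j := hmul hf
    have := Filter.eventually_pure.1 (eventually_le_sum_piecewise hadd
      (u := fun j => (ball x₀ (2 * r))ᶜ.indicator (F j))
      (v := fun j => (ball x₀ (2 * r)).indicator (F j))
      (fun j => hD.indicator_compl (hFm j) _ _) (fun j => hD.indicator_ball j _ (hFm j) _ _))
    rw [compl_add_indicator] at this
    refine this.trans (le_of_eq (Finset.sum_congr rfl fun σ _ => ?_))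
    rw [← splitTuple_eq_piecewise, sublinearIteratedCommutator]
    congr 1
    ext1 j
    exact (mul_splitTuple f σ x₀ r j (fun z => b j x - b j z)).symm
  have h2 : ∀ g ∈ commutatorDomain D b, sublinearIteratedCommutator b S g x ≤
      ∑ τ : Finset (Fin m), (∏ j ∈ τ, ‖b j x - c j‖ₑ) * S (oscTuple b c g τ) x := by
    intro g hg
    set u : Fin m → E n → 𝕜 := fun j => (b j x - c j) • g j
    set v : Fin m → E n → 𝕜 := fun j => (-1 : 𝕜) • fun z => (b j z - c j) * g j z
    have huv : u + v = fun j z => (b j x - b j z) * g j z := by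
      ext j z
      simp only [u, v, Pi.add_apply, Pi.smul_apply, smul_eq_mul]
      ring
    have := Filter.eventually_pure.1 (eventually_le_sum_piecewise hadd (u := u) (v := v)
      (fun j => Submodule.smul_mem _ _ (hg j).1)
      (fun j => Submodule.smul_mem _ _ (sub_const_mul_mem (c j) (hg j).1 (hg j).2)))
    rw [huv] at this
    refine this.trans (le_of_eq (Finset.sum_congr rfl fun τ _ => ?_))
    have e : τ.piecewise u v =
        fun j => (if j ∈ τ then b j x - c j else (-1 : 𝕜)) • oscTuple b c g τ j := by
      ext1 j
      by_cases hj : j ∈ τ <;> simp [oscTuple, u, v, hj]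
    rw [e, hS.apply_smul (oscTuple_mem hg c τ)]
    congr 1
    rw [← Finset.prod_subset (Finset.subset_univ τ) fun j _ hj => by simp [hj]]
    exact Finset.prod_congr rfl fun j hj => by simp [hj]
  rw [enorm_eq_self, enorm_eq_self]
  refine h1.trans ?_
  rw [← Finset.add_sum_erase _ _ (Finset.mem_univ ∅)]
  gcongr with σ _
  refine (h2 _ (hD.splitTuple_mem_commutatorDomain hf σ x₀ r)).trans (le_of_eq ?_)
  exact Finset.sum_congr rfl fun τ _ => by rw [oscTuple_splitTuple]

end SublinearExpansion

/-! ### Commutators of multilinear operators -/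

section Multilinear

variable {n m : ℕ} {D : Fin m → Submodule 𝕜 (E n → 𝕜)}

/-- The domain of `commutator k b U` for an operator `U` with domain `D`. -/
def shrinkDomain (k : Fin m) (b : E n → 𝕜) (D : Fin m → Submodule 𝕜 (E n → 𝕜)) :
    Fin m → Submodule 𝕜 (E n → 𝕜) :=
  Function.update D k (D k ⊓ (D k).comap (LinearMap.mulLeft 𝕜 b))

lemma mem_shrinkDomain_self {k : Fin m} {b g : E n → 𝕜} :
    g ∈ shrinkDomain k b D k ↔ g ∈ D k ∧ b * g ∈ D k := by
  simp [shrinkDomain]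

lemma shrinkDomain_of_ne {k j : Fin m} (h : j ≠ k) (b : E n → 𝕜) :
    shrinkDomain k b D j = D j := by
  simp [shrinkDomain, h]

lemma shrinkDomain_le (k : Fin m) (b : E n → 𝕜) (j : Fin m) : shrinkDomain k b D j ≤ D j := by
  rcases eq_or_ne j k with rfl | hj
  · exact fun g hg => (mem_shrinkDomain_self.1 hg).1
  · exact (shrinkDomain_of_ne hj b).le

lemma update_mem {f : Fin m → E n → 𝕜} (hf : ∀ j, f j ∈ D j) {i : Fin m} {g : E n → 𝕜}
    (hg : g ∈ D i) (j : Fin m) : Function.update f i g j ∈ D j := by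
  rcases eq_or_ne j i with rfl | hj
  · simpa using hg
  · simpa [hj] using hf j

/-- Forming $[b,T]_k$ preserves multilinearity once the $k$-th domain is cut down to the $g$ with
$bg$ still admissible, which allows induction along the list of commutators. -/
lemma IsMultilinearOn.commutator {T : (Fin m → E n → 𝕜) → E n → 𝕜} (hT : IsMultilinearOn D T)
    (k : Fin m) {b : E n → 𝕜} (hb : AEStronglyMeasurable b volume) :
    IsMultilinearOn (shrinkDomain k b D) (commutator k b T) := by
  have hle := fun j => shrinkDomain_le (D := D) k b j
  have hk : ∀ {f : Fin m → E n → 𝕜}, (∀ j, f j ∈ shrinkDomain k b D j) →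
      ∀ j, Function.update f k (b * f k) j ∈ D j := fun hf =>
    update_mem (fun j => hle j (hf j)) (mem_shrinkDomain_self.1 (hf k)).2
  refine ⟨fun f hf => ?_, fun f hf i g hg h hh => ?_, fun f hf i g hg c => ?_⟩
  · exact (hb.mul (hT.aestronglyMeasurable f fun j => hle j (hf j))).sub
      (hT.aestronglyMeasurable _ (hk hf))
  · have h1 := hT.map_add f (fun j => hle j (hf j)) i g (hle i hg) h (hle i hh)
    rcases eq_or_ne i k with rfl | hi
    · have h2 := hT.map_add f (fun j => hle j (hf j)) i _ (mem_shrinkDomain_self.1 hg).2 _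
        (mem_shrinkDomain_self.1 hh).2
      filter_upwards [h1, h2] with x hx1 hx2
      simp only [Amalgam.commutator, Function.update_self, Function.update_idem, mul_add, hx1, hx2]
      ring
    · have h2 := hT.map_add _ (hk hf) i g (hle i hg) h (hle i hh)
      have hc : ∀ G, Function.update (Function.update f i G) k (b * f k) =
          Function.update (Function.update f k (b * f k)) i G :=
        fun G => Function.update_comm hi _ _ _
      filter_upwards [h1, h2] with x hx1 hx2
      simp only [Amalgam.commutator, Function.update_of_ne hi.symm, hc, hx1, hx2]
      ring
  · have h1 := hT.map_smul f (fun j => hle j (hf j)) i g (hle i hg) c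
    rcases eq_or_ne i k with rfl | hi
    · have h2 := hT.map_smul f (fun j => hle j (hf j)) i _ (mem_shrinkDomain_self.1 hg).2 c
      filter_upwards [h1, h2] with x hx1 hx2
      simp only [Amalgam.commutator, Function.update_self, Function.update_idem, mul_smul_comm,
        hx1, hx2]
      ring
    · have h2 := hT.map_smul _ (hk hf) i g (hle i hg) c
      have hc : ∀ G, Function.update (Function.update f i G) k (b * f k) =
          Function.update (Function.update f k (b * f k)) i G :=
        fun G => Function.update_comm hi _ _ _
      filter_upwards [h1, h2] with x hx1 hx2
      simp only [Amalgam.commutator, Function.update_of_ne hi.symm, hc, hx1, hx2]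
      ring

/-- The domain of the iterated commutator over a list of indices. -/
def iteratedDomain (b : Fin m → E n → 𝕜) (D : Fin m → Submodule 𝕜 (E n → 𝕜)) (l : List (Fin m)) :
    Fin m → Submodule 𝕜 (E n → 𝕜) :=
  l.foldr (fun i D => shrinkDomain i (b i) D) D

/-- The iterated commutator over a list of indices. -/
def listCommutator (b : Fin m → E n → 𝕜) (T : (Fin m → E n → 𝕜) → E n → 𝕜) (l : List (Fin m)) :
    (Fin m → E n → 𝕜) → E n → 𝕜 :=
  l.foldr (fun i U => Amalgam.commutator i (b i) U) T

variable {T : (Fin m → E n → 𝕜) → E n → 𝕜} {b : Fin m → E n → 𝕜}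

lemma isMultilinearOn_listCommutator (hT : IsMultilinearOn D T)
    (hb : ∀ j, AEStronglyMeasurable (b j) volume) (l : List (Fin m)) :
    IsMultilinearOn (iteratedDomain b D l) (listCommutator b T l) := by
  induction l with
  | nil => exact hT
  | cons k l ih => exact ih.commutator k (hb k)

lemma iteratedDomain_of_notMem {l : List (Fin m)} {j : Fin m} (h : j ∉ l) :
    iteratedDomain b D l j = D j := by
  induction l with
  | nil => rfl
  | cons k l ih =>
    rw [List.mem_cons, not_or] at h
    exact (shrinkDomain_of_ne h.1 _).trans (ih h.2)

lemma mem_iteratedDomain {l : List (Fin m)} (hl : l.Nodup) {j : Fin m} {g : E n → 𝕜}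
    (hg : g ∈ D j) (hbg : b j * g ∈ D j) : g ∈ iteratedDomain b D l j := by
  induction l with
  | nil => exact hg
  | cons k l ih =>
    rw [List.nodup_cons] at hl
    change g ∈ shrinkDomain k (b k) (iteratedDomain b D l) j
    rcases eq_or_ne j k with rfl | hj
    · rw [mem_shrinkDomain_self, iteratedDomain_of_notMem hl.1]
      exact ⟨hg, hbg⟩
    · rw [shrinkDomain_of_ne hj]
      exact ih hl.2

/-- A constant symbol commutes with an operator linear in that slot, so the contributions of $c_k$
cancel. This is where linearity lets the symbols be centred. -/
lemma listCommutator_sub_const_ae_eq (hT : IsMultilinearOn D T)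
    (hb : ∀ j, AEStronglyMeasurable (b j) volume) (c : Fin m → 𝕜) (l : List (Fin m)) :
    ∀ f : Fin m → E n → 𝕜, (∀ j, f j ∈ iteratedDomain b D l j) →
      listCommutator (fun j z => b j z - c j) T l f =ᵐ[volume] listCommutator b T l f := by
  induction l with
  | nil => exact fun f _ => Filter.EventuallyEq.rfl
  | cons k l ih =>
    intro f hf
    have hf' : ∀ j, f j ∈ iteratedDomain b D l j := fun j => shrinkDomain_le k (b k) j (hf j)
    have hk := mem_shrinkDomain_self.1 (hf k)
    have hM := isMultilinearOn_listCommutator hT hb l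
    have hck : (-c k) • f k ∈ iteratedDomain b D l k := Submodule.smul_mem _ _ hk.1
    have e : (fun z => b k z - c k) * f k = b k * f k + (-c k) • f k := by
      ext z
      simp only [Pi.mul_apply, Pi.add_apply, Pi.smul_apply, smul_eq_mul]
      ring
    filter_upwards [ih f hf', ih _ (update_mem hf' (add_mem hk.2 hck)),
      hM.map_add f hf' k _ hk.2 _ hck, hM.map_smul f hf' k _ hk.1 (-c k)] with x h1 h2 h3 h4
    change (b k x - c k) * listCommutator (fun j z => b j z - c j) T l f x -
      listCommutator (fun j z => b j z - c j) T l
        (Function.update f k ((fun z => b k z - c k) * f k)) x =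
      b k x * listCommutator b T l f x -
        listCommutator b T l (Function.update f k (b k * f k)) x
    rw [e, h1, h2, h3, h4, Function.update_eq_self]
    ring

/-- Only the triangle inequality: each commutator either multiplies outside by $b_j(x)$, for
$j\in\tau$, or inserts $b_j$ into the $j$-th slot. No linearity of `T` is involved. -/
lemma enorm_listCommutator_le (b : Fin m → E n → 𝕜) (T : (Fin m → E n → 𝕜) → E n → 𝕜)
    {l : List (Fin m)} (hl : l.Nodup) (x : E n) :
    ∀ f : Fin m → E n → 𝕜, ‖listCommutator b T l f x‖ₑ ≤
      ∑ τ ∈ l.toFinset.powerset, (∏ j ∈ τ, ‖b j x‖ₑ) *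
        ‖T (fun j => if j ∈ l ∧ j ∉ τ then b j * f j else f j) x‖ₑ := by
  induction l with
  | nil => intro f; simp [listCommutator]
  | cons k l ih =>
    intro f
    rw [List.nodup_cons] at hl
    have hk : k ∉ l.toFinset := by simpa using hl.1
    rw [List.toFinset_cons, Finset.sum_powerset_insert hk, add_comm]
    change ‖b k x * listCommutator b T l f x -
        listCommutator b T l (Function.update f k (b k * f k)) x‖ₑ ≤ _
    refine enorm_sub_le.trans (add_le_add ?_ ?_)
    · rw [enorm_mul]
      refine (mul_le_mul_right (ih hl.2 f) _).trans (le_of_eq ?_)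
      rw [Finset.mul_sum]
      refine Finset.sum_congr rfl fun τ hτ => ?_
      have hkτ : k ∉ τ := fun h => hk (Finset.mem_powerset.1 hτ h)
      rw [Finset.prod_insert hkτ, mul_assoc]
      congr 4
      ext1 j
      rcases eq_or_ne j k with rfl | hj
      · simp [hl.1]
      · simp [hj]
    · refine (ih hl.2 _).trans (le_of_eq ?_)
      refine Finset.sum_congr rfl fun τ hτ => ?_
      have hkτ : k ∉ τ := fun h => hk (Finset.mem_powerset.1 hτ h)
      congr 3
      ext1 j
      rcases eq_or_ne j k with rfl | hj
      · simp [hl.1, hkτ]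
      · simp [hj]

/-- The commutator is multilinear, so it splits into near and far pieces. On each piece the symbols
are replaced by $b_j-c_j$ before the brackets are opened. -/
lemma IsMultilinearOn.hasLocalExpansion (hD : IsOperatorDomain D) (hT : IsMultilinearOn D T)
    (hb : ∀ j, AEStronglyMeasurable (b j) volume) :
    HasLocalExpansion D b (fun f x => ‖T f x‖ₑ) (iteratedCommutator b T) := by
  intro f hf x₀ r c
  set l := List.finRange m
  have hl : l.Nodup := List.nodup_finRange m
  have hM := isMultilinearOn_listCommutator hT hb l
  have hmem : ∀ g ∈ commutatorDomain D b, ∀ j, g j ∈ iteratedDomain b D l j :=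
    fun g hg j => mem_iteratedDomain hl (hg j).1 (hg j).2
  have h1 : ∀ᵐ x, ‖listCommutator b T l f x‖ₑ ≤
      ∑ σ : Finset (Fin m), ‖listCommutator b T l (splitTuple f σ x₀ r) x‖ₑ := by
    have := eventually_le_sum_piecewise (F := ae volume) (D := iteratedDomain b D l)
      (S := fun f x => ‖listCommutator b T l f x‖ₑ)
      (u := fun j => (ball x₀ (2 * r))ᶜ.indicator (f j))
      (v := fun j => (ball x₀ (2 * r)).indicator (f j))
      (fun f hf i g hg h hh => (hM.map_add f hf i g hg h hh).mono fun x hx => by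
        rw [hx]; exact enorm_add_le _ _)
      (by simpa [splitTuple] using
        hmem _ (hD.splitTuple_mem_commutatorDomain hf Finset.univ x₀ r))
      (by simpa [splitTuple] using
        hmem _ (hD.splitTuple_mem_commutatorDomain hf ∅ x₀ r))
    rw [compl_add_indicator] at this
    exact this
  have h2 : ∀ᵐ x, ∀ σ : Finset (Fin m), ‖listCommutator b T l (splitTuple f σ x₀ r) x‖ₑ ≤
      ∑ τ : Finset (Fin m),
        (∏ j ∈ τ, ‖b j x - c j‖ₑ) * ‖T (splitTuple (oscTuple b c f τ) σ x₀ r) x‖ₑ := by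
    rw [ae_all_iff]
    intro σ
    filter_upwards [listCommutator_sub_const_ae_eq hT hb c l _
      (hmem _ (hD.splitTuple_mem_commutatorDomain hf σ x₀ r))] with x hx
    rw [← hx]
    refine (enorm_listCommutator_le _ T hl x _).trans (le_of_eq ?_)
    rw [List.toFinset_finRange, Finset.powerset_univ]
    refine Finset.sum_congr rfl fun τ _ => ?_
    rw [← oscTuple_splitTuple]
    congr 3
    ext1 j
    by_cases hj : j ∈ τ
    · simp [oscTuple, hj]
    · simp only [oscTuple, hj, l, List.mem_finRange, not_false_eq_true, and_self, if_true, if_false]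
      rfl
  filter_upwards [h1, h2] with x hx1 hx2
  refine hx1.trans ?_
  rw [← Finset.add_sum_erase _ _ (Finset.mem_univ ∅)]
  exact add_le_add le_rfl (Finset.sum_le_sum fun σ _ => hx2 σ)

lemma IsMultilinearOn.aestronglyMeasurable_iteratedCommutator (hT : IsMultilinearOn D T)
    (hb : ∀ j, AEStronglyMeasurable (b j) volume) {f : Fin m → E n → 𝕜}
    (hf : f ∈ commutatorDomain D b) : AEStronglyMeasurable (iteratedCommutator b T f) volume :=
  (isMultilinearOn_listCommutator hT hb (List.finRange m)).aestronglyMeasurable f fun j =>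
    mem_iteratedDomain (List.nodup_finRange m) (hf j).1 (hf j).2

end Multilinear

/-! ### Local averages -/

section Averages

variable {n m : ℕ}

/-- Hölder's inequality against a weight and its dual weight. -/
lemma lintegral_mul_rpow_le {ω : E n → ℝ} (hω : IsWeight ω) {s : ℝ} (hs : 0 < s) {Q : ℝ≥0∞}
    (hQ : Q ≠ ∞) (hsQ : s < Q.toReal) {f : E n → 𝕜} (hf : AEStronglyMeasurable f volume)
    {h : E n → ℝ≥0∞} (hh : AEMeasurable h volume) {u : ℝ}
    (hu : u = s * (Q.toReal / s / (Q.toReal / s - 1))) (x : E n) (R : ℝ) :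
    (∫⁻ z in ball x R, (h z * ‖f z‖ₑ) ^ s) ^ (1 / s) ≤
      eLpNorm f Q ((weightMeasure ω).restrict (ball x R)) *
        (∫⁻ z in ball x R, h z ^ u
          ∂(volume.withDensity (dualWeight (Q.toReal / s) ω))) ^ (1 / u) := by
  have hQ0 : Q ≠ 0 := by rintro rfl; simp at hsQ; linarith
  set t := Q.toReal with ht
  have ht0 : 0 < t := hs.trans hsQ
  have hp1 : 1 < t / s := (one_lt_div hs).2 hsQ
  have hconj : (t / s).HolderConjugate (t / s / (t / s - 1)) :=
    Real.HolderConjugate.conjExponent hp1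
  have hp0 := hconj.pos
  have hq0 := hconj.symm.pos
  have hWm := hω.aemeasurable
  set W : E n → ℝ≥0∞ := fun y => ENNReal.ofReal (ω y)
  -- Insert $W^{1/(t/s)}W^{-1/(t/s)}$: the first factor turns $|f|^s$ into an $L^t(\omega)$
  -- integrand, the second raised to $(t/s)'$ is the dual weight.
  have key := ENNReal.lintegral_mul_le_Lp_mul_Lq (volume.restrict (ball x R)) hconj
    (f := fun z => ‖f z‖ₑ ^ s * W z ^ (1 / (t / s)))
    (g := fun z => h z ^ s * W z ^ (-(1 / (t / s))))
    ((hf.enorm.pow_const _).mul (hWm.pow_const _)).restrict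
    ((hh.pow_const _).mul (hWm.pow_const _)).restrict
  have e0 : ∫⁻ z in ball x R, (h z * ‖f z‖ₑ) ^ s = ∫⁻ z in ball x R,
      ((fun z => ‖f z‖ₑ ^ s * W z ^ (1 / (t / s))) *
        fun z => h z ^ s * W z ^ (-(1 / (t / s)))) z := by
    refine lintegral_congr_ae (ae_restrict_of_ae ?_)
    filter_upwards [hω.pos] with z hz
    have hW0 : W z ≠ 0 := by simpa [W] using hz
    have hWt : W z ≠ ∞ := ENNReal.ofReal_ne_top
    simp only [Pi.mul_apply]
    calc (h z * ‖f z‖ₑ) ^ s = h z ^ s * ‖f z‖ₑ ^ s *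
          (W z ^ (1 / (t / s)) * W z ^ (-(1 / (t / s)))) := by
          rw [← ENNReal.rpow_add _ _ hW0 hWt, add_neg_cancel, ENNReal.rpow_zero, mul_one,
            ENNReal.mul_rpow_of_nonneg _ _ hs.le]
      _ = _ := by ring
  have e1 : ∫⁻ z in ball x R, (‖f z‖ₑ ^ s * W z ^ (1 / (t / s))) ^ (t / s) =
      ∫⁻ z in ball x R, ‖f z‖ₑ ^ t ∂(weightMeasure ω) := by
    rw [weightMeasure, setLIntegral_withDensity_eq_lintegral_mul₀ hWm (hf.enorm.pow_const _)
      measurableSet_ball]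
    refine lintegral_congr fun z => ?_
    rw [ENNReal.mul_rpow_of_nonneg _ _ hp0.le, ← ENNReal.rpow_mul, ← ENNReal.rpow_mul,
      one_div_mul_cancel hp0.ne', ENNReal.rpow_one, mul_div_cancel₀ t hs.ne', Pi.mul_apply,
      mul_comm]
  have e2 : ∫⁻ z in ball x R, (h z ^ s * W z ^ (-(1 / (t / s)))) ^ (t / s / (t / s - 1)) =
      ∫⁻ z in ball x R, h z ^ u ∂(volume.withDensity (dualWeight (t / s) ω)) := by
    have hdm : AEMeasurable (dualWeight (t / s) ω) volume := hWm.pow_const _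
    rw [setLIntegral_withDensity_eq_lintegral_mul₀ hdm (hh.pow_const _) measurableSet_ball]
    refine lintegral_congr fun z => ?_
    rw [ENNReal.mul_rpow_of_nonneg _ _ hq0.le, ← ENNReal.rpow_mul, ← ENNReal.rpow_mul, ← hu,
      Pi.mul_apply, mul_comm, dualWeight]
    congr 2
    have key2 : ∀ p : ℝ, p ≠ 0 → p - 1 ≠ 0 → -(1 / p) * (p / (p - 1)) = 1 - p / (p - 1) := by
      intro p h1 h2
      field_simp
      ring
    exact key2 _ hp0.ne' (by linarith)
  rw [e0]
  refine (ENNReal.rpow_le_rpow key (by positivity)).trans (le_of_eq ?_)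
  rw [e1, e2, ENNReal.mul_rpow_of_nonneg _ _ (by positivity), ← ENNReal.rpow_mul,
    ← ENNReal.rpow_mul, eLpNorm_eq_lintegral_rpow_enorm_toReal hQ0 hQ]
  congr 2
  · rw [← ht]; field_simp
  · rw [hu]; field_simp

/-- Passing from $2B$ to $2^{k+1}B$ costs the volume ratio $2^{nk}$, which the factor
$2^{-nk|\sigma^c|}$ of the size condition pays for once per near slot. For $s\ge1$ the root $1/s$
can be dropped from this ratio. -/
lemma rpow_ballMean_two_mul_le (g : E n → ℝ≥0∞) (x : E n) {r : ℝ} (hr : 0 < r) {s : ℝ}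
    (hs : 1 ≤ s) (k : ℕ) :
    ballMean g x (2 * r) ^ (1 / s) ≤ 2 ^ (n * k) * ballMean g x (2 ^ (k + 1) * r) ^ (1 / s) := by
  have h2 : (2 : ℝ) ^ (k + 1) * r = 2 ^ k * (2 * r) := by ring
  have hk : (0 : ℝ) < 2 ^ k := by positivity
  have h1k : (1 : ℝ) ≤ 2 ^ k := one_le_pow₀ one_le_two
  have hr2 : 0 < 2 * r := by positivity
  have e : ENNReal.ofReal (((2 : ℝ) ^ k) ^ n) = 2 ^ (n * k) := by
    rw [← pow_mul, mul_comm k n, ENNReal.ofReal_pow (by norm_num)]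
    simp
  have h3 : ballMean g x (2 * r) ≤ 2 ^ (n * k) * ballMean g x (2 ^ (k + 1) * r) := by
    unfold ballMean
    rw [← mul_assoc, h2]
    gcongr ?_ * ?_
    · refine ENNReal.inv_le_mul_inv_of_le (volume_ball_pos' x hr2) (volume_ball_ne_top' x _)
        (volume_ball_pos' x (by positivity)) (volume_ball_ne_top' x _) ?_
      rw [volume_ball_mul x x hk, e]
    · exact lintegral_mono_set (ball_subset_ball (by nlinarith))
  have hs0 : 0 ≤ 1 / s := by positivity
  calc _ ≤ (2 ^ (n * k) * ballMean g x (2 ^ (k + 1) * r)) ^ (1 / s) := by gcongr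
    _ = (2 ^ (n * k)) ^ (1 / s) * ballMean g x (2 ^ (k + 1) * r) ^ (1 / s) :=
        ENNReal.mul_rpow_of_nonneg _ _ hs0
    _ ≤ _ := by
        gcongr
        calc ((2 : ℝ≥0∞) ^ (n * k)) ^ (1 / s) ≤ (2 ^ (n * k)) ^ (1 : ℝ) :=
              ENNReal.rpow_le_rpow_of_exponent_le (one_le_pow₀ one_le_two)
                (by rw [div_le_one (by linarith)]; exact hs)
          _ = _ := ENNReal.rpow_one _

/-- The right-hand side of the size condition is a series of products of averages over the same
ball. -/
lemma size_le_tsum_prod_ballMean (g : Fin m → E n → ℝ≥0∞) (x : E n) {r : ℝ} (hr : 0 < r) {s : ℝ}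
    (hs : 1 ≤ s) (σ : Finset (Fin m)) :
    (∏ j ∈ σᶜ, (ballMean (g j) x (2 * r)) ^ (1 / s)) *
      ∑' k : ℕ, (k : ℝ≥0∞) / 2 ^ (n * k * σᶜ.card) *
        ∏ j ∈ σ, ((volume (ball x (2 ^ (k + 1) * r)))⁻¹ *
          ∫⁻ z in ball x (2 ^ (k + 1) * r) \ ball x (2 ^ k * r), g j z) ^ (1 / s) ≤
    ∑' k : ℕ, (k : ℝ≥0∞) * ∏ j, ballMean (g j) x (2 ^ (k + 1) * r) ^ (1 / s) := by
  rw [← ENNReal.tsum_mul_left]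
  refine ENNReal.tsum_le_tsum fun k => ?_
  set X : Fin m → ℝ≥0∞ := fun j => ballMean (g j) x (2 ^ (k + 1) * r) ^ (1 / s)
  set N : ℝ≥0∞ := 2 ^ (n * k * σᶜ.card) with hN
  have h1 : ∏ j ∈ σᶜ, (ballMean (g j) x (2 * r)) ^ (1 / s) ≤ N * ∏ j ∈ σᶜ, X j := by
    calc _ ≤ ∏ j ∈ σᶜ, (2 ^ (n * k) * X j) :=
          Finset.prod_le_prod' fun j _ => rpow_ballMean_two_mul_le (g j) x hr hs k
      _ = _ := by rw [Finset.prod_mul_distrib, Finset.prod_const, ← pow_mul]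
  have h2 : ∏ j ∈ σ, ((volume (ball x (2 ^ (k + 1) * r)))⁻¹ *
      ∫⁻ z in ball x (2 ^ (k + 1) * r) \ ball x (2 ^ k * r), g j z) ^ (1 / s) ≤ ∏ j ∈ σ, X j := by
    refine Finset.prod_le_prod' fun j _ => ?_
    refine ENNReal.rpow_le_rpow ?_ (by positivity)
    unfold ballMean
    gcongr
    exact Set.sdiff_subset
  have hN0 : N ≠ 0 := by rw [hN]; positivity
  have hNt : N ≠ ∞ := by rw [hN]; finiteness
  calc _ ≤ (N * ∏ j ∈ σᶜ, X j) * (k / N * ∏ j ∈ σ, X j) := by gcongr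
    _ = (N * (k / N)) * ((∏ j ∈ σ, X j) * ∏ j ∈ σᶜ, X j) := by ring
    _ = _ := by rw [ENNReal.mul_div_cancel hN0 hNt, Finset.prod_mul_prod_compl]

/-- The factor `|b - c|` or `1` in the entries of `oscTuple`. -/
lemma enorm_oscTuple (b : Fin m → E n → 𝕜) (c : Fin m → 𝕜) (f : Fin m → E n → 𝕜)
    (τ : Finset (Fin m)) (j : Fin m) (z : E n) :
    ‖oscTuple b c f τ j z‖ₑ = (if j ∈ τ then 1 else ‖b j z - c j‖ₑ) * ‖f j z‖ₑ := by
  unfold oscTuple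
  split_ifs <;> simp

variable (𝕜) in
/-- Averages of the entries of `oscTuple`. -/
lemma exists_ballMean_oscTuple_le (hn : 0 < n) {ω : E n → ℝ} (hω : IsWeight ω) {s : ℝ}
    (hs : 0 < s) {Q : ℝ≥0∞} (hQ : Q ≠ ∞) (hsQ : s < Q.toReal)
    (hdual : IsAInftyMeasure (volume.withDensity (dualWeight (Q.toReal / s) ω))) :
    ∃ C : ℝ≥0∞, C ≠ ∞ ∧ ∀ b : E n → 𝕜, MemBMO b → ∀ f : E n → 𝕜, AEStronglyMeasurable f volume →
      ∀ (x : E n) (r : ℝ), 0 < r → ∀ (k : ℕ) (osc : Prop) [Decidable osc],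
      ballMean (fun z => ((if osc then 1 else ‖b z - ⨍ y in ball x r, b y‖ₑ) * ‖f z‖ₑ) ^ s) x
          (2 ^ k * r) ^ (1 / s) ≤
        (C * ((k : ℝ≥0∞) + 1) * if osc then 1 else bmoNorm b) *
          eLpNorm f Q ((weightMeasure ω).restrict (ball x (2 ^ k * r))) *
          ((volume (ball x (2 ^ k * r)))⁻¹ ^ (1 / s) *
            (volume.withDensity (dualWeight (Q.toReal / s) ω)) (ball x (2 ^ k * r)) ^
              (1 / (s * (Q.toReal / s / (Q.toReal / s - 1))))) := by
  set u := s * (Q.toReal / s / (Q.toReal / s - 1)) with hu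
  have hp1 : 1 < Q.toReal / s := (one_lt_div hs).2 hsQ
  have hu0 : 0 < u := by
    have : 0 < Q.toReal / s - 1 := by linarith
    have : 0 < Q.toReal / s := by linarith
    positivity
  set μ := volume.withDensity (dualWeight (Q.toReal / s) ω)
  obtain ⟨C, hC, hosc⟩ := hdual.exists_oscillation_bound 𝕜 hn hu0
  refine ⟨C ^ (1 / u) + 1, by
    have := ENNReal.rpow_ne_top_of_nonneg (y := 1 / u) (by positivity) hC
    finiteness, fun b hb f hf x r hr k osc _ => ?_⟩
  set c := ⨍ y in ball x r, b y
  set B := ball x (2 ^ k * r)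
  set h : E n → ℝ≥0∞ := fun z => if osc then 1 else ‖b z - c‖ₑ with hh
  have hhm : AEMeasurable h volume := by
    rw [hh]
    split_ifs
    · exact aemeasurable_const
    · exact (hb.1.aestronglyMeasurable.aemeasurable.sub_const _).enorm
  -- The mean is taken over the small ball while the integral runs over $2^kB$; hence the factor
  -- $k+1$.
  have h1 : (∫⁻ z in B, h z ^ u ∂μ) ^ (1 / u) ≤
      ((C ^ (1 / u) + 1) * ((k : ℝ≥0∞) + 1) * if osc then 1 else bmoNorm b) *
        μ B ^ (1 / u) := by
    by_cases ho : osc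
    · simp only [hh, ho, if_true, ENNReal.one_rpow, setLIntegral_const, one_mul, mul_one]
      refine le_mul_of_one_le_left zero_le (one_le_mul le_add_self le_add_self)
    · simp only [hh, ho, if_false]
      refine (ENNReal.rpow_le_rpow (hosc b hb x r hr k) (by positivity)).trans ?_
      rw [ENNReal.mul_rpow_of_nonneg _ _ (by positivity),
        ENNReal.mul_rpow_of_nonneg _ _ (by positivity), one_div, ENNReal.rpow_rpow_inv hu0.ne',
        ← mul_assoc]
      gcongr
      exact le_self_add
  have h2 := lintegral_mul_rpow_le hω hs hQ hsQ hf hhm hu x (2 ^ k * r)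
  rw [ballMean, ENNReal.mul_rpow_of_nonneg _ _ (by positivity)]
  calc _ ≤ (volume B)⁻¹ ^ (1 / s) * (eLpNorm f Q ((weightMeasure ω).restrict B) *
        (((C ^ (1 / u) + 1) * ((k : ℝ≥0∞) + 1) * if osc then 1 else bmoNorm b) *
        μ B ^ (1 / u))) := by
        gcongr
        exact h2.trans (by gcongr)
    _ = _ := by ring

end Averages

/-! ### The local estimate -/

lemma weightMeasure_ball_ne_zero {n : ℕ} {ω : E n → ℝ}
    (hω : AEMeasurable (fun y => ENNReal.ofReal (ω y)) volume) (hpos : ∀ᵐ y, 0 < ω y) (x : E n)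
    {r : ℝ} (hr : 0 < r) : weightMeasure ω (ball x r) ≠ 0 := by
  rw [weightMeasure, withDensity_apply _ measurableSet_ball]
  exact lintegral_ball_ne_zero hω (hpos.mono fun y hy => by simpa using hy) x hr

lemma IsWeight.weightMeasure_ball_ne_top {n : ℕ} {ω : E n → ℝ} (hω : IsWeight ω) (x : E n)
    (r : ℝ) : weightMeasure ω (ball x r) ≠ ∞ := by
  rw [weightMeasure, withDensity_apply _ measurableSet_ball]
  have h := (hω.locallyIntegrable.integrableOn_isCompact
    (isCompact_closedBall x r)).mono_set (ball_subset_closedBall (x := x) (ε := r))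
  exact h.lintegral_lt_top.ne

lemma multiWeight_pos {n m : ℕ} {ω : Fin m → E n → ℝ} (hω : ∀ j, IsWeight (ω j)) (p : ℝ)
    (P : Fin m → ℝ) : ∀ᵐ y, 0 < multiWeight p P ω y := by
  filter_upwards [ae_all_iff.2 fun j => (hω j).pos] with y hpos
  exact Finset.prod_pos fun j _ => Real.rpow_pos_of_pos (hpos j) _

/-- The exponent $q$ may be below 1, hence the quasi-norm constant. Measurability of one summand is
enough to split the integral. -/
lemma eLpNorm_le_of_ae_le_add {α : Type*} [MeasurableSpace α] {μ : Measure α} {q : ℝ≥0∞}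
    (hq0 : q ≠ 0) (hqt : q ≠ ∞) {g u v : α → ℝ≥0∞} (h : ∀ᵐ z ∂μ, g z ≤ u z + v z)
    (hv : AEMeasurable v μ) :
    eLpNorm g q μ ≤ (2 * 2 ^ (1 / q.toReal)) * (eLpNorm u q μ + eLpNorm v q μ) := by
  have ht : 0 < q.toReal := ENNReal.toReal_pos hq0 hqt
  set t := q.toReal with ht'
  have h1 : 0 < 1 / t := by positivity
  simp only [eLpNorm_eq_lintegral_rpow_enorm_toReal hq0 hqt, enorm_eq_self, ← ht']
  have h2t : (2 : ℝ≥0∞) ^ t ≠ ∞ := ENNReal.rpow_ne_top_of_nonneg ht.le (by simp)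
  calc (∫⁻ z, g z ^ t ∂μ) ^ (1 / t)
      ≤ (2 ^ t * ((∫⁻ z, u z ^ t ∂μ) + ∫⁻ z, v z ^ t ∂μ)) ^ (1 / t) := by
        gcongr
        rw [← lintegral_add_right' _ (hv.pow_const _), ← lintegral_const_mul' _ _ h2t]
        refine lintegral_mono_ae (h.mono fun z hz => ?_)
        exact (ENNReal.rpow_le_rpow hz ht.le).trans (add_rpow_le _ _ ht)
    _ = 2 * ((∫⁻ z, u z ^ t ∂μ) + ∫⁻ z, v z ^ t ∂μ) ^ (1 / t) := by
        rw [ENNReal.mul_rpow_of_nonneg _ _ h1.le, one_div, ENNReal.rpow_rpow_inv ht.ne']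
    _ ≤ 2 * (2 ^ (1 / t) * ((∫⁻ z, u z ^ t ∂μ) ^ (1 / t) + (∫⁻ z, v z ^ t ∂μ) ^ (1 / t))) := by
        gcongr
        exact add_rpow_le _ _ h1
    _ = _ := by ring

section Local

variable {n m : ℕ} {s : ℝ} {Q : Fin m → ℝ≥0∞} {q : ℝ≥0∞} {ω : Fin m → E n → ℝ}
  {ν : Measure (E n)}

lemma harmonicExponent_div (hq : 1 / q.toReal = ∑ j, 1 / (Q j).toReal) :
    harmonicExponent (fun j => (Q j).toReal / s) = q.toReal / s := by
  unfold harmonicExponent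
  simp_rw [one_div_div]
  rw [show ∑ j, s / (Q j).toReal = s * (1 / q.toReal) by
    rw [hq, Finset.mul_sum]; exact Finset.sum_congr rfl fun j _ => by ring]
  rw [mul_one_div, one_div_div]

/-- The vector condition for the exponents $q_j/s$ is raised to the power $1/s$ and solved for the
dual measures. The weight $\nu$ is the same for $q_j$ and $q_j/s$, as only ratios of exponents occur
in it. -/
lemma MemAVec.measure_bound (hm : 0 < m) (hs : 0 < s) (hsQ : ∀ j, s < (Q j).toReal)
    (hq : 1 / q.toReal = ∑ j, 1 / (Q j).toReal)
    (hω : MemAVec (fun j => (Q j).toReal / s) ω)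
    (hν : ν = weightMeasure (multiWeight q.toReal (fun j => (Q j).toReal) ω)) :
    IsAInftyMeasure ν ∧
    (∀ j, IsAInftyMeasure (volume.withDensity (dualWeight ((Q j).toReal / s) (ω j)))) ∧
    (∀ (x : E n) (r : ℝ), 0 < r → ν (ball x r) ≠ 0) ∧
    ∃ C : ℝ≥0∞, C ≠ ∞ ∧ ∀ (x : E n) (r : ℝ), 0 < r →
      ∏ j, ((volume (ball x r))⁻¹ ^ (1 / s) *
        (volume.withDensity (dualWeight ((Q j).toReal / s) (ω j))) (ball x r) ^
          (1 / (s * ((Q j).toReal / s / ((Q j).toReal / s - 1))))) ≤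
      C * ν (ball x r) ^ (-(1 / q.toReal)) := by
  have hQ0 : ∀ j, 0 < (Q j).toReal := fun j => hs.trans (hsQ j)
  have hq0 : 0 < q.toReal := by
    have : 0 < 1 / q.toReal := by
      rw [hq]
      have : Nonempty (Fin m) := ⟨⟨0, hm⟩⟩
      exact Finset.sum_pos (fun j _ => one_div_pos.2 (hQ0 j)) Finset.univ_nonempty
    exact one_div_pos.1 this
  have hP : ∀ j, 1 < (Q j).toReal / s := fun j => (one_lt_div hs).2 (hsQ j)
  have hH := harmonicExponent_div (s := s) hq
  have hW : multiWeight (harmonicExponent fun j => (Q j).toReal / s) (fun j => (Q j).toReal / s) ω =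
      multiWeight q.toReal (fun j => (Q j).toReal) ω := by
    rw [hH]
    ext y
    refine Finset.prod_congr rfl fun j _ => ?_
    rw [div_div_div_cancel_right₀ hs.ne']
  obtain ⟨h1, h2, C, hC, h3⟩ := hω.exists_bound hm hP rfl
  rw [hW] at h1 h3
  rw [hH] at h3
  have hν0 : ∀ (x : E n) (r : ℝ), 0 < r → ν (ball x r) ≠ 0 := fun x r hr => by
    rw [hν]
    exact weightMeasure_ball_ne_zero (aemeasurable_multiWeight hω.1 _ _)
      (multiWeight_pos hω.1 _ _) x hr
  have hνA : IsAInftyMeasure ν := by rw [hν]; exact h1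
  refine ⟨hνA, h2, hν0, C ^ (1 / s), ENNReal.rpow_ne_top_of_nonneg (by positivity) hC,
    fun x r hr => ?_⟩
  have hs' : 0 ≤ 1 / s := by positivity
  set V := volume (ball x r)
  have hV0 : V ≠ 0 := volume_ball_pos' x hr
  have hVt : V ≠ ∞ := volume_ball_ne_top' x r
  set X : Fin m → ℝ≥0∞ := fun j =>
    (volume.withDensity (dualWeight ((Q j).toReal / s) (ω j))) (ball x r) ^
      (1 / (s * ((Q j).toReal / s / ((Q j).toReal / s - 1))))
  have h4 : ν (ball x r) ^ (1 / q.toReal) * ∏ j, X j ≤ C ^ (1 / s) * (V ^ (1 / s)) ^ m := by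
    have := ENNReal.rpow_le_rpow (h3 x r hr) hs'
    rw [ENNReal.mul_rpow_of_nonneg _ _ hs', ENNReal.mul_rpow_of_nonneg _ _ hs',
      ← ENNReal.prod_rpow_of_nonneg hs', ← ENNReal.rpow_mul,
      show (V ^ m) ^ (1 / s) = (V ^ (1 / s)) ^ m by
        rw [← ENNReal.rpow_natCast, ← ENNReal.rpow_natCast, ← ENNReal.rpow_mul,
          ← ENNReal.rpow_mul, mul_comm]] at this
    refine le_trans (le_of_eq ?_) this
    rw [hν, weightMeasure, withDensity_apply _ measurableSet_ball]
    congr 1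
    · congr 1
      field_simp
    · refine Finset.prod_congr rfl fun j _ => ?_
      rw [← ENNReal.rpow_mul, ← withDensity_apply _ measurableSet_ball]
      simp only [X]
      congr 1
      rw [← one_div_mul_one_div, mul_comm]
  rw [Finset.prod_mul_distrib, Finset.prod_const, Finset.card_univ, Fintype.card_fin]
  have hcancel : ν (ball x r) ^ (-(1 / q.toReal)) * ν (ball x r) ^ (1 / q.toReal) = 1 := by
    rw [← ENNReal.rpow_add _ _ (hν0 x r hr) (hνA.ball_ne_top x r), neg_add_cancel,
      ENNReal.rpow_zero]
  have hVcancel : (V⁻¹ ^ (1 / s)) ^ m * (V ^ (1 / s)) ^ m = 1 := by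
    rw [← mul_pow, ← ENNReal.mul_rpow_of_nonneg _ _ hs', ENNReal.inv_mul_cancel hV0 hVt,
      ENNReal.one_rpow, one_pow]
  calc (V⁻¹ ^ (1 / s)) ^ m * ∏ j, X j
      = (V⁻¹ ^ (1 / s)) ^ m * ν (ball x r) ^ (-(1 / q.toReal)) *
          (ν (ball x r) ^ (1 / q.toReal) * ∏ j, X j) := by
        rw [mul_assoc, ← mul_assoc (ν (ball x r) ^ (-(1 / q.toReal))), hcancel, one_mul]
    _ ≤ (V⁻¹ ^ (1 / s)) ^ m * ν (ball x r) ^ (-(1 / q.toReal)) *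
          (C ^ (1 / s) * (V ^ (1 / s)) ^ m) := by gcongr
    _ = ((V⁻¹ ^ (1 / s)) ^ m * (V ^ (1 / s)) ^ m) * (C ^ (1 / s) *
          ν (ball x r) ^ (-(1 / q.toReal))) := by ring
    _ = _ := by rw [hVcancel, one_mul]

/-- The series on the right-hand side of the local estimate. -/
def localSeries (Q : Fin m → ℝ≥0∞) (q : ℝ≥0∞) (ω : Fin m → E n → ℝ) (ν : Measure (E n))
    (f : Fin m → E n → 𝕜) (x : E n) (r : ℝ) : ℝ≥0∞ :=
  ∑' k : ℕ, ((k : ℝ≥0∞) + 1) ^ (m + 1) * (ν (ball x (2 ^ k * r)) ^ (-(1 / q.toReal)) *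
    ∏ j, eLpNorm (f j) (Q j) ((weightMeasure (ω j)).restrict (ball x (2 ^ k * r))))

variable (𝕜) in
-- John–Nirenberg contributes at most one factor $k+1$ per slot, and the size condition one more:
-- hence the power $m+1$ in `localSeries`.
lemma exists_size_le_localSeries (hn : 0 < n) (hm : 0 < m) (hs : 1 ≤ s) (hQt : ∀ j, Q j ≠ ∞)
    (hsQ : ∀ j, s < (Q j).toReal) (hq : 1 / q.toReal = ∑ j, 1 / (Q j).toReal)
    (hω : MemAVec (fun j => (Q j).toReal / s) ω)
    (hν : ν = weightMeasure (multiWeight q.toReal (fun j => (Q j).toReal) ω)) :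
    ∃ C : ℝ≥0∞, C ≠ ∞ ∧ ∀ b : Fin m → E n → 𝕜, (∀ j, MemBMO (b j)) → ∀ f : Fin m → E n → 𝕜,
      (∀ j, AEStronglyMeasurable (f j) volume) → ∀ (x : E n) (r : ℝ), 0 < r →
      ∀ τ : Finset (Fin m),
      ∑' k : ℕ, (k : ℝ≥0∞) * ∏ j, ballMean
        (fun z => ‖oscTuple b (fun j => ⨍ y in ball x r, b j y) f τ j z‖ₑ ^ s) x
          (2 ^ (k + 1) * r) ^ (1 / s) ≤
        C * (∏ j ∈ τᶜ, bmoNorm (b j)) * localSeries Q q ω ν f x r := by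
  have hs0 : 0 < s := by linarith
  obtain ⟨-, hdual, -, C, hC, hprod⟩ := hω.measure_bound hm hs0 hsQ hq hν
  choose c hc hmean using fun j =>
    exists_ballMean_oscTuple_le 𝕜 hn (hω.1 j) hs0 (hQt j) (hsQ j) (hdual j)
  refine ⟨(∏ j, c j) * C, ENNReal.mul_ne_top (ENNReal.prod_ne_top fun j _ => hc j) hC,
    fun b hb f hf x r hr τ => ?_⟩
  set F : ℕ → ℝ≥0∞ := fun k =>
    ∏ j, eLpNorm (f j) (Q j) ((weightMeasure (ω j)).restrict (ball x (2 ^ k * r)))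
  set G : ℕ → ℝ≥0∞ := fun k =>
    ((k : ℝ≥0∞) + 1) ^ (m + 1) * (ν (ball x (2 ^ k * r)) ^ (-(1 / q.toReal)) * F k)
  have hprodτ : ∏ j, (if j ∈ τ then 1 else bmoNorm (b j)) = ∏ j ∈ τᶜ, bmoNorm (b j) := by
    rw [← Fintype.prod_ite_mem τᶜ]
    refine Finset.prod_congr rfl fun j _ => ?_
    by_cases hj : j ∈ τ <;> simp [hj]
  have hterm : ∀ k : ℕ, (k : ℝ≥0∞) * ∏ j, ballMean
        (fun z => ‖oscTuple b (fun j => ⨍ y in ball x r, b j y) f τ j z‖ₑ ^ s) x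
          (2 ^ (k + 1) * r) ^ (1 / s) ≤
      ((∏ j, c j) * C) * (∏ j ∈ τᶜ, bmoNorm (b j)) * G (k + 1) := by
    intro k
    have hk : (0 : ℝ) < 2 ^ (k + 1) * r := by positivity
    have h1 : ∏ j, ballMean
        (fun z => ‖oscTuple b (fun j => ⨍ y in ball x r, b j y) f τ j z‖ₑ ^ s) x
          (2 ^ (k + 1) * r) ^ (1 / s) ≤
        ((∏ j, c j) * (((k + 1 : ℕ) : ℝ≥0∞) + 1) ^ m * ∏ j ∈ τᶜ, bmoNorm (b j)) * F (k + 1) *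
          (C * ν (ball x (2 ^ (k + 1) * r)) ^ (-(1 / q.toReal))) := by
      calc _ ≤ ∏ j, ((c j * (((k + 1 : ℕ) : ℝ≥0∞) + 1) * if j ∈ τ then 1 else bmoNorm (b j)) *
            eLpNorm (f j) (Q j) ((weightMeasure (ω j)).restrict (ball x (2 ^ (k + 1) * r))) *
            ((volume (ball x (2 ^ (k + 1) * r)))⁻¹ ^ (1 / s) *
              (volume.withDensity (dualWeight ((Q j).toReal / s) (ω j)))
                (ball x (2 ^ (k + 1) * r)) ^
                (1 / (s * ((Q j).toReal / s / ((Q j).toReal / s - 1)))))) := by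
            refine Finset.prod_le_prod' fun j _ => ?_
            simp_rw [enorm_oscTuple]
            exact hmean j (b j) (hb j) (f j) (hf j) x r hr (k + 1) (j ∈ τ)
        _ ≤ _ := by
            rw [Finset.prod_mul_distrib, Finset.prod_mul_distrib, Finset.prod_mul_distrib, hprodτ,
              Finset.prod_mul_distrib, Finset.prod_const, Finset.card_univ, Fintype.card_fin]
            gcongr
            exact hprod x _ hk
    calc _ ≤ (((k + 1 : ℕ) : ℝ≥0∞) + 1) * (((∏ j, c j) * (((k + 1 : ℕ) : ℝ≥0∞) + 1) ^ m *
            ∏ j ∈ τᶜ, bmoNorm (b j)) * F (k + 1) *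
            (C * ν (ball x (2 ^ (k + 1) * r)) ^ (-(1 / q.toReal)))) := by
          gcongr
          push_cast
          rw [add_assoc]
          exact le_self_add
      _ = _ := by simp only [G]; ring
  calc _ ≤ ∑' k : ℕ, ((∏ j, c j) * C) * (∏ j ∈ τᶜ, bmoNorm (b j)) * G (k + 1) :=
        ENNReal.tsum_le_tsum hterm
    _ = ((∏ j, c j) * C) * (∏ j ∈ τᶜ, bmoNorm (b j)) * ∑' k : ℕ, G (k + 1) :=
        ENNReal.tsum_mul_left
    _ ≤ _ := by
        gcongr
        -- The size condition begins at a larger ball, so its terms are those of the series shifted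
        -- by one.
        exact ENNReal.tsum_comp_le_tsum_of_injective (add_left_injective 1) G

variable (𝕜) in
/-- The `L^q(ν)` norm of products of oscillations. -/
lemma exists_lintegral_prod_oscillation_le (hn : 0 < n) (hm : 0 < m) (hν : IsAInftyMeasure ν)
    {t : ℝ} (ht : 0 < t) :
    ∃ C : ℝ≥0∞, C ≠ ∞ ∧ ∀ b : Fin m → E n → 𝕜, (∀ j, MemBMO (b j)) → ∀ (x : E n) (r : ℝ), 0 < r →
      ∫⁻ z in ball x r, (∏ j, (‖b j z - ⨍ y in ball x r, b j y‖ₑ + bmoNorm (b j))) ^ t ∂ν ≤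
        C * (∏ j, bmoNorm (b j)) ^ t * ν (ball x r) := by
  have hm' : (0 : ℝ) < m := by exact_mod_cast hm
  -- Hölder's inequality with $m$ equal exponents puts each factor into $L^{tm}$.
  set u := t * m
  have hu : 0 < u := by positivity
  obtain ⟨C, hC, hosc⟩ := hν.exists_oscillation_bound 𝕜 hn hu
  have h2u : (2 : ℝ≥0∞) ^ u ≠ ∞ := ENNReal.rpow_ne_top_of_nonneg hu.le (by simp)
  refine ⟨2 ^ u * (C + 1), by finiteness, fun b hb x r hr => ?_⟩
  set B := ball x r
  set A : ℝ≥0∞ := 2 ^ u * (C + 1)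
  set h : Fin m → E n → ℝ≥0∞ := fun j z => ‖b j z - ⨍ y in B, b j y‖ₑ + bmoNorm (b j)
  have hhm : ∀ j, AEMeasurable (h j) (ν.restrict B) := fun j =>
    (((((hb j).1.aestronglyMeasurable.aemeasurable.sub_const _).enorm).add_const _).mono_ac
      hν.ac).restrict
  have hsingle : ∀ j, ∫⁻ z in B, h j z ^ u ∂ν ≤ A * bmoNorm (b j) ^ u * ν B := by
    intro j
    have h1 := hosc (b j) (hb j) x r hr 0
    simp only [pow_zero, one_mul, Nat.cast_zero, zero_add] at h1
    calc _ ≤ ∫⁻ z in B, 2 ^ u * (‖b j z - ⨍ y in B, b j y‖ₑ ^ u + bmoNorm (b j) ^ u) ∂ν :=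
          lintegral_mono fun z => add_rpow_le _ _ hu
      _ = 2 ^ u * ((∫⁻ z in B, ‖b j z - ⨍ y in B, b j y‖ₑ ^ u ∂ν) + bmoNorm (b j) ^ u * ν B) := by
          rw [lintegral_const_mul' _ _ h2u, lintegral_add_right' _ aemeasurable_const,
            setLIntegral_const]
      _ ≤ 2 ^ u * (C * bmoNorm (b j) ^ u * ν B + bmoNorm (b j) ^ u * ν B) := by gcongr
      _ = _ := by simp only [A]; ring
  have hone : ∑ _j : Fin m, (1 / m : ℝ) = 1 := by simp [hm'.ne']
  calc ∫⁻ z in B, (∏ j, h j z) ^ t ∂ν = ∫⁻ z in B, ∏ j, (h j z ^ u) ^ (1 / m : ℝ) ∂ν := by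
        refine lintegral_congr fun z => ?_
        rw [← ENNReal.prod_rpow_of_nonneg ht.le]
        refine Finset.prod_congr rfl fun j _ => ?_
        rw [← ENNReal.rpow_mul]
        congr 1
        simp only [u]; field_simp
    _ ≤ ∏ j, (∫⁻ z in B, h j z ^ u ∂ν) ^ (1 / m : ℝ) :=
        ENNReal.lintegral_prod_norm_pow_le _ (fun j _ => (hhm j).pow_const _) hone
          fun _ _ => by positivity
    _ ≤ ∏ j, ((A * ν B) * bmoNorm (b j) ^ u) ^ (1 / m : ℝ) := by
        refine Finset.prod_le_prod' fun j _ => ENNReal.rpow_le_rpow ?_ (by positivity)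
        exact (hsingle j).trans (le_of_eq (by ring))
    _ = (A * ν B) * ∏ j, (bmoNorm (b j) ^ u) ^ (1 / m : ℝ) :=
        prod_rpow_mean (fun _ => by positivity) hone _ _
    _ = (A * ν B) * (∏ j, bmoNorm (b j)) ^ t := by
        rw [← ENNReal.prod_rpow_of_nonneg ht.le]
        congr 1
        refine Finset.prod_congr rfl fun j _ => ?_
        rw [← ENNReal.rpow_mul]
        congr 1
        simp only [u]; field_simp
    _ = _ := by ring

variable (𝕜) in
/-- The local estimate for the iterated commutator. -/
lemma exists_local_bound (hn : 0 < n) (hm : 0 < m) (hs : 1 ≤ s) (hQt : ∀ j, Q j ≠ ∞)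
    (hsQ : ∀ j, s < (Q j).toReal) (hqt : q ≠ ∞) (hq : 1 / q.toReal = ∑ j, 1 / (Q j).toReal)
    (hω : MemAVec (fun j => (Q j).toReal / s) ω)
    (hν : ν = weightMeasure (multiWeight q.toReal (fun j => (Q j).toReal) ω)) (C₁ : ℝ≥0) :
    ∃ C : ℝ≥0∞, C ≠ ∞ ∧ ∀ D : Fin m → Submodule 𝕜 (E n → 𝕜), IsOperatorDomain D →
      ∀ b : Fin m → E n → 𝕜, (∀ j, MemBMO (b j)) → ∀ K : ℝ≥0,
      ∀ S U : (Fin m → E n → 𝕜) → E n → ℝ≥0∞, SizeCondition D S s C₁ →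
      HasLocalExpansion D b S U →
      LebesgueBounded (commutatorDomain D b) U Q q ω
        (multiWeight q.toReal (fun j => (Q j).toReal) ω) K →
      ∀ f ∈ commutatorDomain D b, ∀ (x : E n) (r : ℝ), 0 < r →
      (∀ j, eLpNorm (f j) (Q j) ((weightMeasure (ω j)).restrict (ball x (2 * r))) ≠ ∞) →
      eLpNorm (U f) q (ν.restrict (ball x r)) ≤
        C * (K + ∏ j, bmoNorm (b j)) *
          (ν (ball x r) ^ (1 / q.toReal) * localSeries Q q ω ν f x r) := by
  have hs0 : 0 < s := by linarith
  have hQ0 : ∀ j, 0 < (Q j).toReal := fun j => hs0.trans (hsQ j)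
  have hq0 : 0 < q.toReal := by
    have : 0 < 1 / q.toReal := by
      rw [hq]
      have : Nonempty (Fin m) := ⟨⟨0, hm⟩⟩
      exact Finset.sum_pos (fun j _ => one_div_pos.2 (hQ0 j)) Finset.univ_nonempty
    exact one_div_pos.1 this
  have hqz : q ≠ 0 := by rintro rfl; simp at hq0
  obtain ⟨hνA, -, hν0, -⟩ := hω.measure_bound hm hs0 hsQ hq hν
  obtain ⟨Cs, hCs, hsize⟩ := exists_size_le_localSeries 𝕜 hn hm hs hQt hsQ hq hω hν
  set t := q.toReal with ht
  obtain ⟨Co, hCo, hosc⟩ := exists_lintegral_prod_oscillation_le 𝕜 hn hm hνA hq0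
  obtain ⟨Dd, hDd1, hDd⟩ := hνA.exists_doubling one_le_two
  obtain ⟨N, hN⟩ : ∃ N : ℝ≥0∞,
      N = (((Finset.univ : Finset (Finset (Fin m))).erase ∅).card : ℝ≥0∞) := ⟨_, rfl⟩
  have hNt : N ≠ ∞ := by rw [hN]; exact ENNReal.natCast_ne_top _
  have h1t : 0 ≤ 1 / t := by positivity
  -- the two constants
  set A₁ : ℝ≥0∞ := (2 * 2 ^ (1 / t)) * (Dd : ℝ≥0∞) ^ (1 / t) with hA₁
  set A₂ : ℝ≥0∞ := (2 * 2 ^ (1 / t)) * (N * (C₁ * Cs) * Co ^ (1 / t)) with hA₂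
  have h2t : (2 : ℝ≥0∞) ^ (1 / t) ≠ ∞ := ENNReal.rpow_ne_top_of_nonneg h1t (by simp)
  have hDt : (Dd : ℝ≥0∞) ^ (1 / t) ≠ ∞ := ENNReal.rpow_ne_top_of_nonneg h1t (by simp)
  have hCot : Co ^ (1 / t) ≠ ∞ := ENNReal.rpow_ne_top_of_nonneg h1t hCo
  refine ⟨A₁ + A₂, by finiteness, fun D hD b hb K S U hS hexp hbdd f hf x r hr hfin => ?_⟩
  set B := ball x r with hB
  set c : Fin m → 𝕜 := fun j => ⨍ y in B, b j y
  set Θ := localSeries Q q ω ν f x r with hΘ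
  have hfm : ∀ j, AEStronglyMeasurable (f j) volume := fun j =>
    hD.aestronglyMeasurable j _ (hf j).1
  set β := ∏ j, bmoNorm (b j)
  set Φ : E n → ℝ≥0∞ := fun z => ∏ j, (‖b j z - c j‖ₑ + bmoNorm (b j))
  set Z : E n → ℝ≥0∞ := fun z => N * (C₁ * Cs) * Θ * Φ z
  have hΦm : AEMeasurable Φ (ν.restrict B) := by
    refine Finset.aemeasurable_fun_prod _ fun j _ => ?_
    exact (((((hb j).1.aestronglyMeasurable.aemeasurable.sub_const _).enorm).add_const _).mono_ac
      hνA.ac).restrict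
  -- the nonlocal part
  have hpt : ∀ᵐ z ∂(ν.restrict B), U f z ≤ U (splitTuple f ∅ x r) z + Z z := by
    refine (hνA.ac.restrict B).ae_le ?_
    have hsz : ∀ᵐ z ∂(volume.restrict B), ∀ σ : Finset (Fin m), σ.Nonempty →
        ∀ τ : Finset (Fin m), S (splitTuple (oscTuple b c f τ) σ x r) z ≤
          (C₁ * Cs) * (∏ j ∈ τᶜ, bmoNorm (b j)) * Θ := by
      rw [ae_all_iff]
      intro σ
      by_cases hσ : σ.Nonempty
      · have : ∀ᵐ z ∂(volume.restrict B), ∀ τ : Finset (Fin m),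
            S (splitTuple (oscTuple b c f τ) σ x r) z ≤
              (C₁ * Cs) * (∏ j ∈ τᶜ, bmoNorm (b j)) * Θ := by
          rw [ae_all_iff]
          intro τ
          filter_upwards [hS _ (oscTuple_mem hf c τ) x r hr σ hσ] with z hz
          refine hz.trans ?_
          rw [mul_assoc]
          refine (mul_le_mul_right ((size_le_tsum_prod_ballMean
            (fun j z => ‖oscTuple b c f τ j z‖ₑ ^ s) x hr hs σ).trans
            (hsize b hb f hfm x r hr τ)) _).trans (le_of_eq ?_)
          ring
        filter_upwards [this] with z hz _ using hz
      · exact Filter.Eventually.of_forall fun z h => absurd h hσ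
    filter_upwards [hsz, ae_restrict_of_ae (hexp f hf x r c)] with z hz hz2
    simp only [enorm_eq_self] at hz2
    refine hz2.trans (add_le_add le_rfl ?_)
    calc _ ≤ ∑ σ ∈ (Finset.univ : Finset (Finset (Fin m))).erase ∅, (C₁ * Cs) * Θ * Φ z := by
          refine Finset.sum_le_sum fun σ hσ => ?_
          have hσ' : σ.Nonempty := Finset.nonempty_iff_ne_empty.2 (Finset.ne_of_mem_erase hσ)
          calc _ ≤ ∑ τ : Finset (Fin m), (∏ j ∈ τ, ‖b j z - c j‖ₑ) *
                ((C₁ * Cs) * (∏ j ∈ τᶜ, bmoNorm (b j)) * Θ) := by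
                gcongr with τ _
                exact hz σ hσ' τ
            _ = (C₁ * Cs) * Θ * ∑ τ : Finset (Fin m), (∏ j ∈ τ, ‖b j z - c j‖ₑ) *
                  ∏ j ∈ τᶜ, bmoNorm (b j) := by
                rw [Finset.mul_sum]
                exact Finset.sum_congr rfl fun τ _ => by ring
            -- Summed over $\tau$, the outer factors $|b_j-c_j|$ and the norms $\|b_j\|$ recombine
            -- into $\prod_j(|b_j-c_j|+\|b_j\|)$.
            _ = _ := by rw [← Fintype.prod_add]
      _ = Z z := by
          rw [Finset.sum_const, nsmul_eq_mul]
          simp only [Z, hN]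
          ring
  -- the local part
  have hloc : eLpNorm (U (splitTuple f ∅ x r)) q (ν.restrict B) ≤
      K * (ν (ball x (2 * r)) ^ (1 / t) * Θ) := by
    have hmem : ∀ j, MemLp (splitTuple f ∅ x r j) (Q j) (weightMeasure (ω j)) ∧
        eLpNorm (splitTuple f ∅ x r j) (Q j) (weightMeasure (ω j)) =
          eLpNorm (f j) (Q j) ((weightMeasure (ω j)).restrict (ball x (2 * r))) := by
      intro j
      have e : splitTuple f ∅ x r j = (ball x (2 * r)).indicator (f j) := by simp [splitTuple]
      have e2 : eLpNorm (splitTuple f ∅ x r j) (Q j) (weightMeasure (ω j)) =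
          eLpNorm (f j) (Q j) ((weightMeasure (ω j)).restrict (ball x (2 * r))) := by
        rw [e]; exact eLpNorm_indicator_eq_eLpNorm_restrict measurableSet_ball
      refine ⟨⟨?_, by rw [e2]; exact (hfin j).lt_top⟩, e2⟩
      rw [e]
      exact ((hfm j).indicator measurableSet_ball).mono_ac (withDensity_absolutelyContinuous _ _)
    have h1 := (hbdd _ (hD.splitTuple_mem_commutatorDomain hf ∅ x r) fun j => (hmem j).1).2
    rw [← hν] at h1
    refine (eLpNorm_mono_measure _ Measure.restrict_le_self).trans (h1.trans ?_)
    gcongr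
    have h2 : ν (ball x (2 * r)) ^ (1 / t) * ν (ball x (2 * r)) ^ (-(1 / t)) = 1 := by
      rw [← ENNReal.rpow_add _ _ (hν0 x _ (by positivity)) (hνA.ball_ne_top x _), add_neg_cancel,
        ENNReal.rpow_zero]
    calc ∏ j, eLpNorm (splitTuple f ∅ x r j) (Q j) (weightMeasure (ω j))
        = ν (ball x (2 * r)) ^ (1 / t) * (ν (ball x (2 * r)) ^ (-(1 / t)) *
          ∏ j, eLpNorm (f j) (Q j) ((weightMeasure (ω j)).restrict (ball x (2 * r)))) := by
          rw [← mul_assoc, h2, one_mul]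
          exact Finset.prod_congr rfl fun j _ => (hmem j).2
      _ ≤ _ := by
          gcongr
          -- The local contribution over $2B$ is dominated by the term $k=1$ of the series.
          refine le_trans ?_ (ENNReal.le_tsum 1)
          rw [pow_one]
          refine le_mul_of_one_le_left zero_le (one_le_pow₀ ?_)
          exact le_add_self
  have hνd : ν (ball x (2 * r)) ^ (1 / t) ≤ (Dd : ℝ≥0∞) ^ (1 / t) * ν B ^ (1 / t) := by
    rw [← ENNReal.mul_rpow_of_nonneg _ _ h1t]
    exact ENNReal.rpow_le_rpow (hDd x r hr) h1t
  have hZ : eLpNorm Z q (ν.restrict B) ≤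
      N * (C₁ * Cs) * Co ^ (1 / t) * β * (ν B ^ (1 / t) * Θ) := by
    rw [eLpNorm_eq_lintegral_rpow_enorm_toReal hqz hqt]
    simp only [enorm_eq_self, Z, ← ht]
    simp_rw [fun z => ENNReal.mul_rpow_of_nonneg (N * (C₁ * Cs) * Θ) (Φ z) hq0.le]
    rw [lintegral_const_mul'' _ (hΦm.pow_const _), ENNReal.mul_rpow_of_nonneg _ _ h1t, one_div,
      ENNReal.rpow_rpow_inv hq0.ne', ← one_div]
    calc _ ≤ N * (C₁ * Cs) * Θ * (Co * β ^ t * ν B) ^ (1 / t) := by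
          gcongr
          exact hosc b hb x r hr
      _ = _ := by
          rw [ENNReal.mul_rpow_of_nonneg _ _ h1t, ENNReal.mul_rpow_of_nonneg _ _ h1t, one_div,
            ENNReal.rpow_rpow_inv hq0.ne']
          ring
  have hsum : eLpNorm (U f) q (ν.restrict B) ≤ (2 * 2 ^ (1 / t)) *
      (eLpNorm (U (splitTuple f ∅ x r)) q (ν.restrict B) + eLpNorm Z q (ν.restrict B)) :=
    eLpNorm_le_of_ae_le_add hqz hqt hpt (hΦm.const_mul _)
  refine hsum.trans ?_
  calc _ ≤ (2 * 2 ^ (1 / t)) * (K * (((Dd : ℝ≥0∞) ^ (1 / t) * ν B ^ (1 / t)) * Θ) +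
        N * (C₁ * Cs) * Co ^ (1 / t) * β * (ν B ^ (1 / t) * Θ)) := by
        gcongr
        exact hloc.trans (by gcongr)
    _ = (A₁ * K + A₂ * β) * (ν B ^ (1 / t) * Θ) := by rw [hA₁, hA₂]; ring
    _ ≤ _ := by
        gcongr
        rw [add_mul, mul_add, mul_add]
        exact add_le_add le_self_add le_add_self

end Local

/-! ### Series and products in $L^p$ for all $0<p\le\infty$ -/

section Norms

variable {X : Type*} [MeasurableSpace X] {μ : Measure X}

lemma ae_le_of_eLpNorm_top_le {g : X → ℝ≥0∞} {M : ℝ≥0∞} (h : eLpNorm g ∞ μ ≤ M) :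
    ∀ᵐ y ∂μ, g y ≤ M := by
  rw [eLpNorm_exponent_top] at h
  filter_upwards [ae_le_eLpNormEssSup (f := g) (μ := μ)] with y hy
  exact (by simpa using hy : g y ≤ eLpNormEssSup g μ).trans h

lemma eLpNorm_top_le_of_ae_le {g : X → ℝ≥0∞} {M : ℝ≥0∞} (h : ∀ᵐ y ∂μ, g y ≤ M) :
    eLpNorm g ∞ μ ≤ M := by
  rw [eLpNorm_exponent_top]
  exact eLpNormEssSup_le_of_ae_enorm_bound (by simpa using h)

lemma ae_ne_top_of_eLpNorm_ne_top {g : X → ℝ≥0∞} {p : ℝ≥0∞} (hp : p ≠ 0) (hg : AEMeasurable g μ)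
    (h : eLpNorm g p μ ≠ ∞) : ∀ᵐ y ∂μ, g y ≠ ∞ := by
  rcases eq_or_ne p ∞ with rfl | hpt
  · filter_upwards [ae_le_of_eLpNorm_top_le le_rfl] with y hy
    exact (hy.trans_lt h.lt_top).ne
  · have hp0 := ENNReal.toReal_pos hp hpt
    have h1 := lintegral_rpow_enorm_lt_top_of_eLpNorm_lt_top hp hpt h.lt_top
    simp only [enorm_eq_self] at h1
    filter_upwards [ae_lt_top' (hg.pow_const _) h1.ne] with y hy hyt
    simp [hyt, ENNReal.top_rpow_of_pos hp0] at hy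

/-- A quasi-norm substitute for the countable triangle inequality. -/
lemma exists_eLpNorm_tsum_le {p : ℝ≥0∞} (hp : p ≠ 0) {a : ℕ → ℝ≥0∞}
    (ha : ∀ u : ℝ, 0 < u → ∑' k, a k ^ u ≠ ∞) :
    ∃ C : ℝ≥0∞, C ≠ ∞ ∧ ∀ g : ℕ → X → ℝ≥0∞, (∀ k, AEMeasurable (g k) μ) → ∀ M : ℝ≥0∞,
      (∀ k, eLpNorm (g k) p μ ≤ M) → eLpNorm (fun y => ∑' k, a k * g k y) p μ ≤ C * M := by
  rcases eq_or_ne p ∞ with rfl | hpt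
  · refine ⟨∑' k, a k, by simpa using ha 1 one_pos, fun g _ M hM => ?_⟩
    refine eLpNorm_top_le_of_ae_le ?_
    filter_upwards [ae_all_iff.2 fun k => ae_le_of_eLpNorm_top_le (hM k)] with y hy
    rw [← ENNReal.tsum_mul_right]
    exact ENNReal.tsum_le_tsum fun k => by gcongr; exact hy k
  have ht := ENNReal.toReal_pos hp hpt
  set t := p.toReal
  -- The coefficients are split as $a_k=e_k\cdot e_k$: one half is summed outright, the other stays
  -- with $g_k$ and makes the $\ell^t$ norm summable. This covers $t<1$, where the triangle
  -- inequality fails.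
  set e : ℕ → ℝ≥0∞ := fun k => a k ^ (1 / 2 : ℝ)
  have hea : ∀ k, a k = e k * e k := fun k => by
    rw [← ENNReal.rpow_add_of_nonneg _ _ (by norm_num) (by norm_num)]; norm_num
  have he1 : ∑' k, e k ≠ ∞ := ha _ (by norm_num)
  have het : ∑' k, e k ^ t ≠ ∞ := by
    simpa only [e, ← ENNReal.rpow_mul] using ha (1 / 2 * t) (by positivity)
  refine ⟨(∑' k, e k) * (∑' k, e k ^ t) ^ (1 / t), ENNReal.mul_ne_top he1
    (ENNReal.rpow_ne_top_of_nonneg (by positivity) het), fun g hg M hM => ?_⟩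
  have hpt' : ∀ y, ∑' k, a k * g k y ≤ (∑' k, e k) * (∑' k, (e k * g k y) ^ t) ^ (1 / t) := by
    intro y
    rw [← ENNReal.tsum_mul_right]
    refine ENNReal.tsum_le_tsum fun k => ?_
    rw [hea, mul_assoc]
    gcongr
    rw [one_div, ENNReal.le_rpow_inv_iff ht]
    exact ENNReal.le_tsum (f := fun k => (e k * g k y) ^ t) k
  have hint : ∀ k, ∫⁻ y, g k y ^ t ∂μ ≤ M ^ t := by
    intro k
    have := hM k
    rw [eLpNorm_eq_lintegral_rpow_enorm_toReal hp hpt, one_div, ENNReal.rpow_inv_le_iff ht] at this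
    simpa using this
  rw [eLpNorm_eq_lintegral_rpow_enorm_toReal hp hpt, one_div, ENNReal.rpow_inv_le_iff ht]
  simp only [enorm_eq_self]
  calc ∫⁻ y, (∑' k, a k * g k y) ^ t ∂μ
      ≤ ∫⁻ y, (∑' k, e k) ^ t * ∑' k, e k ^ t * g k y ^ t ∂μ := by
        refine lintegral_mono fun y => ?_
        refine (ENNReal.rpow_le_rpow (hpt' y) ht.le).trans (le_of_eq ?_)
        rw [ENNReal.mul_rpow_of_nonneg _ _ ht.le, one_div, ENNReal.rpow_inv_rpow ht.ne']
        simp_rw [ENNReal.mul_rpow_of_nonneg _ _ ht.le]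
    _ = (∑' k, e k) ^ t * ∑' k, e k ^ t * ∫⁻ y, g k y ^ t ∂μ := by
        rw [lintegral_const_mul' _ _ (ENNReal.rpow_ne_top_of_nonneg ht.le he1),
          lintegral_tsum fun k => ((hg k).pow_const _).const_mul _]
        congr 2 with k
        exact lintegral_const_mul'' _ ((hg k).pow_const _)
    _ ≤ (∑' k, e k) ^ t * ∑' k, e k ^ t * M ^ t := by
        gcongr with k
        exact hint k
    _ = _ := by
        rw [ENNReal.tsum_mul_right, ENNReal.mul_rpow_of_nonneg _ _ ht.le,
          ENNReal.mul_rpow_of_nonneg _ _ ht.le, mul_assoc]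
        simp only [show p.toReal = t from rfl, ENNReal.rpow_inv_rpow ht.ne']

lemma eLpNorm_prod_le {ι : Type*} [Fintype ι] {p : ℝ≥0∞} {P : ι → ℝ≥0∞} (hp : p ≠ 0)
    (hP : ∀ j, P j ≠ 0) (hpP : 1 / p.toReal = ∑ j, 1 / (P j).toReal) (htop : ∀ j, p = ∞ ↔ P j = ∞)
    {G : ι → X → ℝ≥0∞} (hG : ∀ j, AEMeasurable (G j) μ) :
    eLpNorm (fun y => ∏ j, G j y) p μ ≤ ∏ j, eLpNorm (G j) (P j) μ := by
  rcases eq_or_ne p ∞ with rfl | hpt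
  · refine eLpNorm_top_le_of_ae_le ?_
    have : ∀ j, ∀ᵐ y ∂μ, G j y ≤ eLpNorm (G j) (P j) μ := fun j => by
      rw [(htop j).1 rfl]; exact ae_le_of_eLpNorm_top_le le_rfl
    filter_upwards [ae_all_iff.2 this] with y hy
    exact Finset.prod_le_prod' fun j _ => hy j
  have hPt : ∀ j, P j ≠ ∞ := fun j h => hpt ((htop j).2 h)
  have ht := ENNReal.toReal_pos hp hpt
  have hTp : ∀ j, 0 < (P j).toReal := fun j => ENNReal.toReal_pos (hP j) (hPt j)
  rw [eLpNorm_eq_lintegral_rpow_enorm_toReal hp hpt, one_div, ENNReal.rpow_inv_le_iff ht]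
  simp only [enorm_eq_self]
  set t := p.toReal
  calc ∫⁻ y, (∏ j, G j y) ^ t ∂μ
      = ∫⁻ y, ∏ j, (G j y ^ (P j).toReal) ^ (t / (P j).toReal) ∂μ := by
        refine lintegral_congr fun y => ?_
        rw [← ENNReal.prod_rpow_of_nonneg ht.le]
        refine Finset.prod_congr rfl fun j _ => ?_
        rw [← ENNReal.rpow_mul, mul_div_cancel₀ _ (hTp j).ne']
    _ ≤ ∏ j, (∫⁻ y, G j y ^ (P j).toReal ∂μ) ^ (t / (P j).toReal) := by
        refine ENNReal.lintegral_prod_norm_pow_le _ (fun j _ => (hG j).pow_const _) ?_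
          fun j _ => (div_pos ht (hTp j)).le
        calc ∑ j, t / (P j).toReal = t * ∑ j, 1 / (P j).toReal := by
              rw [Finset.mul_sum]; exact Finset.sum_congr rfl fun j _ => by ring
          _ = 1 := by rw [← hpP]; field_simp
    _ = _ := by
        rw [← ENNReal.prod_rpow_of_nonneg ht.le]
        refine Finset.prod_congr rfl fun j _ => ?_
        rw [eLpNorm_eq_lintegral_rpow_enorm_toReal (hP j) (hPt j), ← ENNReal.rpow_mul]
        simp only [enorm_eq_self]
        congr 1
        ring

end Norms

/-! ### Measurability in the centre of the ball -/

/-- The set of pairs at distance less than $r$ is open, so Tonelli's theorem applies. Replacing `v`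
by a measurable version changes no integral, for any centre. -/
lemma measurable_lintegral_ball {n : ℕ} {v : E n → ℝ≥0∞} (hv : AEMeasurable v volume) (r : ℝ) :
    Measurable fun y => ∫⁻ z in ball y r, v z := by
  have e : (fun y => ∫⁻ z in ball y r, v z) =
      fun y => ∫⁻ z,
        {w : E n × E n | dist w.2 w.1 < r}.indicator (fun w => hv.mk v w.2) (y, z) := by
    funext y
    rw [← lintegral_indicator measurableSet_ball]
    refine lintegral_congr_ae ?_
    filter_upwards [hv.ae_eq_mk] with z hz
    simp [Set.indicator, mem_ball, hz]
  rw [e]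
  refine Measurable.lintegral_prod_right' (Measurable.indicator ?_ ?_)
  · exact hv.measurable_mk.comp measurable_snd
  · exact (isOpen_lt (by fun_prop) continuous_const).measurableSet

lemma IsWeight.measurable_weightMeasure_ball {n : ℕ} {ω : E n → ℝ} (hω : IsWeight ω) (r : ℝ) :
    Measurable fun y => weightMeasure ω (ball y r) := by
  simp only [weightMeasure, withDensity_apply _ measurableSet_ball]
  exact measurable_lintegral_ball hω.aemeasurable r

lemma IsWeight.measurable_eLpNorm_ball {n : ℕ} {ω : E n → ℝ} (hω : IsWeight ω) {ε : Type*}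
    [TopologicalSpace ε] [ContinuousENorm ε] {f : E n → ε} (hf : AEStronglyMeasurable f volume)
    {q : ℝ≥0∞} (hq : q ≠ 0) (hqt : q ≠ ∞) (r : ℝ) :
    Measurable fun y => eLpNorm f q ((weightMeasure ω).restrict (ball y r)) := by
  simp only [eLpNorm_eq_lintegral_rpow_enorm_toReal hq hqt]
  refine Measurable.pow_const ?_ _
  have e : ∀ y, ∫⁻ z in ball y r, ‖f z‖ₑ ^ q.toReal ∂(weightMeasure ω) =
      ∫⁻ z in ball y r, ENNReal.ofReal (ω z) * ‖f z‖ₑ ^ q.toReal := by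
    intro y
    rw [weightMeasure, restrict_withDensity measurableSet_ball,
      lintegral_withDensity_eq_lintegral_mul₀ hω.aemeasurable.restrict
        (hf.enorm.pow_const _).restrict]
    rfl
  simp only [e]
  exact measurable_lintegral_ball (hω.aemeasurable.mul (hf.enorm.pow_const _)) r

/-! ### Exponents -/

section Exponents

variable {m : ℕ} {q : ℝ≥0∞} {Q : Fin m → ℝ≥0∞}

lemma one_div_toReal_eq_sum (hQ : ∀ j, Q j ≠ 0) (hq : 1 / q = ∑ j, 1 / Q j) :
    1 / q.toReal = ∑ j, 1 / (Q j).toReal := by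
  have h := congrArg ENNReal.toReal hq
  rw [ENNReal.toReal_sum fun j _ => by simp [hQ j]] at h
  simpa using h

lemma ne_zero_of_one_div_eq_sum (hQ : ∀ j, Q j ≠ 0) (hq : 1 / q = ∑ j, 1 / Q j) : q ≠ 0 := by
  rintro rfl
  have h : ∑ j, 1 / Q j ≠ ∞ := ENNReal.sum_ne_top.2 fun j _ => by simp [hQ j]
  rw [← hq] at h
  simp at h

lemma eq_top_iff_of_one_div_eq_sum (hq : 1 / q = ∑ j, 1 / Q j) : q = ∞ ↔ ∀ j, Q j = ∞ := by
  have : q = ∞ ↔ 1 / q = 0 := by simp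
  rw [this, hq, Finset.sum_eq_zero_iff]
  simp

end Exponents

/-! ### The estimate in amalgam spaces -/

section Main

variable {n m : ℕ} {ω : Fin m → E n → ℝ}

/-- A reverse Hölder inequality with a nonpositive exponent. -/
lemma exists_weightMeasure_rpow_le (hω : ∀ j, IsWeight (ω j)) (hωi : ∀ j, MemAInfty (ω j))
    {q : ℝ} {Q : Fin m → ℝ} (hq : 0 < q) (hQ : ∀ j, 0 < Q j) (hqQ : 1 / q = ∑ j, 1 / Q j)
    (hνt : ∀ x r, weightMeasure (multiWeight q Q ω) (ball x r) ≠ ∞) {β : ℝ} (hβ : β ≤ 0) :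
    ∃ C : ℝ≥0∞, C ≠ ∞ ∧ ∀ (x : E n) (r : ℝ), 0 < r →
      weightMeasure (multiWeight q Q ω) (ball x r) ^ β ≤
        C * ∏ j, weightMeasure (ω j) (ball x r) ^ (q / Q j * β) := by
  have hθ1 : ∑ j, q / Q j = 1 := by
    calc ∑ j, q / Q j = q * ∑ j, 1 / Q j := by
          rw [Finset.mul_sum]; exact Finset.sum_congr rfl fun j _ => by ring
      _ = 1 := by rw [← hqQ]; field_simp
  obtain ⟨C, hC, h⟩ := exists_prod_rpow_le hω hωi (aemeasurable_multiWeight hω q Q)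
    (fun j => div_pos hq (hQ j)) hθ1 (multiWeight_ae_eq hω q Q)
  have hCt : C ^ (-β) ≠ ∞ := ENNReal.rpow_ne_top_of_nonneg (by linarith) hC
  refine ⟨C ^ (-β), hCt, fun x r hr => ?_⟩
  have hβ' := neg_nonneg.2 hβ
  have h1 := ENNReal.rpow_le_rpow (h x r hr) hβ'
  have hω0 := fun j => weightMeasure_ball_ne_zero (hω j).aemeasurable (hω j).pos x hr
  have hωt := fun j => (hω j).weightMeasure_ball_ne_top x r
  simp only [weightMeasure, withDensity_apply _ measurableSet_ball] at hω0 hωt hνt ⊢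
  set V := ∫⁻ y in ball x r, ENNReal.ofReal (multiWeight q Q ω y)
  set w : Fin m → ℝ≥0∞ := fun j => ∫⁻ y in ball x r, ENNReal.ofReal (ω j y)
  have hwθ : ∀ j, w j ^ (q / Q j) ≠ ∞ := fun j =>
    ENNReal.rpow_ne_top_of_nonneg (div_pos hq (hQ j)).le (hωt j)
  have hW0 : ∏ j, w j ^ (q / Q j) ≠ 0 := Finset.prod_ne_zero_iff.2 fun j _ =>
    (ENNReal.rpow_pos (pos_iff_ne_zero.2 (hω0 j)) (hωt j)).ne'
  have hWt : ∏ j, w j ^ (q / Q j) ≠ ∞ := ENNReal.prod_ne_top fun j _ => hwθ j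
  have hV0 : V ≠ 0 := by
    intro hV
    have := h x r hr
    rw [show ∫⁻ y in ball x r, ENNReal.ofReal (multiWeight q Q ω y) = 0 from hV, mul_zero] at this
    exact hW0 (le_zero_iff.1 this)
  have hVt : V ≠ ∞ := hνt x r
  rw [ENNReal.mul_rpow_of_nonneg _ _ hβ'] at h1
  -- The reverse Hölder inequality, raised to the power $-\beta\ge0$, is inverted; this is where the
  -- sign of $\beta$ matters.
  have h2 := ENNReal.inv_le_mul_inv_of_le (ENNReal.rpow_pos (pos_iff_ne_zero.2 hV0) hVt).ne'
    (ENNReal.rpow_ne_top_of_nonneg hβ' hVt) (ENNReal.rpow_pos (pos_iff_ne_zero.2 hW0) hWt).ne'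
    (ENNReal.rpow_ne_top_of_nonneg hβ' hWt) h1
  rw [← ENNReal.rpow_neg, ← ENNReal.rpow_neg, neg_neg] at h2
  refine h2.trans (le_of_eq ?_)
  rw [← ENNReal.prod_rpow_of_ne_top fun j _ => hwθ j]
  simp_rw [ENNReal.rpow_mul, w]

lemma tsum_pow_mul_pow_rpow_ne_top (d : ℕ) {κ : ℝ≥0} (hκ : κ < 1) {u : ℝ} (hu : 0 < u) :
    ∑' k : ℕ, (((k : ℝ≥0∞) + 1) ^ d * (κ : ℝ≥0∞) ^ k) ^ u ≠ ∞ := by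
  have h := tsum_succ_rpow_mul_pow_ne_top (d * u) (κ := κ ^ u) (NNReal.rpow_lt_one hκ hu)
  convert h using 3 with k
  rw [ENNReal.mul_rpow_of_nonneg _ _ hu.le, ENNReal.coe_rpow_of_nonneg _ hu.le]
  simp only [← ENNReal.rpow_natCast, ← ENNReal.rpow_mul, mul_comm u]

variable (𝕜) in
/-- The estimate in the amalgam spaces, for an operator given by its absolute value. -/
lemma exists_amalgamNorm_le (hn : 0 < n) (hm : 0 < m)
    (s : ℝ) (Q A P : Fin m → ℝ≥0∞) (q α p : ℝ≥0∞)
    (hs : 1 ≤ s) (hsQ : ∀ j, ENNReal.ofReal s < Q j) (hQA : ∀ j, Q j ≤ A j)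
    (hAP : ∀ j, A j < P j)
    (hq : 1 / q = ∑ j, 1 / Q j) (hα : 1 / α = ∑ j, 1 / A j) (hp : 1 / p = ∑ j, 1 / P j)
    (hαq : ∀ j, α / A j = q / Q j) (hpq : p ≠ ∞ → ∀ j, p / P j = q / Q j)
    (hω : MemAVec (fun j => (Q j).toReal / s) ω) (hωi : ∀ j, MemAInfty (ω j)) (C₁ : ℝ≥0) :
    ∃ C : ℝ≥0, ∀ D : Fin m → Submodule 𝕜 (E n → 𝕜), IsOperatorDomain D →
      ∀ b : Fin m → E n → 𝕜, (∀ j, MemBMO (b j)) → ∀ K : ℝ≥0,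
      ∀ S U : (Fin m → E n → 𝕜) → E n → ℝ≥0∞, SizeCondition D S s C₁ →
      HasLocalExpansion D b S U →
      LebesgueBounded (commutatorDomain D b) U Q q ω
        (multiWeight q.toReal (fun j => (Q j).toReal) ω) K →
      ∀ f ∈ commutatorDomain D b, (∀ j, MemAmalgam (Q j) (P j) (A j) (ω j) (f j)) →
      amalgamNorm q p α (multiWeight q.toReal (fun j => (Q j).toReal) ω)
          (multiWeight q.toReal (fun j => (Q j).toReal) ω) (U f) ≤
        C * (K + ∏ j, bmoNorm (b j)) *
          ∏ j, amalgamNorm (Q j) (P j) (A j) (ω j) (ω j) (f j) := by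
  -- exponents
  have hs0 : 0 < s := by linarith
  have hAt : ∀ j, A j ≠ ∞ := fun j => (hAP j).ne_top
  have hQt : ∀ j, Q j ≠ ∞ := fun j => ne_top_of_le_ne_top (hAt j) (hQA j)
  have hQz : ∀ j, Q j ≠ 0 := fun j => (hsQ j).ne_bot
  have hAz : ∀ j, A j ≠ 0 := fun j => ((hsQ j).trans_le (hQA j)).ne_bot
  have hPz : ∀ j, P j ≠ 0 := fun j => (hAP j).ne_bot
  have hsQ' : ∀ j, s < (Q j).toReal := fun j =>
    (ENNReal.ofReal_lt_iff_lt_toReal hs0.le (hQt j)).1 (hsQ j)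
  have hQ0 : ∀ j, 0 < (Q j).toReal := fun j => hs0.trans (hsQ' j)
  have hA0 : ∀ j, 0 < (A j).toReal := fun j => ENNReal.toReal_pos (hAz j) (hAt j)
  have hqz := ne_zero_of_one_div_eq_sum hQz hq
  have hαz := ne_zero_of_one_div_eq_sum hAz hα
  have hpz := ne_zero_of_one_div_eq_sum hPz hp
  have hqt : q ≠ ∞ := fun h => hQt ⟨0, hm⟩ ((eq_top_iff_of_one_div_eq_sum hq).1 h _)
  have hαt : α ≠ ∞ := fun h => hAt ⟨0, hm⟩ ((eq_top_iff_of_one_div_eq_sum hα).1 h _)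
  have hq0 := ENNReal.toReal_pos hqz hqt
  have hα0 := ENNReal.toReal_pos hαz hαt
  have hqs := one_div_toReal_eq_sum hQz hq
  have hαs := one_div_toReal_eq_sum hAz hα
  have hps := one_div_toReal_eq_sum hPz hp
  -- An infinite $P_j$ with $p$ finite would make $p/P_j$ zero, whereas $q/Q_j$ is positive.
  have htop : ∀ j, p = ∞ ↔ P j = ∞ := by
    refine fun j => ⟨fun h => (eq_top_iff_of_one_div_eq_sum hp).1 h j, fun h => ?_⟩
    by_contra hpt
    have := hpq hpt j
    rw [h, ENNReal.div_top] at this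
    exact (ENNReal.div_pos hqz (hQt j)).ne this
  set β : ℝ := 1 / α.toReal - 1 / q.toReal - 1 / p.toReal with hβ
  -- Positive because every $\alpha_j<p_j$ strictly; this is the source of the geometric decay.
  set δ : ℝ := 1 / α.toReal - 1 / p.toReal with hδ
  have hβδ : β + 1 / q.toReal = δ := by rw [hβ, hδ]; ring
  have hne : (Finset.univ : Finset (Fin m)).Nonempty := ⟨⟨0, hm⟩, Finset.mem_univ _⟩
  have hβ0 : β ≤ 0 := by
    have h1 : 1 / α.toReal ≤ 1 / q.toReal := by
      rw [hαs, hqs]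
      refine Finset.sum_le_sum fun j _ => one_div_le_one_div_of_le (hQ0 j) ?_
      exact ENNReal.toReal_mono (hAt j) (hQA j)
    have h2 : 0 ≤ 1 / p.toReal := by positivity
    rw [hβ]; linarith
  have hδ0 : 0 < δ := by
    rw [hδ, sub_pos, hαs, hps]
    refine Finset.sum_lt_sum_of_nonempty hne fun j _ => ?_
    rcases eq_or_ne (P j) ∞ with h | h
    · simpa [h] using hA0 j
    · exact one_div_lt_one_div_of_lt (hA0 j) (ENNReal.toReal_strict_mono h (hAP j))
  have hθ : ∀ j, q.toReal / (Q j).toReal * β =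
      1 / (A j).toReal - 1 / (Q j).toReal - 1 / (P j).toReal := by
    intro j
    have h1 : α.toReal / (A j).toReal = q.toReal / (Q j).toReal := by
      simpa using congrArg ENNReal.toReal (hαq j)
    have hA1 : q.toReal / (Q j).toReal * (1 / α.toReal) = 1 / (A j).toReal := by
      rw [← h1]; field_simp
    have hQ1 : q.toReal / (Q j).toReal * (1 / q.toReal) = 1 / (Q j).toReal := by field_simp
    have hP1 : q.toReal / (Q j).toReal * (1 / p.toReal) = 1 / (P j).toReal := by
      rcases eq_or_ne p ∞ with h | h
      · simp [h, (htop j).1 h]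
      · have h2 : p.toReal / (P j).toReal = q.toReal / (Q j).toReal := by
          simpa using congrArg ENNReal.toReal (hpq h j)
        have := ENNReal.toReal_pos hpz h
        rw [← h2]; field_simp
    rw [hβ, mul_sub, mul_sub, hA1, hQ1, hP1]
  -- constants
  set ν := weightMeasure (multiWeight q.toReal (fun j => (Q j).toReal) ω) with hν
  obtain ⟨hνA, -, hν0, -⟩ := hω.measure_bound hm hs0 hsQ' hqs hν
  obtain ⟨Cl, hCl, hloc⟩ := exists_local_bound 𝕜 hn hm hs hQt hsQ' hqt hqs hω hν C₁
  obtain ⟨Cr, hCr, hrh⟩ := exists_weightMeasure_rpow_le hω.1 hωi hq0 hQ0 hqs hνA.ball_ne_top hβ0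
  obtain ⟨κ, hκ, hrd⟩ := hνA.exists_reverse_doubling hn
  -- The polynomial factor of the local series times the decay $\kappa^{\delta k}$ of reverse
  -- doubling.
  set a : ℕ → ℝ≥0∞ := fun k => ((k : ℝ≥0∞) + 1) ^ (m + 1) * ((κ ^ δ : ℝ≥0) : ℝ≥0∞) ^ k
  obtain ⟨Ct, hCt, hts⟩ := exists_eLpNorm_tsum_le (μ := (volume : Measure (E n))) hpz (a := a)
    fun u hu => tsum_pow_mul_pow_rpow_ne_top (m + 1) (NNReal.rpow_lt_one hκ hδ0) hu
  refine ⟨(Cl * Cr * Ct).toNNReal, fun D hD b hb K S U hS hexp hbdd f hf hfa => ?_⟩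
  rw [ENNReal.coe_toNNReal (by finiteness)]
  set M := ∏ j, amalgamNorm (Q j) (P j) (A j) (ω j) (ω j) (f j)
  set G : Fin m → ℝ → E n → ℝ≥0∞ := fun j r y =>
    weightMeasure (ω j) (ball y r) ^ (q.toReal / (Q j).toReal * β) *
      eLpNorm (f j) (Q j) ((weightMeasure (ω j)).restrict (ball y r)) with hG
  have hGm : ∀ j r, Measurable (G j r) := fun j r =>
    (((hω.1 j).measurable_weightMeasure_ball r).pow_const _).mul
      ((hω.1 j).measurable_eLpNorm_ball (hfa j).1 (hQz j) (hQt j) r)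
  have hGn : ∀ j r, 0 < r → eLpNorm (G j r) (P j) volume ≤
      amalgamNorm (Q j) (P j) (A j) (ω j) (ω j) (f j) := by
    intro j r hr
    simp only [hG, hθ]
    exact le_iSup₂ (f := fun (r : ℝ) (_ : 0 < r) => eLpNorm (fun y : E n =>
      (weightMeasure (ω j) (ball y r)) ^
        (1 / (A j).toReal - 1 / (Q j).toReal - 1 / (P j).toReal) *
        eLpNorm (f j) (Q j) ((weightMeasure (ω j)).restrict (ball y r))) (P j) volume) r hr
  have hω0 : ∀ j (y : E n) r, 0 < r → weightMeasure (ω j) (ball y r) ≠ 0 := fun j y r hr =>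
    weightMeasure_ball_ne_zero (hω.1 j).aemeasurable (hω.1 j).pos y hr
  refine iSup₂_le fun r hr => ?_
  -- The Lebesgue bound needs $f_j\chi_{2B}$ in $L^{q_j}(\omega_j)$. Finite amalgam norms ensure it
  -- for almost every centre, which suffices inside the $L^p(dy)$ norm.
  have hfin : ∀ᵐ y, ∀ j,
      eLpNorm (f j) (Q j) ((weightMeasure (ω j)).restrict (ball y (2 * r))) ≠ ∞ := by
    refine ae_all_iff.2 fun j => ?_
    filter_upwards [ae_ne_top_of_eLpNorm_ne_top (hPz j) (hGm j (2 * r)).aemeasurable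
      ((hGn j _ (by positivity)).trans_lt (hfa j).2).ne] with y hy h
    refine hy ?_
    simp only [hG, h]
    refine ENNReal.mul_top fun h0 => ?_
    rcases ENNReal.rpow_eq_zero_iff.1 h0 with h | h
    · exact hω0 j y _ (by positivity) h.1
    · exact (hω.1 j).weightMeasure_ball_ne_top y _ h.1
  have hpt : ∀ᵐ y, ν (ball y r) ^ β * eLpNorm (U f) q (ν.restrict (ball y r)) ≤
      (Cl * (K + ∏ j, bmoNorm (b j)) * Cr) * ∑' k, a k * ∏ j, G j (2 ^ k * r) y := by
    filter_upwards [hfin] with y hy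
    have hB0 := hν0 y r hr
    have hBt := hνA.ball_ne_top y r
    calc _ ≤ ν (ball y r) ^ β * (Cl * (K + ∏ j, bmoNorm (b j)) *
          (ν (ball y r) ^ (1 / q.toReal) * localSeries Q q ω ν f y r)) := by
          gcongr
          exact hloc D hD b hb K S U hS hexp hbdd f hf y r hr hy
      _ = (Cl * (K + ∏ j, bmoNorm (b j))) * (ν (ball y r) ^ δ * localSeries Q q ω ν f y r) := by
          rw [← hβδ, ENNReal.rpow_add _ _ hB0 hBt]; ring
      _ ≤ (Cl * (K + ∏ j, bmoNorm (b j))) * (Cr * ∑' k, a k * ∏ j, G j (2 ^ k * r) y) := by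
          refine mul_le_mul_right ?_ _
          unfold localSeries
          rw [← ENNReal.tsum_mul_left, ← ENNReal.tsum_mul_left]
          refine ENNReal.tsum_le_tsum fun k => ?_
          have hk : 0 < 2 ^ k * r := by positivity
          have h1 : ν (ball y r) ^ δ ≤
              ((κ ^ δ : ℝ≥0) : ℝ≥0∞) ^ k * ν (ball y (2 ^ k * r)) ^ δ := by
            refine (ENNReal.rpow_le_rpow (hrd y r hr k) hδ0.le).trans (le_of_eq ?_)
            rw [ENNReal.mul_rpow_of_nonneg _ _ hδ0.le, ENNReal.coe_rpow_of_nonneg _ hδ0.le]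
            simp only [← ENNReal.rpow_natCast, ← ENNReal.rpow_mul, mul_comm δ]
          have h2 : ν (ball y (2 ^ k * r)) ^ δ * ν (ball y (2 ^ k * r)) ^ (-(1 / q.toReal)) ≤
              Cr * ∏ j, weightMeasure (ω j) (ball y (2 ^ k * r)) ^
                (q.toReal / (Q j).toReal * β) := by
            rw [← ENNReal.rpow_add _ _ (hν0 y _ hk) (hνA.ball_ne_top y _), ← hβδ,
              add_neg_cancel_right]
            exact hrh y _ hk
          simp only [hG, Finset.prod_mul_distrib]
          set F := ∏ j, eLpNorm (f j) (Q j) ((weightMeasure (ω j)).restrict (ball y (2 ^ k * r)))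
          calc _ ≤ (((κ ^ δ : ℝ≥0) : ℝ≥0∞) ^ k * ν (ball y (2 ^ k * r)) ^ δ) *
                (((k : ℝ≥0∞) + 1) ^ (m + 1) *
                  (ν (ball y (2 ^ k * r)) ^ (-(1 / q.toReal)) * F)) := by gcongr
            _ = a k * F * (ν (ball y (2 ^ k * r)) ^ δ *
                ν (ball y (2 ^ k * r)) ^ (-(1 / q.toReal))) := by simp only [a]; ring
            _ ≤ a k * F * _ := mul_le_mul_right h2 _
            _ = _ := by ring
      _ = _ := by ring
  have hser : eLpNorm (fun y => ∑' k, a k * ∏ j, G j (2 ^ k * r) y) p volume ≤ Ct * M := by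
    refine hts _ (fun k => (Finset.measurable_fun_prod _ fun j _ => hGm j _).aemeasurable) M
      fun k => ?_
    refine (eLpNorm_prod_le hpz hPz hps htop fun j => (hGm j _).aemeasurable).trans ?_
    exact Finset.prod_le_prod' fun j _ => hGn j _ (by positivity)
  have hKt : K + ∏ j, bmoNorm (b j) ≠ ∞ :=
    ENNReal.add_ne_top.2 ⟨by simp, ENNReal.prod_ne_top fun j _ => (hb j).2.ne⟩
  have hct : Cl * (K + ∏ j, bmoNorm (b j)) * Cr ≠ ∞ := by finiteness
  lift Cl * (K + ∏ j, bmoNorm (b j)) * Cr to ℝ≥0 using hct with c hc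
  refine (eLpNorm_le_mul_eLpNorm_of_ae_le_mul' (c := c)
    (g := fun y => ∑' k, a k * ∏ j, G j (2 ^ k * r) y) ?_ p).trans ?_
  · filter_upwards [hpt] with y hy
    exact hy
  · calc _ ≤ (c : ℝ≥0∞) * (Ct * M) := by gcongr
      _ = _ := by rw [hc]; ring

lemma HasLocalExpansion.enorm {ε : Type*} [ENorm ε] {D : Fin m → Submodule 𝕜 (E n → 𝕜)}
    {b : Fin m → E n → 𝕜} {S : (Fin m → E n → 𝕜) → E n → ℝ≥0∞} {U : (Fin m → E n → 𝕜) → E n → ε}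
    (h : HasLocalExpansion D b S U) : HasLocalExpansion D b S fun f x => ‖U f x‖ₑ :=
  fun f hf x₀ r c => by simpa only [enorm_eq_self] using h f hf x₀ r c

lemma LebesgueBounded.enorm {dom : Set (Fin m → E n → 𝕜)} {U : (Fin m → E n → 𝕜) → E n → 𝕜}
    {Q : Fin m → ℝ≥0∞} {q : ℝ≥0∞} {ν : E n → ℝ} {K : ℝ≥0∞} (h : LebesgueBounded dom U Q q ω ν K) :
    LebesgueBounded dom (fun f x => ‖U f x‖ₑ) Q q ω ν K := fun f hf hfm =>
  have h1 := h f hf hfm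
  ⟨⟨h1.1.1.enorm.aestronglyMeasurable, by rw [eLpNorm_enorm]; exact h1.1.2⟩,
    by rw [eLpNorm_enorm]; exact h1.2⟩

lemma amalgamNorm_enorm {q p α : ℝ≥0∞} (ω₁ ω₂ : E n → ℝ) (f : E n → 𝕜) :
    amalgamNorm q p α ω₁ ω₂ (fun x => ‖f x‖ₑ) = amalgamNorm q p α ω₁ ω₂ f := by
  simp only [amalgamNorm, eLpNorm_enorm]

end Main

end Amalgam

end

/-! ### The theorem: both cases reduced to the operator $|\mathcal T_{\Pi\vec b}|$ -/

open Amalgam in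
theorem mainTheorem3 {𝕜 : Type*} [RCLike 𝕜] {n m : ℕ} (hn : 0 < n) (hm : 0 < m)
    (s : ℝ) (Q A P : Fin m → ℝ≥0∞) (q α p : ℝ≥0∞)
    (hs : 1 ≤ s) (hsQ : ∀ j, ENNReal.ofReal s < Q j) (hQA : ∀ j, Q j ≤ A j)
    (hAP : ∀ j, A j < P j)
    (hq : 1 / q = ∑ j, 1 / Q j) (hα : 1 / α = ∑ j, 1 / A j) (hp : 1 / p = ∑ j, 1 / P j)
    (hαq : ∀ j, α / A j = q / Q j) (hpq : p ≠ ∞ → ∀ j, p / P j = q / Q j)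
    (ω : Fin m → E n → ℝ)
    (hω : MemAVec (fun j => (Q j).toReal / s) ω) (hω_inf : ∀ j, MemAInfty (ω j))
    (C₁ : ℝ≥0) :
    ∃ C : ℝ≥0, ∀ D : Fin m → Submodule 𝕜 (E n → 𝕜), IsOperatorDomain D →
      ∀ b : Fin m → E n → 𝕜, (∀ j, MemBMO (b j)) → ∀ K : ℝ≥0,
        -- `m`-linear operators
        (∀ T : (Fin m → E n → 𝕜) → E n → 𝕜,
          IsMultilinearOn D T → SizeCondition D (fun f x => ‖T f x‖ₑ) s C₁ →
          LebesgueBounded (commutatorDomain D b) (iteratedCommutator b T) Q q ω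
            (multiWeight q.toReal (fun j => (Q j).toReal) ω) K →
          AmalgamBounded (commutatorDomain D b) (iteratedCommutator b T) Q P A q p α ω
            (multiWeight q.toReal (fun j => (Q j).toReal) ω)
            (C * (K + ∏ j, bmoNorm (b j)))) ∧
        -- `m`-sublinear operators
        (∀ S : (Fin m → E n → 𝕜) → E n → ℝ≥0∞,
          IsMultisublinearOn D S → SizeCondition D S s C₁ →
          (∀ f ∈ commutatorDomain D b,
            AEStronglyMeasurable (sublinearIteratedCommutator b S f) volume) →
          LebesgueBounded (commutatorDomain D b) (sublinearIteratedCommutator b S) Q q ω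
            (multiWeight q.toReal (fun j => (Q j).toReal) ω) K →
          AmalgamBounded (commutatorDomain D b) (sublinearIteratedCommutator b S) Q P A q p α ω
            (multiWeight q.toReal (fun j => (Q j).toReal) ω)
            (C * (K + ∏ j, bmoNorm (b j)))) := by
  obtain ⟨C, h⟩ := exists_amalgamNorm_le 𝕜 hn hm s Q A P q α p hs hsQ hQA hAP hq hα hp hαq hpq hω
    hω_inf C₁
  refine ⟨C, fun D hD b hb K => ?_⟩
  have hbm : ∀ j, AEStronglyMeasurable (b j) volume := fun j => (hb j).1.aestronglyMeasurable
  have hfin : ∀ f : Fin m → E n → 𝕜, (∀ j, MemAmalgam (Q j) (P j) (A j) (ω j) (f j)) →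
      C * (K + ∏ j, bmoNorm (b j)) * ∏ j, amalgamNorm (Q j) (P j) (A j) (ω j) (ω j) (f j) < ∞ :=
    fun f hf => ENNReal.mul_lt_top (ENNReal.mul_lt_top (by simp) (ENNReal.add_lt_top.2
      ⟨by simp, ENNReal.prod_lt_top fun j _ => (hb j).2⟩)) (ENNReal.prod_lt_top fun j _ => (hf j).2)
  constructor
  · intro T hT hS hbdd f hf hfa
    have hle := h D hD b hb K _ _ hS (hT.hasLocalExpansion hD hbm).enorm hbdd.enorm f hf hfa
    rw [amalgamNorm_enorm] at hle
    exact ⟨⟨hT.aestronglyMeasurable_iteratedCommutator hbm hf, hle.trans_lt (hfin f hfa)⟩, hle⟩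
  · intro S hS hsize hmeas hbdd f hf hfa
    have hle := h D hD b hb K S _ hsize (hS.hasLocalExpansion hD) hbdd f hf hfa
    exact ⟨⟨hmeas f hf, hle.trans_lt (hfin f hfa)⟩, hle⟩
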